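/- There are a streaming algorithm (one fixed finite program), natural numbers $K, k$ and an absolute constant $C$ such that the following holds for every dimension $d \ge 1$ and every stream of points $z_1, z_2, \dots \in \mathbb{R}^d$ (the length of the stream is not known to the algorithm). **Model.** The algorithm runs on a real RAM with unit-cost arithmetic ($+,-,\times,\div$) and comparisons of reals, unit-cost integer index operations, and indirect addressing. It receives $d$ at the start and then the points one at a time. After receiving $z_t$ it outputs a center $c_t \in \mathbb{R}^d$, a scaling factor $\alpha_t \in (0,1]$, and one irrevocable decision: select the index $t$ or not. It keeps nothing between the points except its memory of at most $K d^2$ real numbers and a fixed number of index registers with values at most $K d^2$. For every $n \ge 1$, its total running time on the first $n$ points is $\widetilde O(nd^2)$, namely at most $C\, n d^2 (1+\log(nd))^k$. **Coreset guarantee.** Let $S_t$ be the set of indices selected among $1,\dots,t$. Then $S_0=\varnothing$, each $S_t$ is either $S_{t-1}$ or $S_{t-1}\cup\{t\}$, and for every $t\ge 1$ $$\operatorname{conv}\{z_i : i\in S_t\} \subseteq \operatorname{conv}\{z_1,\dots,z_t\} \subseteq c_t + \frac1{\alpha_t}\bigl(\operatorname{conv}\{z_i : i\in S_t\} - c_t\bigr).$$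 **Size and approximation bounds.** Write $Z_t=\operatorname{conv}\{z_1,\dots,z_t\}$ and let $d_t$ be the dimension of the affine span of $z_1,\dots,z_t$. Let $R_t$ be the circumradius of $Z_t$ (the smallest radius of a ball containing $Z_t$). Let $r_t$ be the inradius of $Z_t$, that is, the largest $r$ for which some $c$ satisfies $c + r\,(B_2^d\cap \operatorname{span}(Z_t-c))\subseteq Z_t$, where $B_2^d$ is the closed unit ball. Let $\kappa_t=\max R_t/r_{t'}$, the maximum being over all $t'\le t$ with $d_{t'}\ge 1$. Then for every $t\ge1$: * if $d_t\ge 2$, then $\dfrac1{\alpha_t}\le C\, d_t\log(d_t\,\kappa_t)$ and $|S_t|\le C\, d_t\log\kappa_t$; * if $d_t=1$, then $\dfrac1{\alpha_t}\le C(1+\log\kappa_t)$ and $|S_t|\le C(1+\log\kappa_t)$; * if $d_t=0$, then $\dfrac1{\alpha_t}\le C$ and $|S_t|\le C$; * if $d_t\ge1$ and $z_1,\dots,z_t$ have integer coordinates in $[-N,N]$, where $N$ is a natural number with $dN\ge2$, then $\dfrac1{\alpha_t}\le C\, d_t\log(dN)$ and $|S_t|\le C\, d_t\log(dN)$. -/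

import Mathlib

/-! ## A real RAM for streaming algorithms

Programs are finite and do not depend on the dimension, on the length of the stream or on the data.
A machine state has index registers (natural numbers, used for addressing and loop control) and
a memory of real cells.  The only real operations are the field operations and comparison. -/

namespace RealRAM

/-- A machine state: index registers and real memory cells. -/
structure State where
  reg : ℕ → ℕ
  mem : ℕ → ℝ

/-- Index expressions. -/
inductive IExpr where
  | const (n : ℕ)
  | reg (x : ℕ)
  | add (a b : IExpr)
  | sub (a b : IExpr)
  | mul (a b : IExpr)

/-- Real expressions; `load a` is the content of the cell with (computed) address `a`. -/
inductive RExpr where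
  | const (q : ℤ)
  | load (a : IExpr)
  | add (a b : RExpr)
  | sub (a b : RExpr)
  | mul (a b : RExpr)
  | div (a b : RExpr)

/-- Tests: comparison of two indices or of two reals. -/
inductive Test where
  | ilt (a b : IExpr)
  | rlt (a b : RExpr)

/-- Programs. -/
inductive Cmd where
  | skip
  | setReg (x : ℕ) (e : IExpr)
  | store (a : IExpr) (e : RExpr)
  | seq (p q : Cmd)
  | ite (b : Test) (p q : Cmd)
  | whileDo (b : Test) (p : Cmd)

def IExpr.eval (s : State) : IExpr → ℕ
  | .const n => n
  | .reg x => s.reg x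
  | .add a b => a.eval s + b.eval s
  | .sub a b => a.eval s - b.eval s
  | .mul a b => a.eval s * b.eval s

/-- Number of unit-cost operations in the evaluation of an index expression. -/
def IExpr.cost : IExpr → ℕ
  | .const _ => 1
  | .reg _ => 1
  | .add a b => a.cost + b.cost + 1
  | .sub a b => a.cost + b.cost + 1
  | .mul a b => a.cost + b.cost + 1

noncomputable def RExpr.eval (s : State) : RExpr → ℝ
  | .const q => (q : ℝ)
  | .load a => s.mem (a.eval s)
  | .add a b => a.eval s + b.eval s
  | .sub a b => a.eval s - b.eval s
  | .mul a b => a.eval s * b.eval s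
  | .div a b => a.eval s / b.eval s

/-- Number of unit-cost operations in the evaluation of a real expression. -/
def RExpr.cost : RExpr → ℕ
  | .const _ => 1
  | .load a => a.cost + 1
  | .add a b => a.cost + b.cost + 1
  | .sub a b => a.cost + b.cost + 1
  | .mul a b => a.cost + b.cost + 1
  | .div a b => a.cost + b.cost + 1

/-- The evaluation reads only the cells `0, …, M - 1` and never divides by zero. -/
def RExpr.Valid (M : ℕ) (s : State) : RExpr → Prop
  | .const _ => True
  | .load a => a.eval s < M
  | .add a b => a.Valid M s ∧ b.Valid M s
  | .sub a b => a.Valid M s ∧ b.Valid M s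
  | .mul a b => a.Valid M s ∧ b.Valid M s
  | .div a b => a.Valid M s ∧ b.Valid M s ∧ b.eval s ≠ 0

def Test.Holds (s : State) : Test → Prop
  | .ilt a b => a.eval s < b.eval s
  | .rlt a b => a.eval s < b.eval s

def Test.cost : Test → ℕ
  | .ilt a b => a.cost + b.cost + 1
  | .rlt a b => a.cost + b.cost + 1

def Test.Valid (M : ℕ) (s : State) : Test → Prop
  | .ilt _ _ => True
  | .rlt a b => a.Valid M s ∧ b.Valid M s

def State.setReg (s : State) (x v : ℕ) : State := { s with reg := Function.update s.reg x v }

noncomputable def State.store (s : State) (a : ℕ) (v : ℝ) : State :=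
  { s with mem := Function.update s.mem a v }

/-- `Exec M p s k s'`: on a machine with `M` real cells, whose index registers hold values at most
`M`, program `p` started in state `s` halts in state `s'` after exactly `k` steps.  An access to a
cell outside the memory, a division by zero, or an index exceeding `M` has no rule: the machine
crashes. -/
inductive Exec (M : ℕ) : Cmd → State → ℕ → State → Prop
  | skip (s : State) : Exec M .skip s 1 s
  | setReg (s : State) (x : ℕ) (e : IExpr) (he : e.eval s ≤ M) :
      Exec M (.setReg x e) s (e.cost + 1) (s.setReg x (e.eval s))
  | store (s : State) (a : IExpr) (e : RExpr) (ha : a.eval s < M) (he : e.Valid M s) :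
      Exec M (.store a e) s (a.cost + e.cost + 1) (s.store (a.eval s) (e.eval s))
  | seq {p q : Cmd} {s s' s'' : State} {k l : ℕ} (hp : Exec M p s k s') (hq : Exec M q s' l s'') :
      Exec M (.seq p q) s (k + l) s''
  | iteTrue {b : Test} {p q : Cmd} {s s' : State} {k : ℕ} (hv : b.Valid M s) (hb : b.Holds s)
      (hp : Exec M p s k s') : Exec M (.ite b p q) s (b.cost + k) s'
  | iteFalse {b : Test} {p q : Cmd} {s s' : State} {k : ℕ} (hv : b.Valid M s) (hb : ¬ b.Holds s)
      (hq : Exec M q s k s') : Exec M (.ite b p q) s (b.cost + k) s'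
  | whileTrue {b : Test} {p : Cmd} {s s' s'' : State} {k l : ℕ} (hv : b.Valid M s)
      (hb : b.Holds s) (hp : Exec M p s k s') (hw : Exec M (.whileDo b p) s' l s'') :
      Exec M (.whileDo b p) s (b.cost + k + l) s''
  | whileFalse {b : Test} {p : Cmd} {s : State} (hv : b.Valid M s) (hb : ¬ b.Holds s) :
      Exec M (.whileDo b p) s b.cost s

/-- The machine is deterministic: the final state and the number of steps are determined. -/
theorem Exec.deterministic {M : ℕ} {p : Cmd} {s s₁ s₂ : State} {k₁ k₂ : ℕ}
    (h₁ : Exec M p s k₁ s₁) (h₂ : Exec M p s k₂ s₂) : k₁ = k₂ ∧ s₁ = s₂ := by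
  induction h₁ generalizing k₂ s₂ with
  | skip s => cases h₂; exact ⟨rfl, rfl⟩
  | setReg s x e he => cases h₂; exact ⟨rfl, rfl⟩
  | store s a e ha he => cases h₂; exact ⟨rfl, rfl⟩
  | seq hp hq ihp ihq =>
    cases h₂ with
    | seq hp' hq' =>
      obtain ⟨rfl, rfl⟩ := ihp hp'
      obtain ⟨rfl, rfl⟩ := ihq hq'
      exact ⟨rfl, rfl⟩
  | iteTrue hv hb hp ih =>
    cases h₂ with
    | iteTrue _ _ hp' => obtain ⟨rfl, rfl⟩ := ih hp'; exact ⟨rfl, rfl⟩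
    | iteFalse _ hb' _ => exact absurd hb hb'
  | iteFalse hv hb hq ih =>
    cases h₂ with
    | iteTrue _ hb' _ => exact absurd hb' hb
    | iteFalse _ _ hq' => obtain ⟨rfl, rfl⟩ := ih hq'; exact ⟨rfl, rfl⟩
  | whileTrue hv hb hp hw ihp ihw =>
    cases h₂ with
    | whileTrue _ _ hp' hw' =>
      obtain ⟨rfl, rfl⟩ := ihp hp'
      obtain ⟨rfl, rfl⟩ := ihw hw'
      exact ⟨rfl, rfl⟩
    | whileFalse _ hb' => exact absurd hb hb'
  | whileFalse hv hb =>
    cases h₂ with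
    | whileTrue _ hb' _ _ => exact absurd hb' hb
    | whileFalse _ _ => exact ⟨rfl, rfl⟩

/-- A streaming algorithm: a program that is run once before the stream starts, and a program that
is run after the arrival of each point. -/
structure StreamAlg where
  init : Cmd
  step : Cmd

/-- The state in which the machine is started: register `0` holds the dimension `d`, everything
else is `0`. -/
def State.start (d : ℕ) : State where
  reg := fun x => if x = 0 then d else 0
  mem := fun _ => 0

/-- The arrival of a point: its coordinates are written to the cells `0, …, d - 1`. -/
noncomputable def State.receive {d : ℕ} (s : State) (x : EuclideanSpace ℝ (Fin d)) : State where
  reg := s.reg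
  mem := fun j => if h : j < d then x ⟨j, h⟩ else s.mem j

/-- `IsRun A M z σ τ`: on the stream `z 1, z 2, …` and with `M` real cells, the algorithm `A` is in
state `σ t` after it has processed the points `z 1, …, z t`; the initialisation takes `τ 0` steps
and the processing of `z t` takes `τ t` steps.  Nothing is kept between the points
except the machine state. -/
def IsRun (A : StreamAlg) (M : ℕ) {d : ℕ} (z : ℕ → EuclideanSpace ℝ (Fin d))
    (σ : ℕ → State) (τ : ℕ → ℕ) : Prop :=
  Exec M A.init (State.start d) (τ 0) (σ 0) ∧
    ∀ t : ℕ, Exec M A.step ((σ t).receive (z (t + 1))) (τ (t + 1)) (σ (t + 1))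

/-- Total running time on the first `n` points, with `d` steps charged for the arrival of each. -/
def totalTime (d : ℕ) (τ : ℕ → ℕ) (n : ℕ) : ℕ :=
  τ 0 + ∑ t ∈ Finset.Icc 1 n, (d + τ t)

/-- The center, output in the cells `d, …, 2 d - 1`. -/
noncomputable def State.center (d : ℕ) (s : State) : EuclideanSpace ℝ (Fin d) :=
  WithLp.toLp 2 (fun i : Fin d => s.mem (d + i))

/-- The scaling factor, output in the cell `2 d`. -/
def State.scale (d : ℕ) (s : State) : ℝ := s.mem (2 * d)

/-- The set of selected indices: `t` is selected, irrevocably and on arrival, if and only if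
register `1` is nonzero after `z t` has been processed. -/
def coreset (σ : ℕ → State) : ℕ → Finset ℕ
  | 0 => ∅
  | t + 1 => if (σ (t + 1)).reg 1 = 0 then coreset σ t else coreset σ t ∪ {t + 1}

end RealRAM

/-! ## Geometry of the stream -/

/-- The inradius of `K`: the largest `r` such that some `c` satisfies
`c + r • (B ∩ span (K - c)) ⊆ K`, with `B` the closed unit ball. -/
noncomputable def inradius {d : ℕ} (K : Set (EuclideanSpace ℝ (Fin d))) : ℝ :=
  sSup {r : ℝ | 0 ≤ r ∧ ∃ c : EuclideanSpace ℝ (Fin d),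
    ∀ v ∈ Submodule.span ℝ ((fun x => x - c) '' K), ‖v‖ ≤ 1 → c + r • v ∈ K}

/-- The circumradius of `K`: the smallest radius of a ball that contains `K`. -/
noncomputable def circumradius {d : ℕ} (K : Set (EuclideanSpace ℝ (Fin d))) : ℝ :=
  sInf {R : ℝ | 0 ≤ R ∧ ∃ c : EuclideanSpace ℝ (Fin d), K ⊆ Metric.closedBall c R}

/-- The convex hull of the points with index in `T`. -/
def hullOf {d : ℕ} (z : ℕ → EuclideanSpace ℝ (Fin d)) (T : Finset ℕ) :
    Set (EuclideanSpace ℝ (Fin d)) :=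
  convexHull ℝ (z '' (T : Set ℕ))

/-- The dimension of the affine span of `z 1, …, z t`. -/
noncomputable def dimAt {d : ℕ} (z : ℕ → EuclideanSpace ℝ (Fin d)) (t : ℕ) : ℕ :=
  Module.finrank ℝ (affineSpan ℝ (z '' (Finset.Icc 1 t : Set ℕ))).direction

/-- The maximum over `t' ≤ t` of the ratio of the circumradius of `z 1, …, z t` to the inradius of
`z 1, …, z t'`.  Times `t'` at which all points coincide, where every `r` is admissible in
the definition of the inradius, do not count.  The set is finite, and it is nonempty
as soon as `z 1, …, z t` do not all coincide. -/
noncomputable def maxAspect {d : ℕ} (z : ℕ → EuclideanSpace ℝ (Fin d)) (t : ℕ) : ℝ :=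
  sSup {x : ℝ | ∃ t' ∈ Finset.Icc 1 t, 1 ≤ dimAt z t' ∧
    x = circumradius (hullOf z (Finset.Icc 1 t)) / inradius (hullOf z (Finset.Icc 1 t'))}

/-! The algorithm selects $z_t$ unless it is an affine combination $\sum c_j z_j$ of the points
selected so far with $\sum c_j^2\le 1$. It outputs the centroid $c$ of the $m$ selected points and
$\alpha=1/(m+1)$.

Why the hull is covered (`IsSelection.hullOf_subset`): $\sum c_j^2\le1$ forces $c_j\ge-1$. Since
$mc=\sum z_j$, the contracted point $c+\alpha(z_t-c)$ equals $\sum\alpha(1+c_j)z_j$, a convex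
combination of selected points. Hence $1/\alpha=m+1$, and every bound reduces to a bound on $m$.

Why $m$ is small (`two_pow_mul_det_scatter_le`): lift the points to a hyperplane off the origin, so
that affine combinations become linear ones. Call a selected index basic if its lift is outside the
span of the earlier ones; there are $D=d_t+1$ of these. Start from the scatter matrix $\sum
vv^{\mathsf T}$ of the basic lifts and add the other selected lifts in order of arrival. Each
multiplies the determinant by $1+x^{\mathsf T}A^{-1}x$, where the quadratic term is the sum of
squares of a representation by earlier selected points. By the selection rule it exceeds $1$, so the
determinant at least doubles. By AM-GM the final determinant is at most $(\sum\|v_i\|^2/D)^D$, while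
the initial one is the product of the squared Gram-Schmidt heights. A lower bound on the heights
then gives $m=O(D(1+\log\kappa))$.

Why the heights are large: a basic point at height $g$ over its predecessors makes the hull so thin
that its inradius is at most $g/2$, whence $2R_t\le\kappa_t g$ (`IsSelection.aspect_facts`). For
integer points the Gram determinant is a positive integer (`one_le_prod_gramHeight_sq`).

Why $O(d^2)$ time and memory suffice: the rule needs only the projection $P$ onto the orthogonal
complement of the span of the selected lifts, and a matrix $Q$ whose form on the span is the least
sum of squared coefficients. Both change by low-rank updates (`SpanForm.insert_new`,
`SpanForm.insert_old`). The rest is the verification of the program. -/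

namespace RealRAM

/-! ### Total correctness with a time bound -/

/-- Started in `s`, the program halts within `T` steps in a state that satisfies `Φ`. -/
def Terminates (M : ℕ) (p : Cmd) (s : State) (T : ℕ) (Φ : State → Prop) : Prop :=
  ∃ k s', Exec M p s k s' ∧ k ≤ T ∧ Φ s'

theorem Terminates.mono {M : ℕ} {p : Cmd} {s : State} {T T' : ℕ} {Φ Ψ : State → Prop}
    (h : Terminates M p s T Φ) (hT : T ≤ T') (hΦ : ∀ s', Φ s' → Ψ s') :
    Terminates M p s T' Ψ := by
  obtain ⟨k, s', he, hk, hs⟩ := h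
  exact ⟨k, s', he, hk.trans hT, hΦ _ hs⟩

theorem Terminates.seq {M : ℕ} {p q : Cmd} {s : State} {T₁ T : ℕ} {Φ Ψ : State → Prop} (T₂ : ℕ)
    (hT : T₁ + T₂ ≤ T) (hp : Terminates M p s T₁ Ψ) (hq : ∀ s', Ψ s' → Terminates M q s' T₂ Φ) :
    Terminates M (.seq p q) s T Φ := by
  obtain ⟨k, s', he, hk, hs⟩ := hp
  obtain ⟨l, s'', he', hl, hs'⟩ := hq s' hs
  exact ⟨k + l, s'', .seq he he', by omega, hs'⟩

theorem Terminates.store {M : ℕ} {s : State} {a : IExpr} {e : RExpr} {Φ : State → Prop}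
    (ha : a.eval s < M) (he : e.Valid M s) (h : Φ (s.store (a.eval s) (e.eval s))) :
    Terminates M (.store a e) s (a.cost + e.cost + 1) Φ :=
  ⟨_, _, .store s a e ha he, le_rfl, h⟩

theorem Terminates.setReg {M : ℕ} {s : State} {x : ℕ} {e : IExpr} {Φ : State → Prop}
    (he : e.eval s ≤ M) (h : Φ (s.setReg x (e.eval s))) :
    Terminates M (.setReg x e) s (e.cost + 1) Φ :=
  ⟨_, _, .setReg s x e he, le_rfl, h⟩

theorem Terminates.ite {M : ℕ} {s : State} {b : Test} {p q : Cmd} {T : ℕ} {Φ : State → Prop}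
    (hv : b.Valid M s) (hp : b.Holds s → Terminates M p s T Φ)
    (hq : ¬ b.Holds s → Terminates M q s T Φ) :
    Terminates M (.ite b p q) s (b.cost + T) Φ := by
  by_cases hb : b.Holds s
  · obtain ⟨k, s', he, hk, hs⟩ := hp hb
    exact ⟨_, s', .iteTrue hv hb he, by omega, hs⟩
  · obtain ⟨k, s', he, hk, hs⟩ := hq hb
    exact ⟨_, s', .iteFalse hv hb he, by omega, hs⟩

/-- `for x = 0, …, n - 1 do p`. -/
def forLoop (x : ℕ) (n : IExpr) (p : Cmd) : Cmd :=
  .seq (.setReg x (.const 0))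
    (.whileDo (.ilt (.reg x) n) (.seq p (.setReg x (.add (.reg x) (.const 1)))))

/-- Time bound for a loop with `N` rounds, of which each takes `T` steps. -/
def loopTime (c N T : ℕ) : ℕ := N * (c + 6 + T) + c + 4

/-- The bound `n` is evaluated again before each round, so the invariant has to determine its value,
also at `i = N`, where the test fails. -/
theorem Terminates.forLoop {M x N T : ℕ} {n : IExpr} {p : Cmd} {s : State}
    (I : ℕ → State → Prop) (hN : N ≤ M) (h0 : I 0 (s.setReg x 0))
    (hI : ∀ i s', i ≤ N → I i s' → n.eval s' = N ∧ s'.reg x = i)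
    (hp : ∀ i s', i < N → I i s' →
      Terminates M p s' T (fun s'' => s''.reg x = i ∧ I (i + 1) (s''.setReg x (i + 1)))) :
    Terminates M (forLoop x n p) s (loopTime n.cost N T) (I N) := by
  have key : ∀ j i s', i + j = N → I i s' →
      Terminates M (.whileDo (.ilt (.reg x) n) (.seq p (.setReg x (.add (.reg x) (.const 1))))) s'
        (j * (n.cost + 6 + T) + n.cost + 2) (I N) := by
    intro j
    induction j with
    | zero =>
      intro i s' hi hs
      obtain rfl : i = N := by omega
      obtain ⟨h1, h2⟩ := hI i s' le_rfl hs
      refine ⟨_, s', .whileFalse (by trivial) (by simp [Test.Holds, IExpr.eval, h1, h2]), ?_, hs⟩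
      simp only [Test.cost, IExpr.cost]; omega
    | succ j ih =>
      intro i s' hi hs
      obtain ⟨h1, h2⟩ := hI i s' (by omega) hs
      obtain ⟨k, s₁, he, hk, hx, hs₁⟩ := hp i s' (by omega) hs
      obtain ⟨l, s₂, he₂, hl, hs₂⟩ := ih (i + 1) _ (by omega) hs₁
      have hset := Exec.setReg (M := M) s₁ x (.add (.reg x) (.const 1))
        (by simp [IExpr.eval, hx]; omega)
      rw [show (IExpr.add (.reg x) (.const 1)).eval s₁ = i + 1 by simp [IExpr.eval, hx]] at hset
      refine ⟨_, s₂, .whileTrue (by trivial) ?_ (.seq he hset) he₂, ?_, hs₂⟩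
      · simp only [Test.Holds, IExpr.eval, h1, h2]; omega
      · simp only [Test.cost, IExpr.cost, add_mul, one_mul]
        omega
  have h1 : Terminates M (.setReg x (.const 0)) s 2 (fun s' => s' = s.setReg x 0) :=
    .setReg (by simp [IExpr.eval]) rfl
  refine h1.seq _ ?_ (fun s' hs' => key N 0 s' (by omega) (hs' ▸ h0))
  unfold loopTime; omega

/-- A loop that fills the cells `A, …, A + N - 1`. -/
theorem Terminates.fill {M x N A : ℕ} {n a : IExpr} {e : RExpr} {s : State} (f : ℕ → ℝ)
    (hN : N ≤ M) (hA : A + N ≤ M)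
    (H : ∀ i s', i ≤ N → (∀ y, y ≠ x → s'.reg y = s.reg y) → s'.reg x = i →
      (∀ b, b < A ∨ A + i ≤ b → s'.mem b = s.mem b) →
      n.eval s' = N ∧ (i < N → a.eval s' = A + i ∧ e.Valid M s' ∧ e.eval s' = f i)) :
    Terminates M (RealRAM.forLoop x n (.store a e)) s (loopTime n.cost N (a.cost + e.cost + 1))
      (fun s' => (∀ y, y ≠ x → s'.reg y = s.reg y) ∧ (∀ i < N, s'.mem (A + i) = f i) ∧
        ∀ b, b < A ∨ A + N ≤ b → s'.mem b = s.mem b) := by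
  refine (Terminates.forLoop (fun i s' => (∀ y, y ≠ x → s'.reg y = s.reg y) ∧ s'.reg x = i ∧
    (∀ j < i, s'.mem (A + j) = f j) ∧
        ∀ b, b < A ∨ A + i ≤ b → s'.mem b = s.mem b) hN ?_ ?_ ?_).mono le_rfl ?_
  · refine ⟨fun y hy => by simp [State.setReg, hy], by simp [State.setReg], by simp,
      fun b _ => rfl⟩
  · rintro i s' hi ⟨h1, h2, -, h4⟩
    exact ⟨(H i s' hi h1 h2 h4).1, h2⟩
  · rintro i s' hi ⟨h1, h2, h3, h4⟩
    obtain ⟨ha, hv, he⟩ := (H i s' hi.le h1 h2 h4).2 hi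
    refine .store (by omega) hv ?_
    rw [ha, he]
    refine ⟨h2, fun y hy => by simp [State.setReg, State.store, hy, h1], by simp [State.setReg],
      fun j hj => ?_, fun b hb => ?_⟩
    · by_cases hji : j = i
      · simp [State.setReg, State.store, hji]
      · simp [State.setReg, State.store, hji, h3 j (by omega)]
    · have : b ≠ A + i := by omega
      simp only [State.setReg, State.store, Function.update_of_ne this]
      exact h4 b (by omega)
  · rintro s' ⟨h1, -, h3, h4⟩
    exact ⟨h1, h3, h4⟩

/-- A loop that accumulates a sum in the cell `A`. -/
theorem Terminates.accumulate {M x N A : ℕ} {n a : IExpr} {e : RExpr} {s : State} (f : ℕ → ℝ)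
    (hN : N ≤ M) (hA : A < M)
    (H : ∀ i s', i ≤ N → (∀ y, y ≠ x → s'.reg y = s.reg y) → s'.reg x = i →
      (∀ b, b ≠ A → s'.mem b = s.mem b) →
      n.eval s' = N ∧ (i < N → a.eval s' = A ∧ e.Valid M s' ∧ e.eval s' = s'.mem A + f i)) :
    Terminates M (RealRAM.forLoop x n (.store a e)) s (loopTime n.cost N (a.cost + e.cost + 1))
      (fun s' => (∀ y, y ≠ x → s'.reg y = s.reg y) ∧
        s'.mem A = s.mem A + ∑ i ∈ Finset.range N, f i ∧
        ∀ b, b ≠ A → s'.mem b = s.mem b) := by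
  refine (Terminates.forLoop (fun i s' => (∀ y, y ≠ x → s'.reg y = s.reg y) ∧ s'.reg x = i ∧
    s'.mem A = s.mem A + ∑ j ∈ Finset.range i, f j ∧
        ∀ b, b ≠ A → s'.mem b = s.mem b) hN ?_ ?_ ?_).mono le_rfl ?_
  · refine ⟨fun y hy => by simp [State.setReg, hy], by simp [State.setReg], by simp [State.setReg],
      fun b _ => rfl⟩
  · rintro i s' hi ⟨h1, h2, -, h4⟩
    exact ⟨(H i s' hi h1 h2 h4).1, h2⟩
  · rintro i s' hi ⟨h1, h2, h3, h4⟩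
    obtain ⟨ha, hv, he⟩ := (H i s' hi.le h1 h2 h4).2 hi
    refine .store (by omega) hv ?_
    rw [ha, he]
    refine ⟨h2, fun y hy => by simp [State.setReg, State.store, hy, h1], by simp [State.setReg],
      ?_, fun b hb => ?_⟩
    · simp [State.setReg, State.store, h3, Finset.sum_range_succ, add_assoc]
    · simp only [State.setReg, State.store, Function.update_of_ne hb]
      exact h4 b hb
  · rintro s' ⟨h1, -, h3, h4⟩
    exact ⟨h1, h3, h4⟩

/-- A double loop that fills an `N × N` matrix, stored by rows from the cell `A` on. -/
theorem Terminates.fillMatrix {M N A x y : ℕ} {n a : IExpr} {e : RExpr} {s : State}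
    (f : ℕ → ℕ → ℝ) (hxy : x ≠ y) (hN : N ≤ M) (hA : A + N * N ≤ M)
    (H : ∀ i j s', i ≤ N → j ≤ N → (∀ u, u ≠ x → u ≠ y → s'.reg u = s.reg u) → s'.reg x = i →
      (s'.reg y = j ∨ j = 0) → (∀ b, b < A ∨ A + (i * N + j) ≤ b → s'.mem b = s.mem b) →
      n.eval s' = N ∧
        (i < N → s'.reg y = j → j < N →
          a.eval s' = A + (i * N + j) ∧ e.Valid M s' ∧ e.eval s' = f i j)) :
    Terminates M (RealRAM.forLoop x n (RealRAM.forLoop y n (.store a e))) s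
      (loopTime n.cost N (loopTime n.cost N (a.cost + e.cost + 1)))
      (fun s' => (∀ u, u ≠ x → u ≠ y → s'.reg u = s.reg u) ∧
        (∀ i < N, ∀ j < N, s'.mem (A + (i * N + j)) = f i j) ∧
        ∀ b, b < A ∨ A + N * N ≤ b → s'.mem b = s.mem b) := by
  refine (Terminates.forLoop (fun i s' => (∀ u, u ≠ x → u ≠ y → s'.reg u = s.reg u) ∧
      s'.reg x = i ∧ (∀ k < i, ∀ j < N, s'.mem (A + (k * N + j)) = f k j) ∧
      ∀ b, b < A ∨ A + i * N ≤ b → s'.mem b = s.mem b) hN ?_ ?_ ?_).mono le_rfl ?_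
  · exact ⟨fun u hu _ => by simp [State.setReg, hu], by simp [State.setReg], by simp,
      fun b _ => rfl⟩
  · rintro i s' hi ⟨h1, h2, -, h4⟩
    -- The outer test is made while register `y` still holds a leftover value; the alternative `j =
    -- 0` in `H` exists for this use.
    exact ⟨(H i 0 s' hi (Nat.zero_le _) h1 h2 (Or.inr rfl) (by simpa using h4)).1, h2⟩
  · rintro i s' hi ⟨h1, h2, h3, h4⟩
    have hiN : i * N + N ≤ N * N := by nlinarith
    refine (Terminates.fill (A := A + i * N) (f i) hN (by omega) ?_).mono le_rfl ?_
    · intro j s'' hj g1 g2 g3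
      have := H i j s'' hi.le hj (fun u hu hu' => by rw [g1 u hu', h1 u hu hu'])
        (by rw [g1 x hxy, h2]) (Or.inl g2)
        (fun b hb => by rw [g3 b (by omega), h4 b (by omega)])
      exact ⟨this.1, fun hjN => by rw [add_assoc]; exact this.2 hi g2 hjN⟩
    · rintro s'' ⟨g1, g2, g3⟩
      refine ⟨by rw [g1 x hxy, h2], fun u hu hu' => ?_, by simp [State.setReg], ?_, ?_⟩
      · simp [State.setReg, hu, g1 u hu', h1 u hu hu']
      · intro k hk j hj
        change s''.mem _ = _
        by_cases hki : k = i
        · rw [hki, ← add_assoc, g2 j hj]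
        · have : k * N + N ≤ i * N := by
            have : k + 1 ≤ i := by omega
            nlinarith
          rw [g3 _ (by omega), h3 k (by omega) j hj]
      · intro b hb
        change s''.mem b = _
        rw [add_mul, one_mul] at hb
        rw [g3 b (by omega), h4 b (by omega)]
  · rintro s' ⟨h1, -, h3, h4⟩
    exact ⟨h1, h3, h4⟩

/-- A double loop that computes a matrix-vector product into the cells `A, …, A + N - 1`. -/
theorem Terminates.mulVec {M N A x y : ℕ} {n a : IExpr} {e : RExpr} {s : State}
    (f : ℕ → ℕ → ℝ) (hxy : x ≠ y) (hN : N ≤ M) (hA : A + N ≤ M)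
    (H : ∀ i s', i ≤ N → (∀ u, u ≠ x → u ≠ y → s'.reg u = s.reg u) → s'.reg x = i →
      (∀ b, b < A ∨ A + N ≤ b → s'.mem b = s.mem b) →
      n.eval s' = N ∧ (i < N → a.eval s' = A + i ∧ ∀ j, j < N → s'.reg y = j →
          e.Valid M s' ∧ e.eval s' = s'.mem (A + i) + f i j)) :
    Terminates M (RealRAM.forLoop x n
        (.seq (.store a (.const 0)) (RealRAM.forLoop y n (.store a e)))) s
      (loopTime n.cost N (a.cost + 2 + loopTime n.cost N (a.cost + e.cost + 1)))
      (fun s' => (∀ u, u ≠ x → u ≠ y → s'.reg u = s.reg u) ∧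
        (∀ i < N, s'.mem (A + i) = ∑ j ∈ Finset.range N, f i j) ∧
        ∀ b, b < A ∨ A + N ≤ b → s'.mem b = s.mem b) := by
  refine (Terminates.forLoop (fun i s' => (∀ u, u ≠ x → u ≠ y → s'.reg u = s.reg u) ∧
      s'.reg x = i ∧ (∀ k < i, s'.mem (A + k) = ∑ j ∈ Finset.range N, f k j) ∧
      ∀ b, b < A ∨ A + N ≤ b → s'.mem b = s.mem b) hN ?_ ?_ ?_).mono le_rfl ?_
  · exact ⟨fun u hu _ => by simp [State.setReg, hu], by simp [State.setReg], by simp,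
      fun b _ => rfl⟩
  · rintro i s' hi ⟨h1, h2, -, h4⟩
    exact ⟨(H i s' hi h1 h2 h4).1, h2⟩
  · rintro i s' hi ⟨h1, h2, h3, h4⟩
    have ha := ((H i s' hi.le h1 h2 h4).2 hi).1
    refine Terminates.seq _ (T₁ := a.cost + 2) le_rfl (Ψ := fun s'' => s'' = s'.store (A + i) 0) ?_ ?_
    · exact Terminates.mono (.store (e := .const 0) (by omega) trivial rfl) le_rfl
        (fun s'' h => by rw [← h, ha]; simp [RExpr.eval])
    rintro _ rfl
    refine (Terminates.accumulate (A := A + i) (f i) hN (by omega) ?_).mono le_rfl ?_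
    · intro j s'' hj g1 g2 g3
      have := H i s'' hi.le (fun u hu hu' => by rw [g1 u hu']; exact h1 u hu hu')
        (by rw [g1 x hxy]; exact h2)
        (fun b hb => by
          have : b ≠ A + i := by omega
          rw [g3 b this, ← h4 b hb]; simp only [State.store, Function.update_of_ne this])
      exact ⟨this.1, fun hjN => ⟨(this.2 hi).1, (this.2 hi).2 j hjN g2⟩⟩
    · rintro s'' ⟨g1, g2, g3⟩
      refine ⟨by rw [g1 x hxy]; exact h2, fun u hu hu' => ?_, by simp [State.setReg], ?_, ?_⟩
      · simp only [State.setReg, Function.update_of_ne hu, g1 u hu']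
        exact h1 u hu hu'
      · intro k hk
        change s''.mem _ = _
        by_cases hki : k = i
        · rw [hki, g2]; simp [State.store]
        · have : A + k ≠ A + i := by omega
          rw [g3 _ this, ← h3 k (by omega)]; simp only [State.store, Function.update_of_ne this]
      · intro b hb
        change s''.mem b = _
        have : b ≠ A + i := by omega
        rw [g3 b this, ← h4 b hb]; simp only [State.store, Function.update_of_ne this]
  · rintro s' ⟨h1, -, h3, h4⟩
    exact ⟨h1, h3, h4⟩

end RealRAM

namespace RealRAM

/-! ### The program

Layout of the memory: the current point in `0, …, d - 1`, the center in `d, …, 2 d - 1`, the scaling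
factor in `2 d`, the number of selected points in `2 d + 1`, two scalars in `2 d + 2` and `2 d + 3`,
three vectors with `d + 1` entries from `2 d + 4` on, and two square matrices of size `d + 1` from
`5 d + 7` on.  Register `1` is the output flag, registers `2` and `3` are loop counters. -/

/-- The dimension `d + 1` of the lifted points. -/
def ixN : IExpr := .add (.reg 0) (.const 1)

/-- The address `k * d + c`. -/
def ixLin (k c : ℕ) : IExpr := .add (.mul (.const k) (.reg 0)) (.const c)

/-- The address `k * d + c + i`, with the index `i` in register `x`. -/
def ixVec (k c x : ℕ) : IExpr := .add (ixLin k c) (.reg x)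

/-- Offset of the entry whose indices are in the registers `x` and `y`. -/
def ixEntry (x y : ℕ) : IExpr := .add (.mul (.reg x) ixN) (.reg y)

/-- Address in the first matrix. -/
def ixProj (x y : ℕ) : IExpr := .add (ixLin 5 7) (ixEntry x y)

/-- Address in the second matrix. -/
def ixForm (x y : ℕ) : IExpr := .add (.add (ixLin 5 7) (.mul ixN ixN)) (ixEntry x y)

/-- Set the first matrix to the identity matrix. -/
def initCmd : Cmd := forLoop 2 ixN (.store (ixProj 2 2) (.const 1))

/-- Compute the lifted point `v`, its images `P v` and `Q v`, and the values of both quadratic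
forms at `v`. -/
def prepareCmd : Cmd :=
  .seq (forLoop 2 (.reg 0) (.store (ixVec 2 4 2) (.load (.reg 2)))) <|
  .seq (.store (ixLin 3 4) (.const 1)) <|
  .seq (forLoop 2 ixN (.seq (.store (ixVec 3 5 2) (.const 0)) (forLoop 3 ixN
    (.store (ixVec 3 5 2)
      (.add (.load (ixVec 3 5 2)) (.mul (.load (ixProj 2 3)) (.load (ixVec 2 4 3)))))))) <|
  .seq (forLoop 2 ixN (.seq (.store (ixVec 4 6 2) (.const 0)) (forLoop 3 ixN
    (.store (ixVec 4 6 2)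
      (.add (.load (ixVec 4 6 2)) (.mul (.load (ixForm 2 3)) (.load (ixVec 2 4 3)))))))) <|
  .seq (.store (ixLin 2 2) (.const 0)) <|
  .seq (forLoop 2 ixN (.store (ixLin 2 2)
    (.add (.load (ixLin 2 2)) (.mul (.load (ixVec 2 4 2)) (.load (ixVec 3 5 2)))))) <|
  .seq (.store (ixLin 2 3) (.const 0)) <|
    forLoop 2 ixN (.store (ixLin 2 3)
      (.add (.load (ixLin 2 3)) (.mul (.load (ixVec 2 4 2)) (.load (ixVec 4 6 2)))))

/-- Update of the second matrix for a point outside the span. -/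
def formNewCmd : Cmd :=
  forLoop 2 ixN (forLoop 3 ixN (.store (ixForm 2 3)
    (.add (.sub (.load (ixForm 2 3))
      (.div (.add (.mul (.load (ixVec 3 5 2)) (.load (ixVec 4 6 3)))
        (.mul (.load (ixVec 4 6 2)) (.load (ixVec 3 5 3)))) (.load (ixLin 2 2))))
      (.div (.mul (.add (.const 1) (.load (ixLin 2 3)))
        (.mul (.load (ixVec 3 5 2)) (.load (ixVec 3 5 3))))
        (.mul (.load (ixLin 2 2)) (.load (ixLin 2 2)))))))

/-- Update of the first matrix for a point outside the span. -/
def projNewCmd : Cmd :=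
  forLoop 2 ixN (forLoop 3 ixN (.store (ixProj 2 3)
    (.sub (.load (ixProj 2 3))
      (.div (.mul (.load (ixVec 3 5 2)) (.load (ixVec 3 5 3))) (.load (ixLin 2 2))))))

/-- Update of the second matrix for a point in the span. -/
def formOldCmd : Cmd :=
  forLoop 2 ixN (forLoop 3 ixN (.store (ixForm 2 3)
    (.sub (.load (ixForm 2 3))
      (.div (.mul (.load (ixVec 4 6 2)) (.load (ixVec 4 6 3)))
        (.add (.const 1) (.load (ixLin 2 3)))))))

/-- Select the current point, and update the center and the scaling factor. -/
def selectCmd : Cmd :=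
  .seq (.store (ixLin 2 1) (.add (.load (ixLin 2 1)) (.const 1))) <|
  .seq (forLoop 2 (.reg 0) (.store (ixVec 1 0 2) (.add (.load (ixVec 1 0 2))
    (.div (.sub (.load (.reg 2)) (.load (ixVec 1 0 2))) (.load (ixLin 2 1)))))) <|
  .seq (.store (ixLin 2 0) (.div (.const 1) (.add (.load (ixLin 2 1)) (.const 1)))) <|
    .setReg 1 (.const 1)

/-- The treatment of a point. -/
def stepCmd : Cmd :=
  .seq prepareCmd <|
    .ite (.rlt (.const 0) (.load (ixLin 2 2)))
      (.seq formNewCmd (.seq projNewCmd selectCmd))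
      (.ite (.rlt (.const 1) (.load (ixLin 2 3)))
        (.seq formOldCmd selectCmd)
        (.setReg 1 (.const 0)))

/-- The streaming algorithm. -/
def coresetAlg : StreamAlg := ⟨initCmd, stepCmd⟩

/-! ### Addresses and specifications of the subroutines -/

section Eval
variable {s : State} {d : ℕ}

theorem eval_ixN (h : s.reg 0 = d) : ixN.eval s = d + 1 := by
  simp [ixN, IExpr.eval, h]

theorem eval_ixLin (h : s.reg 0 = d) (k c : ℕ) : (ixLin k c).eval s = k * d + c := by
  simp [ixLin, IExpr.eval, h]

theorem eval_ixVec (h : s.reg 0 = d) (k c x : ℕ) :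
    (ixVec k c x).eval s = k * d + c + s.reg x := by
  simp [ixVec, IExpr.eval, eval_ixLin h]

theorem eval_ixProj (h : s.reg 0 = d) (x y : ℕ) :
    (ixProj x y).eval s = 5 * d + 7 + (s.reg x * (d + 1) + s.reg y) := by
  simp [ixProj, ixEntry, IExpr.eval, eval_ixLin h, eval_ixN h]

theorem eval_ixForm (h : s.reg 0 = d) (x y : ℕ) :
    (ixForm x y).eval s =
      5 * d + 7 + (d + 1) * (d + 1) + (s.reg x * (d + 1) + s.reg y) := by
  simp [ixForm, ixEntry, IExpr.eval, eval_ixLin h, eval_ixN h]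

end Eval

/-- The left side is the total number of cells in the layout; equality at $d=1$ is the origin of the
memory constant $20$. -/
theorem layout_le {d : ℕ} (hd : 1 ≤ d) :
    5 * d + 7 + (d + 1) * (d + 1) + (d + 1) * (d + 1) ≤ 20 * d ^ 2 := by
  nlinarith

theorem entry_lt {i j n : ℕ} (hi : i < n) (hj : j < n) : i * n + j < n * n := by
  nlinarith

variable {d M : ℕ} {s : State}

/-- The center is kept as a running mean. Nonnegativity of the counter makes both divisions legal.
-/
theorem select_spec (h0 : s.reg 0 = d) (hM : 5 * d + 7 ≤ M) (hc : 0 ≤ s.mem (2 * d + 1)) :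
    Terminates M selectCmd s (10000 * (d + 1)) (fun s' => s'.reg 0 = d ∧ s'.reg 1 = 1 ∧
      s'.mem (2 * d + 1) = s.mem (2 * d + 1) + 1 ∧
      (∀ i < d, s'.mem (d + i) = s.mem (d + i) +
        (s.mem i - s.mem (d + i)) / (s.mem (2 * d + 1) + 1)) ∧
      s'.mem (2 * d) = 1 / (s.mem (2 * d + 1) + 1 + 1) ∧
      ∀ a, 5 * d + 7 ≤ a → s'.mem a = s.mem a) := by
  refine Terminates.seq (9000 * (d + 1)) ?_ (Ψ := fun s' => s' = s.store (2 * d + 1) (s.mem (2 * d + 1) + 1))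
    (.store ?_ ?_ ?_) ?_
  · simp only [ixLin, IExpr.cost, RExpr.cost]
    omega
  · rw [eval_ixLin h0]; omega
  · simp only [RExpr.Valid, eval_ixLin h0]; constructor <;> first | omega | trivial
  · simp [RExpr.eval, eval_ixLin h0]
  · rintro _ rfl
    set s₁ := s.store (2 * d + 1) (s.mem (2 * d + 1) + 1) with hs₁
    have e1 : s₁.mem (2 * d + 1) = s.mem (2 * d + 1) + 1 := by simp [hs₁, State.store]
    have e2 : ∀ a, a ≠ 2 * d + 1 → s₁.mem a = s.mem a := fun a ha => by
      simp only [hs₁, State.store, Function.update_of_ne ha]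
    have e3 : s₁.reg = s.reg := rfl
    clear_value s₁
    refine Terminates.seq 1000 ?_ (Terminates.fill (A := d) (N := d) (fun i => s.mem (d + i) +
        (s.mem i - s.mem (d + i)) / (s.mem (2 * d + 1) + 1)) (by omega) (by omega) ?_) ?_
    · simp only [loopTime, ixVec, ixLin, IExpr.cost, RExpr.cost]
      omega
    · intro i s' hi g1 g2 g3
      have k0 : s'.reg 0 = d := by rw [g1 0 (by norm_num), e3, h0]
      refine ⟨by simp [IExpr.eval, k0], fun hid => ⟨by simp [eval_ixVec k0, g2], ?_, ?_⟩⟩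
      · simp only [RExpr.Valid, RExpr.eval, eval_ixVec k0, eval_ixLin k0, IExpr.eval, g2]
        rw [g3 (2 * d + 1) (by omega), e1]
        refine ⟨by omega, ⟨by omega, by omega⟩, by omega, by positivity⟩
      · simp only [RExpr.eval, eval_ixVec k0, eval_ixLin k0, IExpr.eval, g2, one_mul, add_zero]
        rw [g3 (2 * d + 1) (by omega), e1, g3 (d + i) (by omega), e2 (d + i) (by omega),
          g3 i (by omega), e2 i (by omega)]
    · rintro s₂ ⟨g1, g2, g3⟩
      have k0 : s₂.reg 0 = d := by rw [g1 0 (by norm_num), e3, h0]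
      have k1 : s₂.mem (2 * d + 1) = s.mem (2 * d + 1) + 1 := by rw [g3 _ (by omega), e1]
      refine Terminates.seq 100 ?_ (Ψ := fun s' => s' = s₂.store (2 * d)
        (1 / (s.mem (2 * d + 1) + 1 + 1))) (.store ?_ ?_ ?_) ?_
      · simp only [ixLin, IExpr.cost, RExpr.cost]
        omega
      · rw [eval_ixLin k0]; omega
      · simp only [RExpr.Valid, RExpr.eval, eval_ixLin k0, k1]
        refine ⟨trivial, ⟨by omega, trivial⟩, by push_cast; positivity⟩
      · simp [RExpr.eval, eval_ixLin k0, k1]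
      · rintro _ rfl
        refine Terminates.mono (.setReg (by simp [IExpr.eval]; omega) ?_)
          (by simp [IExpr.cost]) (fun _ h => h)
        refine ⟨?_, by simp [State.setReg, IExpr.eval], ?_, ?_, ?_, ?_⟩
        · simp [State.setReg, State.store, k0]
        · simp [State.setReg, State.store, k1]
        · intro i hi
          have : d + i ≠ 2 * d := by omega
          simp only [State.setReg, State.store, Function.update_of_ne this]
          exact g2 i hi
        · simp [State.setReg, State.store]
        · intro a ha
          have : a ≠ 2 * d := by omega
          simp only [State.setReg, State.store, Function.update_of_ne this]
          rw [g3 a (by omega), e2 a (by omega)]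

/-- The matrix can be overwritten in place, because the new value of an entry depends only on its
own old value and on cells below the matrix. The same holds for the two updates that follow. -/
theorem formNew_spec (h0 : s.reg 0 = d)
    (hM : 5 * d + 7 + (d + 1) * (d + 1) + (d + 1) * (d + 1) ≤ M) (ha : s.mem (2 * d + 2) ≠ 0) :
    Terminates M formNewCmd s (1000 * ((d + 1) * (d + 1))) (fun s' => s'.reg 0 = d ∧
      (∀ i < d + 1, ∀ j < d + 1, s'.mem (5 * d + 7 + (d + 1) * (d + 1) + (i * (d + 1) + j)) =
        s.mem (5 * d + 7 + (d + 1) * (d + 1) + (i * (d + 1) + j)) -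
        (s.mem (3 * d + 5 + i) * s.mem (4 * d + 6 + j) + s.mem (4 * d + 6 + i) * s.mem (3 * d + 5 + j)) / s.mem (2 * d + 2) +
        (1 + s.mem (2 * d + 3)) * (s.mem (3 * d + 5 + i) * s.mem (3 * d + 5 + j)) / (s.mem (2 * d + 2) * s.mem (2 * d + 2))) ∧
      ∀ a, a < 5 * d + 7 + (d + 1) * (d + 1) ∨ 5 * d + 7 + (d + 1) * (d + 1) + (d + 1) * (d + 1) ≤ a → s'.mem a = s.mem a) := by
  have hN : d + 1 ≤ (d + 1) * (d + 1) := by nlinarith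
  refine (Terminates.fillMatrix (A := 5 * d + 7 + (d + 1) * (d + 1)) (N := d + 1) (fun i j =>
    s.mem (5 * d + 7 + (d + 1) * (d + 1) + (i * (d + 1) + j)) -
        (s.mem (3 * d + 5 + i) * s.mem (4 * d + 6 + j) + s.mem (4 * d + 6 + i) * s.mem (3 * d + 5 + j)) / s.mem (2 * d + 2) +
        (1 + s.mem (2 * d + 3)) * (s.mem (3 * d + 5 + i) * s.mem (3 * d + 5 + j)) / (s.mem (2 * d + 2) * s.mem (2 * d + 2)))
    (by norm_num) (by omega) (by omega) ?_).mono ?_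
    (fun s' h => ⟨by rw [h.1 0 (by norm_num) (by norm_num), h0], h.2⟩)
  · intro i j s' hi hj g1 g2 _ g4
    have k0 : s'.reg 0 = d := by rw [g1 0 (by norm_num) (by norm_num), h0]
    refine ⟨eval_ixN k0, fun hi' g3 hj' => ?_⟩
    have hlt := entry_lt hi' hj'
    have e0 : ∀ b, b < 5 * d + 7 + (d + 1) * (d + 1) → s'.mem b = s.mem b := fun b hb => g4 b (Or.inl hb)
    have e1 := g4 _ (Or.inr le_rfl)
    refine ⟨by rw [eval_ixForm k0, g2, g3], ?_, ?_⟩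
    · simp only [RExpr.Valid, RExpr.eval, eval_ixForm k0, eval_ixVec k0, eval_ixLin k0, g2, g3]
      rw [e0 (2 * d + 2) (by omega)]
      refine ⟨⟨by omega, ⟨⟨by omega, by omega⟩, by omega, by omega⟩, by omega, ha⟩,
        ⟨⟨trivial, by omega⟩, by omega, by omega⟩, ⟨by omega, by omega⟩, mul_ne_zero ha ha⟩
    · simp only [RExpr.eval, eval_ixForm k0, eval_ixVec k0, eval_ixLin k0, g2, g3, e1]
      repeat rw [e0 _ (by omega)]
      try norm_num
  · simp only [loopTime, ixForm, ixEntry, ixN, ixVec, ixLin, IExpr.cost, RExpr.cost]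
    nlinarith

theorem projNew_spec (h0 : s.reg 0 = d)
    (hM : 5 * d + 7 + (d + 1) * (d + 1) + (d + 1) * (d + 1) ≤ M) (ha : s.mem (2 * d + 2) ≠ 0) :
    Terminates M projNewCmd s (1000 * ((d + 1) * (d + 1))) (fun s' => s'.reg 0 = d ∧
      (∀ i < d + 1, ∀ j < d + 1, s'.mem (5 * d + 7 + (i * (d + 1) + j)) =
        s.mem (5 * d + 7 + (i * (d + 1) + j)) -
        s.mem (3 * d + 5 + i) * s.mem (3 * d + 5 + j) / s.mem (2 * d + 2)) ∧
      ∀ a, a < 5 * d + 7 ∨ 5 * d + 7 + (d + 1) * (d + 1) ≤ a → s'.mem a = s.mem a) := by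
  have hN : d + 1 ≤ (d + 1) * (d + 1) := by nlinarith
  refine (Terminates.fillMatrix (A := 5 * d + 7) (N := d + 1) (fun i j =>
    s.mem (5 * d + 7 + (i * (d + 1) + j)) -
        s.mem (3 * d + 5 + i) * s.mem (3 * d + 5 + j) / s.mem (2 * d + 2))
    (by norm_num) (by omega) (by omega) ?_).mono ?_
    (fun s' h => ⟨by rw [h.1 0 (by norm_num) (by norm_num), h0], h.2⟩)
  · intro i j s' hi hj g1 g2 _ g4
    have k0 : s'.reg 0 = d := by rw [g1 0 (by norm_num) (by norm_num), h0]
    refine ⟨eval_ixN k0, fun hi' g3 hj' => ?_⟩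
    have hlt := entry_lt hi' hj'
    have e0 : ∀ b, b < 5 * d + 7 → s'.mem b = s.mem b := fun b hb => g4 b (Or.inl hb)
    have e1 := g4 _ (Or.inr le_rfl)
    refine ⟨by rw [eval_ixProj k0, g2, g3], ?_, ?_⟩
    · simp only [RExpr.Valid, RExpr.eval, eval_ixProj k0, eval_ixVec k0, eval_ixLin k0, g2, g3]
      rw [e0 (2 * d + 2) (by omega)]
      exact ⟨by omega, ⟨by omega, by omega⟩, by omega, ha⟩
    · simp only [RExpr.eval, eval_ixProj k0, eval_ixVec k0, eval_ixLin k0, g2, g3, e1]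
      repeat rw [e0 _ (by omega)]
      try norm_num
  · simp only [loopTime, ixProj, ixEntry, ixN, ixVec, ixLin, IExpr.cost, RExpr.cost]
    nlinarith

theorem formOld_spec (h0 : s.reg 0 = d)
    (hM : 5 * d + 7 + (d + 1) * (d + 1) + (d + 1) * (d + 1) ≤ M) (hb : 1 + s.mem (2 * d + 3) ≠ 0) :
    Terminates M formOldCmd s (1000 * ((d + 1) * (d + 1))) (fun s' => s'.reg 0 = d ∧
      (∀ i < d + 1, ∀ j < d + 1, s'.mem (5 * d + 7 + (d + 1) * (d + 1) + (i * (d + 1) + j)) =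
        s.mem (5 * d + 7 + (d + 1) * (d + 1) + (i * (d + 1) + j)) -
        s.mem (4 * d + 6 + i) * s.mem (4 * d + 6 + j) / (1 + s.mem (2 * d + 3))) ∧
      ∀ a, a < 5 * d + 7 + (d + 1) * (d + 1) ∨ 5 * d + 7 + (d + 1) * (d + 1) + (d + 1) * (d + 1) ≤ a → s'.mem a = s.mem a) := by
  have hN : d + 1 ≤ (d + 1) * (d + 1) := by nlinarith
  refine (Terminates.fillMatrix (A := 5 * d + 7 + (d + 1) * (d + 1)) (N := d + 1) (fun i j =>
    s.mem (5 * d + 7 + (d + 1) * (d + 1) + (i * (d + 1) + j)) -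
        s.mem (4 * d + 6 + i) * s.mem (4 * d + 6 + j) / (1 + s.mem (2 * d + 3)))
    (by norm_num) (by omega) (by omega) ?_).mono ?_
    (fun s' h => ⟨by rw [h.1 0 (by norm_num) (by norm_num), h0], h.2⟩)
  · intro i j s' hi hj g1 g2 _ g4
    have k0 : s'.reg 0 = d := by rw [g1 0 (by norm_num) (by norm_num), h0]
    refine ⟨eval_ixN k0, fun hi' g3 hj' => ?_⟩
    have hlt := entry_lt hi' hj'
    have e0 : ∀ b, b < 5 * d + 7 + (d + 1) * (d + 1) → s'.mem b = s.mem b := fun b hb => g4 b (Or.inl hb)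
    have e1 := g4 _ (Or.inr le_rfl)
    refine ⟨by rw [eval_ixForm k0, g2, g3], ?_, ?_⟩
    · simp only [RExpr.Valid, RExpr.eval, eval_ixForm k0, eval_ixVec k0, eval_ixLin k0, g2, g3]
      rw [e0 (2 * d + 3) (by omega)]
      exact ⟨by omega, ⟨by omega, by omega⟩, ⟨trivial, by omega⟩, by exact_mod_cast hb⟩
    · simp only [RExpr.eval, eval_ixForm k0, eval_ixVec k0, eval_ixLin k0, g2, g3, e1]
      repeat rw [e0 _ (by omega)]
      try norm_num
  · simp only [loopTime, ixForm, ixEntry, ixN, ixVec, ixLin, IExpr.cost, RExpr.cost]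
    nlinarith

theorem init_spec (h0 : s.reg 0 = d) (hs : ∀ a, s.mem a = 0) (hM : 5 * d + 7 + (d + 1) * (d + 1) ≤ M) :
    Terminates M initCmd s (100 * (d + 1)) (fun s' => s'.reg 0 = d ∧
      (∀ i < d + 1, ∀ j < d + 1,
        s'.mem (5 * d + 7 + (i * (d + 1) + j)) = if i = j then 1 else 0) ∧
      ∀ a, a < 5 * d + 7 ∨ 5 * d + 7 + (d + 1) * (d + 1) ≤ a → s'.mem a = 0) := by
  have hN : d + 1 ≤ (d + 1) * (d + 1) := by nlinarith
  refine (Terminates.forLoop (N := d + 1) (T := 20) (fun i s' => s'.reg 0 = d ∧ s'.reg 2 = i ∧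
    (∀ k < d + 1, ∀ j < d + 1,
      s'.mem (5 * d + 7 + (k * (d + 1) + j)) = if k = j ∧ k < i then 1 else 0) ∧
    ∀ a, a < 5 * d + 7 ∨ 5 * d + 7 + (d + 1) * (d + 1) ≤ a → s'.mem a = 0)
    (by omega) ?_ ?_ ?_).mono ?_ ?_
  · exact ⟨by simp [State.setReg, h0], by simp [State.setReg], by simp [State.setReg, hs],
      by simp [State.setReg, hs]⟩
  · rintro i s' - ⟨h1, h2, -⟩
    exact ⟨eval_ixN h1, h2⟩
  · rintro i s' hi ⟨h1, h2, h3, h4⟩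
    have hlt := entry_lt hi hi
    refine Terminates.mono (.store (by rw [eval_ixProj h1, h2]; omega) trivial ?_)
      (by simp [ixProj, ixEntry, ixLin, ixN, IExpr.cost, RExpr.cost]) (fun _ h => h)
    rw [eval_ixProj h1, h2]
    refine ⟨h2, by simp [State.setReg, State.store, h1], by simp [State.setReg], ?_, ?_⟩
    · intro k hk j hj
      -- Row-major offsets determine the index pair: the row is the quotient by $d+1$.
      by_cases hkj : i * (d + 1) + i = k * (d + 1) + j
      · obtain ⟨rfl, rfl⟩ : k = i ∧ j = i := by
          have e1 : (i * (d + 1) + i) / (d + 1) = i := by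
            rw [mul_comm, Nat.mul_add_div (by omega), Nat.div_eq_of_lt hi]; rfl
          have e2 : (k * (d + 1) + j) / (d + 1) = k := by
            rw [mul_comm, Nat.mul_add_div (by omega), Nat.div_eq_of_lt hj]; rfl
          have : k = i := by rw [← e1, ← e2, hkj]
          subst this
          exact ⟨rfl, by omega⟩
        simp [State.setReg, State.store, RExpr.eval]
      · have hne : 5 * d + 7 + (k * (d + 1) + j) ≠ 5 * d + 7 + (i * (d + 1) + i) := by omega
        simp only [State.setReg, State.store, Function.update_of_ne hne]
        rw [h3 k hk j hj]
        have : ¬ (k = j ∧ k = i) := by rintro ⟨rfl, rfl⟩; exact hkj rfl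
        congr 1
        simp only [eq_iff_iff]
        omega
    · intro a ha
      have hne : a ≠ 5 * d + 7 + (i * (d + 1) + i) := by omega
      simp only [State.setReg, State.store, Function.update_of_ne hne]
      exact h4 a ha
  · simp only [loopTime, ixN, IExpr.cost]
    omega
  · rintro s' ⟨h1, -, h3, h4⟩
    refine ⟨h1, fun i hi j hj => ?_, h4⟩
    rw [h3 i hi j hj]
    simp [hi]

theorem prepare_spec (h0 : s.reg 0 = d)
    (hM : 5 * d + 7 + (d + 1) * (d + 1) + (d + 1) * (d + 1) ≤ M) (v w g : ℕ → ℝ)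
    (hv : ∀ i, v i = if i < d then s.mem i else 1)
    (hw : ∀ i, w i = ∑ j ∈ Finset.range (d + 1), s.mem (5 * d + 7 + (i * (d + 1) + j)) * v j)
    (hg : ∀ i, g i = ∑ j ∈ Finset.range (d + 1),
      s.mem (5 * d + 7 + (d + 1) * (d + 1) + (i * (d + 1) + j)) * v j) :
    Terminates M prepareCmd s (2000 * ((d + 1) * (d + 1))) (fun s' => s'.reg 0 = d ∧
      (∀ i < d + 1, s'.mem (3 * d + 5 + i) = w i) ∧
      (∀ i < d + 1, s'.mem (4 * d + 6 + i) = g i) ∧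
      s'.mem (2 * d + 2) = ∑ i ∈ Finset.range (d + 1), v i * w i ∧
      s'.mem (2 * d + 3) = ∑ i ∈ Finset.range (d + 1), v i * g i ∧
      ∀ a, a < 2 * d + 2 ∨ 5 * d + 7 ≤ a → s'.mem a = s.mem a) := by
  have hN : d + 1 ≤ (d + 1) * (d + 1) := by nlinarith
  refine Terminates.seq (1900 * ((d + 1) * (d + 1))) ?_ (Terminates.fill (A := 2 * d + 4) (N := d)
    v (by omega) (by omega) ?_) ?_
  · simp only [loopTime, ixVec, ixLin, IExpr.cost, RExpr.cost]
    nlinarith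
  · intro i s' hi g1 g2 g3
    have k0 : s'.reg 0 = d := by rw [g1 0 (by norm_num), h0]
    refine ⟨by simp [IExpr.eval, k0], fun hid => ⟨by simp [eval_ixVec k0, g2], ?_, ?_⟩⟩
    · simp only [RExpr.Valid, IExpr.eval, g2]; omega
    · simp only [RExpr.eval, IExpr.eval, g2]
      rw [g3 i (by omega), hv, if_pos hid]
  rintro s₁ ⟨a1, a2, a3⟩
  have k1 : s₁.reg 0 = d := by rw [a1 0 (by norm_num), h0]
  refine Terminates.seq (1800 * ((d + 1) * (d + 1))) ?_ (Ψ := fun s' => s' = s₁.store (3 * d + 4) 1)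
    (.store ?_ ?_ ?_) ?_
  · simp only [ixLin, IExpr.cost, RExpr.cost]
    nlinarith
  · rw [eval_ixLin k1]; omega
  · trivial
  · simp [RExpr.eval, eval_ixLin k1]
  rintro s₂ rfl
  have b2 : ∀ i < d + 1, (s₁.store (3 * d + 4) 1).mem (2 * d + 4 + i) = v i := by
    intro i hi
    by_cases hid : i < d
    · have : 2 * d + 4 + i ≠ 3 * d + 4 := by omega
      simp only [State.store, Function.update_of_ne this]
      exact a2 i hid
    · have : 2 * d + 4 + i = 3 * d + 4 := by omega
      rw [this, hv, if_neg hid]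
      simp [State.store]
  have b3 : ∀ a, a < 2 * d + 2 ∨ 5 * d + 7 ≤ a → (s₁.store (3 * d + 4) 1).mem a = s.mem a := by
    intro a ha
    have : a ≠ 3 * d + 4 := by omega
    simp only [State.store, Function.update_of_ne this]
    exact a3 a (by omega)
  have k2 : (s₁.store (3 * d + 4) 1).reg 0 = d := k1
  generalize s₁.store (3 * d + 4) 1 = s₂ at b2 b3 k2 ⊢
  refine Terminates.seq (1200 * ((d + 1) * (d + 1))) ?_ (Terminates.mulVec (A := 3 * d + 5)
    (N := d + 1) (fun i j => s.mem (5 * d + 7 + (i * (d + 1) + j)) * v j) (by norm_num)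
    (by omega) (by omega) ?_) ?_
  · simp only [loopTime, ixProj, ixEntry, ixN, ixVec, ixLin, IExpr.cost, RExpr.cost]
    nlinarith
  · intro i s' hi g1 g2 g3
    have k0 : s'.reg 0 = d := by rw [g1 0 (by norm_num) (by norm_num), k2]
    refine ⟨eval_ixN k0, fun hi' => ⟨by rw [eval_ixVec k0, g2], fun j hj g4 => ?_⟩⟩
    have hlt := entry_lt hi' hj
    refine ⟨?_, ?_⟩
    · simp only [RExpr.Valid, eval_ixProj k0, eval_ixVec k0, g2, g4]
      omega
    · simp only [RExpr.eval, eval_ixProj k0, eval_ixVec k0, g2, g4]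
      rw [g3 (5 * d + 7 + _) (by omega), b3 _ (by omega), g3 (2 * d + 4 + j) (by omega), b2 j hj]
  rintro s₃ ⟨c1, c2, c3⟩
  have k3 : s₃.reg 0 = d := by rw [c1 0 (by norm_num) (by norm_num), k2]
  refine Terminates.seq (600 * ((d + 1) * (d + 1))) ?_ (Terminates.mulVec (A := 4 * d + 6)
    (N := d + 1) (fun i j => s.mem (5 * d + 7 + (d + 1) * (d + 1) + (i * (d + 1) + j)) * v j)
    (by norm_num) (by omega) (by omega) ?_) ?_
  · simp only [loopTime, ixForm, ixEntry, ixN, ixVec, ixLin, IExpr.cost, RExpr.cost]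
    nlinarith
  · intro i s' hi g1 g2 g3
    have k0 : s'.reg 0 = d := by rw [g1 0 (by norm_num) (by norm_num), k3]
    refine ⟨eval_ixN k0, fun hi' => ⟨by rw [eval_ixVec k0, g2], fun j hj g4 => ?_⟩⟩
    have hlt := entry_lt hi' hj
    refine ⟨?_, ?_⟩
    · simp only [RExpr.Valid, eval_ixForm k0, eval_ixVec k0, g2, g4]
      omega
    · simp only [RExpr.eval, eval_ixForm k0, eval_ixVec k0, g2, g4]
      rw [g3 (5 * d + 7 + (d + 1) * (d + 1) + _) (by omega), c3 _ (by omega), b3 _ (by omega),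
        g3 (2 * d + 4 + j) (by omega), c3 _ (by omega), b2 j hj]
  rintro s₄ ⟨d1, d2, d3⟩
  have k4 : s₄.reg 0 = d := by rw [d1 0 (by norm_num) (by norm_num), k3]
  have ev : ∀ i < d + 1, s₄.mem (2 * d + 4 + i) = v i := fun i hi => by
    rw [d3 _ (by omega), c3 _ (by omega), b2 i hi]
  have ew : ∀ i < d + 1, s₄.mem (3 * d + 5 + i) = w i := fun i hi => by
    rw [d3 _ (by omega), c2 i hi, hw]
  have eg : ∀ i < d + 1, s₄.mem (4 * d + 6 + i) = g i := fun i hi => by rw [d2 i hi, hg]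
  have er : ∀ a, a < 2 * d + 2 ∨ 5 * d + 7 ≤ a → s₄.mem a = s.mem a := fun a ha => by
    rw [d3 _ (by omega), c3 _ (by omega), b3 a ha]
  clear c1 c2 c3 d1 d2 d3 b2 b3 a1 a2 a3
  refine Terminates.seq (500 * ((d + 1) * (d + 1))) ?_ (Ψ := fun s' => s' = s₄.store (2 * d + 2) 0)
    (.store ?_ ?_ ?_) ?_
  · simp only [ixLin, IExpr.cost, RExpr.cost]
    nlinarith
  · rw [eval_ixLin k4]; omega
  · trivial
  · simp [RExpr.eval, eval_ixLin k4]
  rintro _ rfl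
  refine Terminates.seq (300 * ((d + 1) * (d + 1))) ?_ (Terminates.accumulate (A := 2 * d + 2)
    (N := d + 1) (fun i => v i * w i) (by omega) (by omega) ?_) ?_
  · simp only [loopTime, ixN, ixVec, ixLin, IExpr.cost, RExpr.cost]
    nlinarith
  · intro i s' hi g1 g2 g3
    have k0 : s'.reg 0 = d := by rw [g1 0 (by norm_num)]; exact k4
    have g4 : ∀ a, a ≠ 2 * d + 2 → s'.mem a = s₄.mem a := fun a ha => by
      rw [g3 a ha]; simp only [State.store, Function.update_of_ne ha]
    refine ⟨eval_ixN k0, fun hi' => ⟨eval_ixLin k0 _ _, ?_, ?_⟩⟩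
    · simp only [RExpr.Valid, eval_ixLin k0, eval_ixVec k0, g2]
      omega
    · simp only [RExpr.eval, eval_ixLin k0, eval_ixVec k0, g2]
      rw [g4 (2 * d + 4 + i) (by omega), g4 (3 * d + 5 + i) (by omega), ev i hi', ew i hi']
  rintro s₅ ⟨c1, c2, c3⟩
  have k5 : s₅.reg 0 = d := by rw [c1 0 (by norm_num)]; exact k4
  have c4 : ∀ a, a ≠ 2 * d + 2 → s₅.mem a = s₄.mem a := fun a ha => by
    rw [c3 a ha]; simp only [State.store, Function.update_of_ne ha]
  have c5 : s₅.mem (2 * d + 2) = ∑ i ∈ Finset.range (d + 1), v i * w i := by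
    rw [c2]; simp [State.store]
  refine Terminates.seq (200 * ((d + 1) * (d + 1))) ?_ (Ψ := fun s' => s' = s₅.store (2 * d + 3) 0)
    (.store ?_ ?_ ?_) ?_
  · simp only [ixLin, IExpr.cost, RExpr.cost]
    omega
  · rw [eval_ixLin k5]; omega
  · trivial
  · simp [RExpr.eval, eval_ixLin k5]
  rintro _ rfl
  refine Terminates.mono (Terminates.accumulate (A := 2 * d + 3)
    (N := d + 1) (fun i => v i * g i) (by omega) (by omega) ?_) ?_ ?_
  · intro i s' hi g1 g2 g3
    have k0 : s'.reg 0 = d := by rw [g1 0 (by norm_num)]; exact k5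
    have g4 : ∀ a, a ≠ 2 * d + 3 → s'.mem a = s₅.mem a := fun a ha => by
      rw [g3 a ha]; simp only [State.store, Function.update_of_ne ha]
    refine ⟨eval_ixN k0, fun hi' => ⟨eval_ixLin k0 _ _, ?_, ?_⟩⟩
    · simp only [RExpr.Valid, eval_ixLin k0, eval_ixVec k0, g2]
      omega
    · simp only [RExpr.eval, eval_ixLin k0, eval_ixVec k0, g2]
      rw [g4 (2 * d + 4 + i) (by omega), g4 (4 * d + 6 + i) (by omega), c4 _ (by omega),
        c4 _ (by omega), ev i hi', eg i hi']
  · simp only [loopTime, ixN, ixVec, ixLin, IExpr.cost, RExpr.cost]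
    omega
  rintro s₆ ⟨d1, d2, d3⟩
  have d4 : ∀ a, a ≠ 2 * d + 3 → s₆.mem a = s₅.mem a := fun a ha => by
    rw [d3 a ha]; simp only [State.store, Function.update_of_ne ha]
  refine ⟨by rw [d1 0 (by norm_num)]; exact k5, fun i hi => ?_, fun i hi => ?_, ?_, ?_,
    fun a ha => ?_⟩
  · rw [d4 _ (by omega), c4 _ (by omega), ew i hi]
  · rw [d4 _ (by omega), c4 _ (by omega), eg i hi]
  · rw [d4 _ (by omega), c5]
  · rw [d2]; simp [State.store]
  · rw [d4 _ (by omega), c4 _ (by omega), er a ha]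

end RealRAM

/-! ### The effect of one step on the stored matrices -/

namespace RealRAM

/-- The first matrix in the memory. -/
def State.proj (d : ℕ) (s : State) : Matrix (Fin (d + 1)) (Fin (d + 1)) ℝ :=
  .of fun i j => s.mem (5 * d + 7 + (i * (d + 1) + j))

/-- The second matrix in the memory. -/
def State.form (d : ℕ) (s : State) : Matrix (Fin (d + 1)) (Fin (d + 1)) ℝ :=
  .of fun i j => s.mem (5 * d + 7 + (d + 1) * (d + 1) + (i * (d + 1) + j))

/-- The number of selected points. -/
def State.count (d : ℕ) (s : State) : ℝ := s.mem (2 * d + 1)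

/-- The point `z` in the affine hyperplane at height one. -/
def liftPt {d : ℕ} (z : EuclideanSpace ℝ (Fin d)) : Fin (d + 1) → ℝ :=
  fun i => if h : (i : ℕ) < d then z ⟨i, h⟩ else 1

/-- The effect of the selection of `z` on the output. -/
def Selects (d : ℕ) (z : EuclideanSpace ℝ (Fin d)) (s s' : State) : Prop :=
  s'.reg 1 = 1 ∧ s'.count d = s.count d + 1 ∧
    s'.center d = s.center d + (s.count d + 1)⁻¹ • (z - s.center d) ∧
    s'.scale d = 1 / (s.count d + 1 + 1)

-- The bridge from memory cells to linear algebra: the alternatives are the branches of the program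
-- (new direction, costly representation, cheap representation), and the machine model does not
-- appear in the correctness argument beyond them.
open Matrix in
theorem step_spec {d : ℕ} (hd : 1 ≤ d) (s : State) (h0 : s.reg 0 = d) (hc : 0 ≤ s.count d)
    (z : EuclideanSpace ℝ (Fin d)) {P Q : Matrix (Fin (d + 1)) (Fin (d + 1)) ℝ}
    {w g : Fin (d + 1) → ℝ} {a b : ℝ} (hP : P = s.proj d) (hQ : Q = s.form d)
    (hw : w = P *ᵥ liftPt z) (hg : g = Q *ᵥ liftPt z) (ha : a = liftPt z ⬝ᵥ w)
    (hb : b = liftPt z ⬝ᵥ g) :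
    ∃ k s', Exec (20 * d ^ 2) stepCmd (s.receive z) k s' ∧ k ≤ 60000 * d ^ 2 ∧ s'.reg 0 = d ∧
      ((0 < a ∧ Selects d z s s' ∧ s'.proj d = P - a⁻¹ • vecMulVec w w ∧
          s'.form d = Q - a⁻¹ • (vecMulVec w g + vecMulVec g w) +
            ((1 + b) / (a * a)) • vecMulVec w w) ∨
        (a ≤ 0 ∧ 1 < b ∧ Selects d z s s' ∧ s'.proj d = P ∧
          s'.form d = Q - (1 + b)⁻¹ • vecMulVec g g) ∨
        (a ≤ 0 ∧ b ≤ 1 ∧ s'.reg 1 = 0 ∧ s'.count d = s.count d ∧ s'.center d = s.center d ∧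
          s'.scale d = s.scale d ∧ s'.proj d = P ∧ s'.form d = Q)) := by
  have hM := layout_le hd
  set M := 20 * d ^ 2
  set s₀ := s.receive z with hs₀
  have k0 : s₀.reg 0 = d := h0
  have m0 : ∀ c, d ≤ c → s₀.mem c = s.mem c := fun c hc => by
    simp [hs₀, State.receive, not_lt.mpr hc]
  have mz : ∀ i : Fin d, s₀.mem i = z i := fun i => by simp [hs₀, State.receive]
  clear_value s₀
  set v : ℕ → ℝ := fun i => if i < d then s₀.mem i else 1 with hv
  set w' : ℕ → ℝ := fun i => ∑ j ∈ Finset.range (d + 1),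
    s₀.mem (5 * d + 7 + (i * (d + 1) + j)) * v j with hw'
  set g' : ℕ → ℝ := fun i => ∑ j ∈ Finset.range (d + 1),
    s₀.mem (5 * d + 7 + (d + 1) * (d + 1) + (i * (d + 1) + j)) * v j with hg'
  have vz : ∀ i : Fin (d + 1), liftPt z i = v i := by
    intro i
    simp only [liftPt, hv]
    by_cases h : (i : ℕ) < d
    · simpa [h] using (mz ⟨i, h⟩).symm
    · simp [h]
  have ww : ∀ i : Fin (d + 1), w' i = w i := by
    intro i
    simp only [hw, hw', Matrix.mulVec, dotProduct, Finset.sum_range, hP, State.proj, of_apply, vz]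
    exact Finset.sum_congr rfl fun j _ => by rw [m0 _ (by omega)]
  have gg : ∀ i : Fin (d + 1), g' i = g i := by
    intro i
    simp only [hg, hg', Matrix.mulVec, dotProduct, Finset.sum_range, hQ, State.form, of_apply, vz]
    exact Finset.sum_congr rfl fun j _ => by rw [m0 _ (by omega)]
  have aa : ∑ i ∈ Finset.range (d + 1), v i * w' i = a := by
    simp only [ha, dotProduct, Finset.sum_range, ww, vz]
  have bb : ∑ i ∈ Finset.range (d + 1), v i * g' i = b := by
    simp only [hb, dotProduct, Finset.sum_range, gg, vz]
  have prep := prepare_spec (M := M) k0 (by omega) v w' g' (fun _ => rfl) (fun _ => rfl)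
    (fun _ => rfl)
  rw [aa, bb] at prep
  clear_value v w' g'
  suffices h : Terminates M stepCmd s₀ (60000 * d ^ 2) (fun s' => s'.reg 0 = d ∧
      ((0 < a ∧ Selects d z s s' ∧ s'.proj d = P - a⁻¹ • vecMulVec w w ∧
          s'.form d = Q - a⁻¹ • (vecMulVec w g + vecMulVec g w) +
            ((1 + b) / (a * a)) • vecMulVec w w) ∨
        (a ≤ 0 ∧ 1 < b ∧ Selects d z s s' ∧ s'.proj d = P ∧
          s'.form d = Q - (1 + b)⁻¹ • vecMulVec g g) ∨
        (a ≤ 0 ∧ b ≤ 1 ∧ s'.reg 1 = 0 ∧ s'.count d = s.count d ∧ s'.center d = s.center d ∧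
          s'.scale d = s.scale d ∧ s'.proj d = P ∧ s'.form d = Q))) by
    obtain ⟨k, s', h1, h2, h3⟩ := h
    exact ⟨k, s', h1, h2, h3⟩
  -- Turns the budget $(2000+13000)(d+1)^2$ into $60000\,d^2$.
  have hsq : (d + 1) * (d + 1) ≤ 4 * d ^ 2 := by nlinarith
  have hsq' : d + 1 ≤ (d + 1) * (d + 1) := by nlinarith
  refine Terminates.seq (13000 * ((d + 1) * (d + 1))) (by omega) prep ?_
  rintro s₁ ⟨k1, p1, p2, p3, p4, p5⟩
  have sel : ∀ s₂ : State, s₂.reg 0 = d → (∀ c, c < 5 * d + 7 → s₂.mem c = s₁.mem c) →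
      Terminates M selectCmd s₂ (10000 * (d + 1)) (fun s' => s'.reg 0 = d ∧ Selects d z s s' ∧
        s'.proj d = s₂.proj d ∧ s'.form d = s₂.form d) := by
    intro s₂ k2 hs₂
    have e1 : s₂.mem (2 * d + 1) = s.count d := by
      rw [hs₂ _ (by omega), p5 _ (by omega), m0 _ (by omega)]; rfl
    have e2 : ∀ i < d, s₂.mem (d + i) = s.mem (d + i) := fun i hi => by
      rw [hs₂ _ (by omega), p5 _ (by omega), m0 _ (by omega)]
    refine (select_spec (M := M) k2 (by omega) (e1 ▸ hc)).mono le_rfl ?_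
    rintro s' ⟨q0, q1, q2, q3, q4, q5⟩
    refine ⟨q0, ⟨q1, by rw [State.count, q2, e1], ?_, by rw [State.scale, q4, e1]⟩, ?_, ?_⟩
    · ext i
      simp only [State.center, PiLp.add_apply, PiLp.smul_apply, PiLp.sub_apply, smul_eq_mul]
      rw [q3 i i.2, e1, e2 i i.2, hs₂ _ (by omega), p5 _ (by omega), mz]
      field_simp
    · ext i j
      exact q5 _ (by omega)
    · ext i j
      exact q5 _ (by omega)
  have hP1 : ∀ i < d + 1, ∀ j < d + 1, s₁.mem (5 * d + 7 + (i * (d + 1) + j)) =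
      s.mem (5 * d + 7 + (i * (d + 1) + j)) := fun i _ j _ => by
    rw [p5 _ (by omega), m0 _ (by omega)]
  have hQ1 : ∀ i < d + 1, ∀ j < d + 1,
      s₁.mem (5 * d + 7 + (d + 1) * (d + 1) + (i * (d + 1) + j)) =
      s.mem (5 * d + 7 + (d + 1) * (d + 1) + (i * (d + 1) + j)) := fun i _ j _ => by
    rw [p5 _ (by omega), m0 _ (by omega)]
  have hpr : s₁.proj d = P := by ext i j; rw [hP]; exact hP1 i i.2 j j.2
  have hfo : s₁.form d = Q := by ext i j; rw [hQ]; exact hQ1 i i.2 j j.2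
  have test : ∀ (q : ℤ) (c : ℕ), (Test.rlt (.const q) (.load (ixLin 2 c))).Holds s₁ ↔
      (q : ℝ) < s₁.mem (2 * d + c) := fun q c => by
    simp [Test.Holds, RExpr.eval, eval_ixLin k1]
  refine Terminates.mono (Terminates.ite (T := 12500 * ((d + 1) * (d + 1)))
    ⟨trivial, by simp only [RExpr.Valid, eval_ixLin k1]; omega⟩ (fun ht => ?_) (fun ht => ?_))
    (by simp only [Test.cost, RExpr.cost, ixLin, IExpr.cost]; omega) (fun _ h => h)
  · rw [test, p3, Int.cast_zero] at ht
    have hane : s₁.mem (2 * d + 2) ≠ 0 := by rw [p3]; exact ht.ne'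
    refine Terminates.seq (11200 * ((d + 1) * (d + 1))) (by omega)
      (formNew_spec k1 (by omega) hane) ?_
    rintro s₂ ⟨k2, r1, r2⟩
    have hane' : s₂.mem (2 * d + 2) ≠ 0 := by rw [r2 _ (by omega)]; exact hane
    refine Terminates.seq (10100 * ((d + 1) * (d + 1))) (by omega)
      (projNew_spec k2 (by omega) hane') ?_
    rintro s₃ ⟨k3, t1, t2⟩
    refine (sel s₃ k3 (fun c hc => by rw [t2 _ (by omega), r2 _ (by omega)])).mono (by omega) ?_
    rintro s' ⟨u0, u1, u2, u3⟩
    refine ⟨u0, Or.inl ⟨ht, u1, ?_, ?_⟩⟩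
    · rw [u2]
      ext i j
      have hlt := entry_lt i.2 j.2
      simp only [State.proj, of_apply, Matrix.sub_apply, Matrix.smul_apply, vecMulVec_apply, smul_eq_mul, hP]
      rw [t1 i i.2 j j.2, r2 _ (by omega), hP1 i i.2 j j.2, r2 _ (by omega), r2 _ (by omega),
        r2 _ (by omega), p1 i i.2, p1 j j.2, p3, ww, ww]
      field_simp
    · rw [u3]
      ext i j
      simp only [State.form, of_apply, Matrix.sub_apply, Matrix.add_apply, Matrix.smul_apply, vecMulVec_apply,
        smul_eq_mul, hQ]
      rw [t2 _ (by omega), r1 i i.2 j j.2, hQ1 i i.2 j j.2, p1 i i.2, p1 j j.2, p2 i i.2, p2 j j.2,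
        p3, p4, ww, ww, gg, gg]
      ring
  · rw [test, p3, Int.cast_zero, not_lt] at ht
    refine Terminates.mono (Terminates.ite (T := 12300 * ((d + 1) * (d + 1)))
      ⟨trivial, by simp only [RExpr.Valid, eval_ixLin k1]; omega⟩ (fun ht' => ?_) (fun ht' => ?_))
      (by simp only [Test.cost, RExpr.cost, ixLin, IExpr.cost]; omega) (fun _ h => h)
    · rw [test, p4, Int.cast_one] at ht'
      refine Terminates.seq (11200 * ((d + 1) * (d + 1))) (by omega)
        (formOld_spec k1 (by omega) (by rw [p4]; positivity)) ?_
      rintro s₂ ⟨k2, r1, r2⟩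
      refine (sel s₂ k2 (fun c hc => by rw [r2 _ (by omega)])).mono (by omega) ?_
      rintro s' ⟨u0, u1, u2, u3⟩
      refine ⟨u0, Or.inr (Or.inl ⟨ht, ht', u1, ?_, ?_⟩)⟩
      · rw [u2, ← hpr]
        ext i j
        have hlt := entry_lt i.2 j.2
        exact r2 _ (by omega)
      · rw [u3]
        ext i j
        simp only [State.form, of_apply, Matrix.sub_apply, Matrix.smul_apply, vecMulVec_apply,
          smul_eq_mul, hQ]
        rw [r1 i i.2 j j.2, hQ1 i i.2 j j.2, p2 i i.2, p2 j j.2, p4, gg, gg]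
        field_simp
    · rw [test, p4, Int.cast_one, not_lt] at ht'
      refine Terminates.mono (.setReg (by simp [IExpr.eval]) ?_)
        (by simp only [IExpr.cost]; omega) (fun _ h => h)
      refine ⟨by simp [State.setReg, k1], Or.inr (Or.inr ⟨ht, ht', ?_, ?_, ?_, ?_, hpr, hfo⟩)⟩
      · simp [State.setReg, IExpr.eval]
      · change s₁.mem _ = _
        rw [p5 _ (by omega), m0 _ (by omega)]; rfl
      · ext i
        change s₁.mem _ = s.mem _
        rw [p5 _ (by omega), m0 _ (by omega)]
      · change s₁.mem _ = _
        rw [p5 _ (by omega), m0 _ (by omega)]; rfl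

theorem start_spec {d : ℕ} (hd : 1 ≤ d) :
    ∃ k s', Exec (20 * d ^ 2) initCmd (State.start d) k s' ∧ k ≤ 200 * d ^ 2 ∧ s'.reg 0 = d ∧
      s'.count d = 0 ∧ s'.center d = 0 ∧ s'.proj d = 1 ∧ s'.form d = 0 := by
  have hM := layout_le hd
  obtain ⟨k, s', h1, h2, h3, h4, h5⟩ := init_spec (s := State.start d) (M := 20 * d ^ 2) (d := d)
    rfl (fun _ => rfl) (by omega)
  refine ⟨k, s', h1, by nlinarith, h3, h5 _ (by omega), ?_, ?_, ?_⟩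
  · ext i
    exact h5 _ (by omega)
  · ext i j
    simp only [State.proj, Matrix.of_apply, Matrix.one_apply]
    rw [h4 i i.2 j j.2]
    simp [Fin.ext_iff]
  · ext i j
    exact h5 _ (by omega)

end RealRAM

/-! ### Minimal representations -/

section SpanForm
open Matrix

variable {ι : Type*} [Fintype ι]

/-- `P` is the projection onto the orthogonal complement of the span of the vectors `v i`, `i ∈ S`,
and on this span the quadratic form of `Q` is the least sum of squares of the coefficients in a
representation by these vectors. -/
structure SpanForm (v : ℕ → ι → ℝ) (S : Finset ℕ) (P Q : Matrix ι ι ℝ) : Prop where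
  proj_symm : Pᵀ = P
  proj_mem : ∀ x, ∃ c : ℕ → ℝ, ∑ i ∈ S, c i • v i = x - P *ᵥ x
  proj_eq_zero : ∀ i ∈ S, P *ᵥ v i = 0
  form_symm : Qᵀ = Q
  form_le : ∀ c : ℕ → ℝ,
    (∑ i ∈ S, c i • v i) ⬝ᵥ Q *ᵥ (∑ i ∈ S, c i • v i) ≤ ∑ i ∈ S, c i ^ 2
  le_form : ∀ c : ℕ → ℝ, ∃ c' : ℕ → ℝ, ∑ i ∈ S, c' i • v i = ∑ i ∈ S, c i • v i ∧
    ∑ i ∈ S, c' i ^ 2 ≤ (∑ i ∈ S, c i • v i) ⬝ᵥ Q *ᵥ (∑ i ∈ S, c i • v i)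

theorem dotProduct_mulVec_of_symm {A : Matrix ι ι ℝ} (hA : Aᵀ = A) (x y : ι → ℝ) :
    x ⬝ᵥ A *ᵥ y = y ⬝ᵥ A *ᵥ x := by
  rw [dotProduct_mulVec, ← mulVec_transpose, hA, dotProduct_comm]

theorem vecMulVec_mulVec_eq (a b x : ι → ℝ) : vecMulVec a b *ᵥ x = (b ⬝ᵥ x) • a := by
  ext i
  simp only [mulVec, dotProduct, vecMulVec_apply, Pi.smul_apply, smul_eq_mul, Finset.sum_mul]
  exact Finset.sum_congr rfl fun j _ => by ring

/-- Extends a coefficient family on `S` by a prescribed value at the new index; `f` is instantiated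
with values, squares and weighted vectors. -/
theorem sum_insert_update {M : Type*} [AddCommMonoid M] {S : Finset ℕ} {t : ℕ} (ht : t ∉ S)
    (c : ℕ → ℝ) (r : ℝ) (f : ℕ → ℝ → M) :
    ∑ i ∈ insert t S, f i (Function.update c t r i) = f t r + ∑ i ∈ S, f i (c i) := by
  rw [Finset.sum_insert ht, Function.update_self]
  congr 1
  exact Finset.sum_congr rfl fun i hi => by
    rw [Function.update_of_ne (by rintro rfl; exact ht hi)]

namespace SpanForm

variable {v : ℕ → ι → ℝ} {S : Finset ℕ} {P Q : Matrix ι ι ℝ} {t : ℕ} {w g : ι → ℝ} {a b : ℝ}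

theorem proj_sum (h : SpanForm v S P Q) (c : ℕ → ℝ) : P *ᵥ (∑ i ∈ S, c i • v i) = 0 := by
  rw [mulVec_sum]
  exact Finset.sum_eq_zero fun i hi => by rw [mulVec_smul, h.proj_eq_zero i hi, smul_zero]

theorem proj_proj (h : SpanForm v S P Q) (x : ι → ℝ) : P *ᵥ (P *ᵥ x) = P *ᵥ x := by
  obtain ⟨c, hc⟩ := h.proj_mem x
  have := h.proj_sum c
  rw [hc, mulVec_sub, sub_eq_zero] at this
  exact this.symm

theorem dot_proj (h : SpanForm v S P Q) (x : ι → ℝ) :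
    x ⬝ᵥ P *ᵥ x = (P *ᵥ x) ⬝ᵥ (P *ᵥ x) := by
  conv_rhs => rw [dotProduct_mulVec_of_symm h.proj_symm, h.proj_proj]

/-- $x\cdot Px=\|Px\|^2$, so the sign test of the program decides exactly whether `x` is in the
span. -/
theorem exists_rep (h : SpanForm v S P Q) {x : ι → ℝ} (hx : x ⬝ᵥ P *ᵥ x ≤ 0) :
    ∃ c : ℕ → ℝ, ∑ i ∈ S, c i • v i = x := by
  rw [h.dot_proj] at hx
  have h0 : P *ᵥ x = 0 := dotProduct_self_eq_zero.mp
    (le_antisymm hx (Finset.sum_nonneg fun i _ => mul_self_nonneg _))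
  obtain ⟨c, hc⟩ := h.proj_mem x
  exact ⟨c, by rw [hc, h0, sub_zero]⟩

theorem exists_rep_le (h : SpanForm v S P Q) {x : ι → ℝ} (hx : x ⬝ᵥ P *ᵥ x ≤ 0) :
    ∃ c : ℕ → ℝ, ∑ i ∈ S, c i • v i = x ∧ ∑ i ∈ S, c i ^ 2 ≤ x ⬝ᵥ Q *ᵥ x := by
  obtain ⟨c, rfl⟩ := h.exists_rep hx
  exact h.le_form c

/-- A vector $x$ of the enlarged span has a forced coefficient $s=(w\cdot x)/a$ at $v_t$, because
$w=Pv_t$ is orthogonal to the old span. The new least cost is therefore $s^2$ plus the old form at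
$x-sv_t$, that is, $x\cdot Qx-2s\,(g\cdot x)+(1+b)s^2$, which is the updated form. Subtracting the
projection onto $w$ updates $P$. -/
theorem insert_new (h : SpanForm v S P Q) (ht : t ∉ S) (hw : w = P *ᵥ v t) (hg : g = Q *ᵥ v t)
    (ha : a = v t ⬝ᵥ w) (hb : b = v t ⬝ᵥ g) (hpos : 0 < a) :
    SpanForm v (insert t S) (P - a⁻¹ • vecMulVec w w)
      (Q - a⁻¹ • (vecMulVec w g + vecMulVec g w) + ((1 + b) / (a * a)) • vecMulVec w w) := by
  have hvv : ∀ x y : ι → ℝ, (vecMulVec x y)ᵀ = vecMulVec y x := fun x y => by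
    ext i j; simp [vecMulVec_apply, mul_comm]
  have hwr : ∀ c : ℕ → ℝ, w ⬝ᵥ (∑ i ∈ S, c i • v i) = 0 := fun c => by
    rw [hw, dotProduct_comm, dotProduct_mulVec_of_symm h.proj_symm, h.proj_sum, dotProduct_zero]
  have hww : w ⬝ᵥ v t = a := by rw [ha, dotProduct_comm]
  have key : ∀ (c : ℝ) (d : ℕ → ℝ), (c • v t + ∑ i ∈ S, d i • v i) ⬝ᵥ
      (Q - a⁻¹ • (vecMulVec w g + vecMulVec g w) + ((1 + b) / (a * a)) • vecMulVec w w) *ᵥ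
      (c • v t + ∑ i ∈ S, d i • v i) =
      c ^ 2 + (∑ i ∈ S, d i • v i) ⬝ᵥ Q *ᵥ (∑ i ∈ S, d i • v i) := by
    intro c d
    have h1 := hwr d
    generalize ∑ i ∈ S, d i • v i = r at h1 ⊢
    have e1 : v t ⬝ᵥ Q *ᵥ r = g ⬝ᵥ r := by
      rw [dotProduct_mulVec_of_symm h.form_symm, hg, dotProduct_comm]
    have e2 : r ⬝ᵥ Q *ᵥ v t = g ⬝ᵥ r := by rw [hg, dotProduct_comm]
    have e3 : v t ⬝ᵥ Q *ᵥ v t = b := by rw [hb, hg]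
    have e4 : g ⬝ᵥ v t = b := by rw [hb, dotProduct_comm]
    have e5 : r ⬝ᵥ w = 0 := by rw [dotProduct_comm, h1]
    have e6 : r ⬝ᵥ g = g ⬝ᵥ r := dotProduct_comm _ _
    simp only [add_mulVec, sub_mulVec, smul_mulVec, vecMulVec_mulVec_eq, mulVec_add, mulVec_smul,
      dotProduct_add, add_dotProduct, dotProduct_sub, dotProduct_smul, smul_dotProduct,
      smul_eq_mul, smul_add, h1, hww, e1, e2, e3, e4, e5, e6, ← ha, ← hb]
    field_simp
    ring
  refine ⟨?_, ?_, ?_, ?_, ?_, ?_⟩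
  · rw [transpose_sub, transpose_smul, hvv, h.proj_symm]
  · intro x
    obtain ⟨c, hc⟩ := h.proj_mem x
    obtain ⟨d, hd⟩ := h.proj_mem (v t)
    set r := a⁻¹ * (w ⬝ᵥ x) with hr
    -- Uses $w=v_t-\sum d_iv_i$: the new projection removes $r\,w$ from $Px$, which adds $r$ at `t`
    -- and $-r\,d_i$ at the old indices.
    refine ⟨Function.update (fun i => c i - r * d i) t r, ?_⟩
    rw [sum_insert_update ht _ _ (fun i y => y • v i)]
    simp only [sub_smul, mul_smul, Finset.sum_sub_distrib, ← Finset.smul_sum, hc, hd, sub_mulVec,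
      smul_mulVec, vecMulVec_mulVec_eq, ← hw, hr]
    module
  · intro i hi
    rw [sub_mulVec, smul_mulVec, vecMulVec_mulVec_eq]
    rcases Finset.mem_insert.mp hi with rfl | hi
    · rw [hww, smul_smul, inv_mul_cancel₀ hpos.ne', one_smul, hw, sub_self]
    · have : w ⬝ᵥ v i = 0 := by
        rw [hw, dotProduct_comm, dotProduct_mulVec_of_symm h.proj_symm, h.proj_eq_zero i hi,
          dotProduct_zero]
      rw [this, zero_smul, smul_zero, sub_zero, h.proj_eq_zero i hi]
  · rw [transpose_add, transpose_sub, transpose_smul, transpose_smul, transpose_add, hvv, hvv, hvv,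
      h.form_symm, add_comm (vecMulVec g w)]
  · intro c
    rw [Finset.sum_insert ht, Finset.sum_insert ht, key]
    linarith [h.form_le c]
  · intro c
    obtain ⟨c', h1, h2⟩ := h.le_form c
    refine ⟨Function.update c' t (c t), ?_, ?_⟩
    · rw [sum_insert_update ht _ _ (fun i y => y • v i), Finset.sum_insert ht, h1]
    · rw [sum_insert_update ht _ _ (fun i y => y ^ 2), Finset.sum_insert ht, key]
      linarith

/-- Now the coefficient $r$ at $v_t$ is free, and the cost of $y$ is the minimum over $r$ of
$r^2+(y-rv_t)\cdot Q(y-rv_t)=y\cdot Qy-2r\,(g\cdot y)+(1+b)r^2$. The minimum is attained at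
$r=(g\cdot y)/(1+b)$ and gives the Sherman-Morrison correction. -/
theorem insert_old (h : SpanForm v S P Q) (ht : t ∉ S) (ha : v t ⬝ᵥ P *ᵥ v t ≤ 0)
    (hg : g = Q *ᵥ v t) (hb : b = v t ⬝ᵥ g) (hpos : 0 < 1 + b) :
    SpanForm v (insert t S) P (Q - (1 + b)⁻¹ • vecMulVec g g) := by
  obtain ⟨d, hd⟩ := h.exists_rep ha
  have hq : ∀ y : ι → ℝ, y ⬝ᵥ (Q - (1 + b)⁻¹ • vecMulVec g g) *ᵥ y =
      y ⬝ᵥ Q *ᵥ y - (g ⬝ᵥ y) ^ 2 / (1 + b) := fun y => by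
    rw [sub_mulVec, smul_mulVec, vecMulVec_mulVec_eq, dotProduct_sub, dotProduct_smul,
      dotProduct_smul, dotProduct_comm y g, smul_eq_mul, smul_eq_mul]
    ring
  have hadd : ∀ (c : ℝ) (r : ι → ℝ), (c • v t + r) ⬝ᵥ Q *ᵥ (c • v t + r) =
      c ^ 2 * b + 2 * c * (g ⬝ᵥ r) + r ⬝ᵥ Q *ᵥ r := by
    intro c r
    have e1 : v t ⬝ᵥ Q *ᵥ r = g ⬝ᵥ r := by
      rw [dotProduct_mulVec_of_symm h.form_symm, hg, dotProduct_comm]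
    have e2 : r ⬝ᵥ Q *ᵥ v t = g ⬝ᵥ r := by rw [hg, dotProduct_comm]
    have e3 : v t ⬝ᵥ Q *ᵥ v t = b := by rw [hb, hg]
    simp only [mulVec_add, mulVec_smul, dotProduct_add, add_dotProduct, dotProduct_smul,
      smul_dotProduct, smul_eq_mul, e1, e2, e3]
    ring
  have e4 : g ⬝ᵥ v t = b := by rw [hb, dotProduct_comm]
  refine ⟨h.proj_symm, ?_, ?_, ?_, ?_, ?_⟩
  · intro x
    obtain ⟨c, hc⟩ := h.proj_mem x
    refine ⟨Function.update c t 0, ?_⟩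
    rw [sum_insert_update ht _ _ (fun i y => y • v i), zero_smul, zero_add, hc]
  · intro i hi
    rcases Finset.mem_insert.mp hi with rfl | hi
    · rw [← hd]; exact h.proj_sum d
    · exact h.proj_eq_zero i hi
  · have : (vecMulVec g g)ᵀ = vecMulVec g g := by
      ext i j; simp [vecMulVec_apply, mul_comm]
    rw [transpose_sub, transpose_smul, this, h.form_symm]
  · intro c
    rw [Finset.sum_insert ht, Finset.sum_insert ht, hq, hadd, dotProduct_add, dotProduct_smul, e4,
      smul_eq_mul]
    have h1 := h.form_le c
    -- Completing the square: the deficit of a coefficient $c_t$ from optimality is a square, so the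
    -- new form is a lower bound for every representation.
    have h2 : c t ^ 2 * b + 2 * c t * (g ⬝ᵥ ∑ i ∈ S, c i • v i) -
        (c t * b + g ⬝ᵥ ∑ i ∈ S, c i • v i) ^ 2 / (1 + b) =
        c t ^ 2 - (c t - g ⬝ᵥ ∑ i ∈ S, c i • v i) ^ 2 / (1 + b) := by
      field_simp
      ring
    have h3 : 0 ≤ (c t - g ⬝ᵥ ∑ i ∈ S, c i • v i) ^ 2 / (1 + b) := by positivity
    linarith
  · intro c
    set y := ∑ i ∈ insert t S, c i • v i with hy
    set r := (g ⬝ᵥ y) / (1 + b) with hr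
    have hrep : ∑ i ∈ S, (c i + c t * d i - r * d i) • v i = -r • v t + y := by
      simp only [sub_smul, add_smul, mul_smul, Finset.sum_sub_distrib, Finset.sum_add_distrib,
        ← Finset.smul_sum, hd]
      rw [hy, Finset.sum_insert ht]
      module
    obtain ⟨c', h1, h2⟩ := h.le_form (fun i => c i + c t * d i - r * d i)
    rw [hrep] at h1 h2
    refine ⟨Function.update c' t r, ?_, ?_⟩
    · rw [sum_insert_update ht _ _ (fun i y => y • v i), h1]
      module
    · rw [sum_insert_update ht _ _ (fun i y => y ^ 2), hq]
      rw [hadd] at h2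
      have : (g ⬝ᵥ y) = r * (1 + b) := by rw [hr]; field_simp
      rw [this] at h2 ⊢
      have e : (r * (1 + b)) ^ 2 / (1 + b) = r ^ 2 * (1 + b) := by field_simp
      rw [e]
      nlinarith

end SpanForm

end SpanForm

/-! ### Selected points -/

/-- `S` is selected among the points `z 1, …, z t` by the following rule: a point is an affine
combination of the points selected so far, with coefficients whose squares add up to at most one,
if and only if it is not selected. -/
structure IsSelection {d : ℕ} (z : ℕ → EuclideanSpace ℝ (Fin d)) (t : ℕ) (S : Finset ℕ) : Prop where
  subset : S ⊆ Finset.Icc 1 t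
  cover : ∀ i ∈ Finset.Icc 1 t, ∃ c : ℕ → ℝ, ∑ j ∈ S with j ≤ i, c j = 1 ∧
    ∑ j ∈ S with j ≤ i, c j • z j = z i ∧ ∑ j ∈ S with j ≤ i, c j ^ 2 ≤ 1
  select : ∀ i ∈ S, ∀ c : ℕ → ℝ, ∑ j ∈ S with j < i, c j = 1 → ∑ j ∈ S with j < i, c j • z j = z i →
    1 < ∑ j ∈ S with j < i, c j ^ 2

namespace IsSelection
variable {d : ℕ} {z : ℕ → EuclideanSpace ℝ (Fin d)} {t : ℕ} {S : Finset ℕ}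

theorem zero (z : ℕ → EuclideanSpace ℝ (Fin d)) : IsSelection z 0 ∅ :=
  ⟨by simp, by simp, by simp⟩

theorem le_of_mem (h : IsSelection z t S) {i : ℕ} (hi : i ∈ S) : i ≤ t :=
  (Finset.mem_Icc.mp (h.subset hi)).2

theorem not_mem (h : IsSelection z t S) : t + 1 ∉ S := fun hi => by
  have := h.le_of_mem hi
  omega

theorem skip (h : IsSelection z t S) (c : ℕ → ℝ) (h1 : ∑ j ∈ S, c j = 1)
    (h2 : ∑ j ∈ S, c j • z j = z (t + 1)) (h3 : ∑ j ∈ S, c j ^ 2 ≤ 1) :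
    IsSelection z (t + 1) S := by
  refine ⟨h.subset.trans (Finset.Icc_subset_Icc_right (by omega)), fun i hi => ?_, h.select⟩
  by_cases hit : i ≤ t
  · exact h.cover i (Finset.mem_Icc.mpr ⟨(Finset.mem_Icc.mp hi).1, hit⟩)
  · have : S.filter (· ≤ i) = S := Finset.filter_true_of_mem fun j hj => by
      have := h.le_of_mem hj
      omega
    obtain rfl : i = t + 1 := by have := (Finset.mem_Icc.mp hi).2; omega
    exact ⟨c, by rw [this]; exact ⟨h1, h2, h3⟩⟩

theorem insert (h : IsSelection z t S) (hs : ∀ c : ℕ → ℝ, ∑ j ∈ S, c j = 1 →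
    ∑ j ∈ S, c j • z j = z (t + 1) → 1 < ∑ j ∈ S, c j ^ 2) :
    IsSelection z (t + 1) (insert (t + 1) S) := by
  refine ⟨?_, fun i hi => ?_, fun i hi => ?_⟩
  · exact Finset.insert_subset (by simp) (h.subset.trans (Finset.Icc_subset_Icc_right (by omega)))
  · by_cases hit : i ≤ t
    · rw [Finset.filter_insert, if_neg (by omega)]
      exact h.cover i (Finset.mem_Icc.mpr ⟨(Finset.mem_Icc.mp hi).1, hit⟩)
    · obtain rfl : i = t + 1 := by have := (Finset.mem_Icc.mp hi).2; omega
      rw [Finset.filter_insert, if_pos le_rfl]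
      have hn : t + 1 ∉ S.filter (· ≤ t + 1) := fun hh => h.not_mem (Finset.mem_filter.mp hh).1
      refine ⟨Function.update (fun _ => 0) (t + 1) 1, ?_, ?_, ?_⟩
      · rw [sum_insert_update hn _ _ (fun _ y => y)]; simp
      · rw [sum_insert_update hn _ _ (fun i y => y • z i)]; simp
      · rw [sum_insert_update hn _ _ (fun _ y => y ^ 2)]; simp
  · rcases Finset.mem_insert.mp hi with rfl | hi
    · rw [Finset.filter_insert, if_neg (lt_irrefl _)]
      have : S.filter (· < t + 1) = S := Finset.filter_true_of_mem fun j hj => by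
        have := h.le_of_mem hj
        omega
      rw [this]
      exact hs
    · have := h.le_of_mem hi
      rw [Finset.filter_insert, if_neg (by omega)]
      exact h.select i hi

end IsSelection

/-! ### The invariant of the stream and the existence of a run -/

namespace RealRAM

/-- The last coordinate of the lift records the sum of the coefficients. -/
theorem sum_smul_liftPt {d : ℕ} (z : ℕ → EuclideanSpace ℝ (Fin d)) (S : Finset ℕ) (c : ℕ → ℝ)
    (y : EuclideanSpace ℝ (Fin d)) :
    ∑ i ∈ S, c i • liftPt (z i) = liftPt y ↔ ∑ i ∈ S, c i = 1 ∧ ∑ i ∈ S, c i • z i = y := by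
  constructor
  · intro h
    refine ⟨?_, ?_⟩
    · simpa [liftPt, Finset.sum_apply] using congrFun h (Fin.last d)
    · ext i
      have := congrFun h (Fin.castSucc i)
      simpa [liftPt, Finset.sum_apply] using this
  · rintro ⟨h1, h2⟩
    ext i
    by_cases hi : (i : ℕ) < d
    · rw [← h2]
      simp [liftPt, Finset.sum_apply, hi]
    · simpa [liftPt, Finset.sum_apply, hi] using h1

/-- The state of the machine after the treatment of `z 1, …, z t`, of which those with index in `S`
have been selected. -/
structure StreamInv {d : ℕ} (z : ℕ → EuclideanSpace ℝ (Fin d)) (t : ℕ) (S : Finset ℕ)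
    (s : State) : Prop where
  dim : s.reg 0 = d
  count : s.count d = S.card
  center : (S.card : ℝ) • s.center d = ∑ i ∈ S, z i
  scale : 1 ≤ t → s.scale d = 1 / (S.card + 1)
  span : SpanForm (fun i => liftPt (z i)) S (s.proj d) (s.form d)
  selection : IsSelection z t S

theorem StreamInv.start {d : ℕ} (z : ℕ → EuclideanSpace ℝ (Fin d)) {s : State} (h0 : s.reg 0 = d)
    (h1 : s.count d = 0) (h2 : s.proj d = 1) (h3 : s.form d = 0) : StreamInv z 0 ∅ s where
  dim := h0
  count := by simp [h1]
  center := by simp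
  scale := by simp
  span := by
    rw [h2, h3]
    refine ⟨by simp, by simp, by simp, by simp, by simp, by simp⟩
  selection := .zero z

open Matrix in
theorem StreamInv.step {d : ℕ} (hd : 1 ≤ d) {z : ℕ → EuclideanSpace ℝ (Fin d)} {t : ℕ}
    {S : Finset ℕ} {s : State} (h : StreamInv z t S s) :
    ∃ k s', Exec (20 * d ^ 2) stepCmd (s.receive (z (t + 1))) k s' ∧ k ≤ 60000 * d ^ 2 ∧
      StreamInv z (t + 1) (if s'.reg 1 = 0 then S else S ∪ {t + 1}) s' := by
  obtain ⟨k, s', he, hk, h0, hcase⟩ := step_spec hd s h.dim (by rw [h.count]; positivity)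
    (z (t + 1)) rfl rfl rfl rfl rfl rfl
  refine ⟨k, s', he, hk, ?_⟩
  have hn := h.selection.not_mem
  have sel : ∀ hs : Selects d (z (t + 1)) s s',
      SpanForm (fun i => liftPt (z i)) (insert (t + 1) S) (s'.proj d) (s'.form d) →
      (∀ c : ℕ → ℝ, ∑ j ∈ S, c j = 1 →
        ∑ j ∈ S, c j • z j = z (t + 1) → 1 < ∑ j ∈ S, c j ^ 2) →
      StreamInv z (t + 1) (if s'.reg 1 = 0 then S else S ∪ {t + 1}) s' := by
    rintro ⟨r1, r2, r3, r4⟩ hspan hsel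
    rw [r1, if_neg one_ne_zero, Finset.union_comm, ← Finset.insert_eq]
    have hcard : ((insert (t + 1) S).card : ℝ) = S.card + 1 := by
      rw [Finset.card_insert_of_notMem hn]; push_cast; rfl
    refine ⟨h0, by rw [r2, h.count, hcard], ?_, fun _ => by rw [r4, h.count, hcard], hspan,
      h.selection.insert hsel⟩
    have hne : (S.card : ℝ) + 1 ≠ 0 := by positivity
    rw [hcard, Finset.sum_insert hn, ← h.center, r3, h.count, smul_add, smul_smul,
      mul_inv_cancel₀ hne]
    module
  rcases hcase with ⟨ha, hs, hP, hQ⟩ | ⟨ha, hb, hs, hP, hQ⟩ | ⟨ha, hb, r1, r2, r3, r4, hP, hQ⟩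
  · refine sel hs ?_ fun c hc1 hc2 => ?_
    · rw [hP, hQ]
      exact h.span.insert_new (v := fun i => liftPt (z i)) hn rfl rfl rfl rfl ha
    · have := h.span.proj_sum c
      rw [(sum_smul_liftPt z S c _).mpr ⟨hc1, hc2⟩] at this
      rw [this, dotProduct_zero] at ha
      exact absurd ha (lt_irrefl _)
  · refine sel hs ?_ fun c hc1 hc2 => ?_
    · rw [hP, hQ]
      exact h.span.insert_old (v := fun i => liftPt (z i)) hn ha rfl rfl (by linarith)
    · have := h.span.form_le c
      rw [(sum_smul_liftPt z S c _).mpr ⟨hc1, hc2⟩] at this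
      linarith
  · rw [r1, if_pos rfl]
    obtain ⟨c, hc1, hc2⟩ := h.span.exists_rep_le ha
    obtain ⟨hc3, hc4⟩ := (sum_smul_liftPt z S c _).mp hc1
    have hsel := h.selection.skip c hc3 hc4 (hc2.trans hb)
    refine ⟨h0, by rw [r2, h.count], by rw [r3, h.center], fun _ => ?_, by rw [hP, hQ]; exact h.span,
      hsel⟩
    -- The scaling factor is not initialised, but the first point is never skipped: the empty
    -- selection has no coefficients with sum $1$.
    have ht : 1 ≤ t := by
      by_contra ht
      have : S ⊆ ∅ := by simpa [show t = 0 by omega] using h.selection.subset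
      rw [Finset.subset_empty.mp this] at hc3
      simp at hc3
    rw [r4, h.scale ht]

/-- The run of the algorithm on a stream. -/
theorem exists_run {d : ℕ} (hd : 1 ≤ d) (z : ℕ → EuclideanSpace ℝ (Fin d)) :
    ∃ (σ : ℕ → State) (τ : ℕ → ℕ), IsRun coresetAlg (20 * d ^ 2) z σ τ ∧
      (∀ t, τ t ≤ 60000 * d ^ 2) ∧ ∀ t, StreamInv z t (coreset σ t) (σ t) := by
  obtain ⟨k₀, s₀, he, hk, h0, h1, -, h2, h3⟩ := start_spec hd
  -- The successor is stated for arbitrary triples, with the invariant inside as a premise, so that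
  -- `choose` yields a plain function to iterate. Outside the invariant the value is irrelevant.
  have hstep : ∀ (t : ℕ) (p : State × ℕ × Finset ℕ), ∃ q : State × ℕ × Finset ℕ,
      StreamInv z t p.2.2 p.1 →
        Exec (20 * d ^ 2) stepCmd (p.1.receive (z (t + 1))) q.2.1 q.1 ∧ q.2.1 ≤ 60000 * d ^ 2 ∧
        q.2.2 = (if q.1.reg 1 = 0 then p.2.2 else p.2.2 ∪ {t + 1}) ∧
        StreamInv z (t + 1) q.2.2 q.1 := by
    intro t p
    by_cases hp : StreamInv z t p.2.2 p.1
    · obtain ⟨k, s', g1, g2, g3⟩ := hp.step hd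
      exact ⟨(s', k, _), fun _ => ⟨g1, g2, rfl, g3⟩⟩
    · exact ⟨p, fun h => absurd h hp⟩
  choose f hf using hstep
  let run : ℕ → State × ℕ × Finset ℕ := fun t => Nat.rec (s₀, k₀, ∅) f t
  have hinv : ∀ t, StreamInv z t (run t).2.2 (run t).1 := by
    intro t
    induction t with
    | zero => exact .start z h0 h1 h2 h3
    | succ t ih => exact (hf t (run t) ih).2.2.2
  have hcore : ∀ t, coreset (fun t => (run t).1) t = (run t).2.2 := by
    intro t
    induction t with
    | zero => rfl
    | succ t ih => rw [coreset, ih, (hf t (run t) (hinv t)).2.2.1.symm]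
  refine ⟨fun t => (run t).1, fun t => (run t).2.1, ⟨he, fun t => (hf t (run t) (hinv t)).1⟩, ?_,
    fun t => ?_⟩
  · rintro (_ | t)
    · exact hk.trans (by nlinarith)
    · exact (hf t (run t) (hinv t)).2.1
  · rw [hcore]
    exact hinv t

end RealRAM

/-! ### Counting selected vectors by determinants -/

section Determinant
open Matrix

variable {κ : Type*} [Fintype κ]

theorem det_add_vecMulVec [DecidableEq κ] {A : Matrix κ κ ℝ} (hA : IsUnit A.det) (x y : κ → ℝ) :
    (A + vecMulVec x y).det = A.det * (1 + y ⬝ᵥ A⁻¹ *ᵥ x) := by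
  have h := det_add_replicateCol_mul_replicateRow (ι := Unit) hA x y
  have e : replicateCol Unit x * replicateRow Unit y = vecMulVec x y := by
    ext i j; simp [Matrix.mul_apply, vecMulVec_apply]
  rw [e] at h
  rw [h, det_unique (1 + replicateRow Unit y * A⁻¹ * replicateCol Unit x), Matrix.add_apply,
    Matrix.one_apply_eq]
  congr 2
  rw [Matrix.mul_assoc, ← replicateCol_mulVec, replicateRow_mul_replicateCol_apply]

/-- The determinant of a positive semidefinite matrix is at most a power of its mean diagonal
entry. -/
theorem det_le_trace_div_card_pow [DecidableEq κ] {A : Matrix κ κ ℝ} (hA : A.PosSemidef) :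
    A.det ≤ (A.trace / Fintype.card κ) ^ Fintype.card κ := by
  rcases isEmpty_or_nonempty κ with hκ | hκ
  · simp
  have hc : (0 : ℝ) < Fintype.card κ := by exact_mod_cast Fintype.card_pos
  have h0 : ∀ i, 0 ≤ hA.1.eigenvalues i := hA.eigenvalues_nonneg
  have h := Real.geom_mean_le_arith_mean Finset.univ (fun _ => (1 : ℝ)) hA.1.eigenvalues
    (fun _ _ => zero_le_one) (by simpa using hc) (fun i _ => h0 i)
  simp only [Real.rpow_one, one_mul, Finset.sum_const, Finset.card_univ, nsmul_eq_mul,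
    mul_one] at h
  have h1 : A.det = ∏ i, hA.1.eigenvalues i := by simpa using hA.1.det_eq_prod_eigenvalues
  have h2 : A.trace = ∑ i, hA.1.eigenvalues i := by simpa using hA.1.trace_eq_sum_eigenvalues
  have hp : 0 ≤ ∏ i, hA.1.eigenvalues i := Finset.prod_nonneg fun i _ => h0 i
  rw [h1, h2]
  calc ∏ i, hA.1.eigenvalues i
      = ((∏ i, hA.1.eigenvalues i) ^ ((Fintype.card κ : ℝ)⁻¹)) ^ Fintype.card κ := by
        rw [← Real.rpow_natCast, ← Real.rpow_mul hp, inv_mul_cancel₀ hc.ne', Real.rpow_one]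
    _ ≤ _ := pow_le_pow_left₀ (Real.rpow_nonneg hp _) h _

variable {V : Type*} [NormedAddCommGroup V] [InnerProductSpace ℝ V]

/-- The scatter matrix of the vectors `v i`, `i ∈ J`, in the coordinates `⟪e k, ·⟫`. -/
noncomputable def scatter (e : κ → V) (v : ℕ → V) (J : Finset ℕ) : Matrix κ κ ℝ :=
  ∑ i ∈ J, vecMulVec (fun k => inner ℝ (e k) (v i)) (fun k => inner ℝ (e k) (v i))

theorem scatter_posSemidef (e : κ → V) (v : ℕ → V) (J : Finset ℕ) :
    (scatter e v J).PosSemidef := by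
  refine posSemidef_sum _ fun i _ => ?_
  simpa using posSemidef_vecMulVec_self_star (fun k => (inner ℝ (e k) (v i) : ℝ))

/-- Solving a linear system with the scatter matrix produces the coefficients of a representation by
the vectors `v i`. -/
theorem scatter_mulVec (e : κ → V) (v : ℕ → V) (J : Finset ℕ) (y : κ → ℝ) (k : κ) :
    (scatter e v J *ᵥ y) k =
      inner ℝ (e k) (∑ i ∈ J, ((fun k => inner ℝ (e k) (v i)) ⬝ᵥ y) • v i) := by
  simp only [scatter, sum_mulVec, vecMulVec_mulVec_eq, Finset.sum_apply, Pi.smul_apply,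
    inner_sum, inner_smul_right, smul_eq_mul]

/-- Bessel's inequality for each vector. -/
theorem trace_scatter_le {e : κ → V} (he : Orthonormal ℝ e) (v : ℕ → V) (J : Finset ℕ) :
    (scatter e v J).trace ≤ ∑ i ∈ J, ‖v i‖ ^ 2 := by
  rw [scatter, trace_sum]
  refine Finset.sum_le_sum fun i _ => ?_
  have := he.sum_inner_products_le (v i) (s := Finset.univ)
  simp only [Real.norm_eq_abs, sq_abs] at this
  rw [trace_vecMulVec]
  simpa [dotProduct, sq] using this

/-- Each selected vector that is not in the basis doubles the determinant of the scatter matrix. -/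
theorem two_pow_mul_det_scatter_le [DecidableEq κ] {e : κ → V} {v : ℕ → V} {S B : Finset ℕ} (hBS : B ⊆ S)
    (he : ∀ x ∈ Submodule.span ℝ (v '' B), (∀ k, inner ℝ (e k) x = 0) → x = 0)
    (hB : LinearIndepOn ℝ v (B : Set ℕ)) (hdet : 0 < (scatter e v B).det)
    (hspan : ∀ i ∈ S, v i ∈ Submodule.span ℝ (v '' {b | b ∈ B ∧ b ≤ i}))
    (hsel : ∀ i ∈ S, ∀ c : ℕ → ℝ, ∑ j ∈ S with j < i, c j • v j = v i →
      1 < ∑ j ∈ S with j < i, c j ^ 2) :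
    2 ^ (S.card - B.card) * (scatter e v B).det ≤ (scatter e v S).det := by
  -- All basis vectors are present from the beginning, also those that arrive after `t`; this keeps
  -- the scatter matrix invertible throughout.
  have key : ∀ t : ℕ, 2 ^ (S.filter (fun i => i ∉ B ∧ i < t)).card * (scatter e v B).det ≤
      (scatter e v (S.filter (fun i => i ∈ B ∨ i < t))).det := by
    intro t
    induction t with
    | zero =>
      have h1 : S.filter (fun i => i ∉ B ∧ i < 0) = ∅ := by simp
      have h2 : S.filter (fun i => i ∈ B ∨ i < 0) = B := by
        ext i; simp only [Finset.mem_filter, not_lt_zero, or_false]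
        exact ⟨fun h => h.2, fun h => ⟨hBS h, h⟩⟩
      rw [h1, h2]; simp
    | succ t ih =>
      by_cases ht : t ∈ S ∧ t ∉ B
      · obtain ⟨htS, htB⟩ := ht
        set J := S.filter (fun i => i ∈ B ∨ i < t) with hJ
        have htJ : t ∉ J := by simp [hJ, htB]
        have h1 : S.filter (fun i => i ∉ B ∧ i < t + 1) =
            insert t (S.filter (fun i => i ∉ B ∧ i < t)) := by
          ext i
          simp only [Finset.mem_filter, Finset.mem_insert, Nat.lt_succ_iff_lt_or_eq]
          constructor
          · rintro ⟨a, b, c | c⟩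
            · exact Or.inr ⟨a, b, c⟩
            · exact Or.inl c
          · rintro (rfl | ⟨a, b, c⟩)
            · exact ⟨htS, htB, Or.inr rfl⟩
            · exact ⟨a, b, Or.inl c⟩
        have h2 : S.filter (fun i => i ∈ B ∨ i < t + 1) = insert t J := by
          ext i
          simp only [hJ, Finset.mem_filter, Finset.mem_insert, Nat.lt_succ_iff_lt_or_eq]
          constructor
          · rintro ⟨a, b | b | b⟩
            · exact Or.inr ⟨a, Or.inl b⟩
            · exact Or.inr ⟨a, Or.inr b⟩
            · exact Or.inl b
          · rintro (rfl | ⟨a, b | b⟩)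
            · exact ⟨htS, Or.inr (Or.inr rfl)⟩
            · exact ⟨a, Or.inl b⟩
            · exact ⟨a, Or.inr (Or.inl b)⟩
        have hpos : 0 < (scatter e v J).det := lt_of_lt_of_le (by positivity) ih
        have hunit : IsUnit (scatter e v J).det := hpos.ne'.isUnit
        set x : κ → ℝ := fun k => inner ℝ (e k) (v t) with hx
        set y := (scatter e v J)⁻¹ *ᵥ x with hy
        set c : ℕ → ℝ := fun i => (fun k => inner ℝ (e k) (v i)) ⬝ᵥ y with hc
        have hAy : scatter e v J *ᵥ y = x := by
          rw [hy, mulVec_mulVec, mul_nonsing_inv _ hunit, one_mulVec]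
        have hmem : ∀ i ∈ S, v i ∈ Submodule.span ℝ (v '' B) := fun i hi =>
          Submodule.span_mono (Set.image_mono fun b hb => hb.1) (hspan i hi)
        -- Both sides lie in the span of the basis and have the same coordinates, and by `he` the
        -- coordinates separate points there.
        have hrep : ∑ i ∈ J, c i • v i = v t := by
          rw [← sub_eq_zero]
          refine he _ (sub_mem (sum_mem fun i hi => Submodule.smul_mem _ _ (hmem i ?_))
            (hmem t htS)) fun k => ?_
          · exact (Finset.mem_filter.mp hi).1
          · rw [inner_sub_right, ← scatter_mulVec, hAy, hx, sub_self]
        have hsq : x ⬝ᵥ y = ∑ i ∈ J, c i ^ 2 := by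
          conv_lhs => rw [← hAy]
          rw [dotProduct_comm, scatter, sum_mulVec, dotProduct_sum]
          refine Finset.sum_congr rfl fun i _ => ?_
          rw [vecMulVec_mulVec_eq, dotProduct_smul, dotProduct_comm y, sq, smul_eq_mul]
        have hmem_lt : ∀ i ∈ S, i < t ∨ i = t →
            v i ∈ Submodule.span ℝ (v '' {b | b ∈ B ∧ b < t}) := by
          rintro i hi hit
          refine Submodule.span_mono (Set.image_mono ?_) (hspan i hi)
          rintro b ⟨hb1, hb2⟩
          refine ⟨hb1, ?_⟩
          rcases hit with hit | rfl
          · omega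
          · exact lt_of_le_of_ne hb2 (by rintro rfl; exact htB hb1)
        have hsplit : S.filter (· < t) ∪ B.filter (t ≤ ·) = J := by
          ext i
          simp only [hJ, Finset.mem_union, Finset.mem_filter]
          constructor
          · rintro (⟨a, b⟩ | ⟨a, b⟩)
            · exact ⟨a, Or.inr b⟩
            · exact ⟨hBS a, Or.inl a⟩
          · rintro ⟨a, b⟩
            by_cases hit : i < t
            · exact Or.inl ⟨a, hit⟩
            · exact Or.inr ⟨b.resolve_right hit, not_lt.mp hit⟩
        have hdisj : Disjoint (S.filter (· < t)) (B.filter (t ≤ ·)) := by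
          rw [Finset.disjoint_left]
          intro i hi hi'
          have := (Finset.mem_filter.mp hi).2
          have := (Finset.mem_filter.mp hi').2
          omega
        have hsum := hrep
        rw [← hsplit, Finset.sum_union hdisj] at hsum
        have hunion : (B : Set ℕ) = {b | b ∈ B ∧ b < t} ∪ ((B.filter (t ≤ ·) : Finset ℕ) : Set ℕ) := by
          ext b
          simp only [Finset.mem_coe, Set.mem_union, Set.mem_ofPred_eq, Finset.coe_filter]
          have := lt_or_ge b t
          tauto
        have hdisj' : Disjoint {b | b ∈ B ∧ b < t} ((B.filter (t ≤ ·) : Finset ℕ) : Set ℕ) := by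
          rw [Set.disjoint_left]
          rintro b ⟨-, hb⟩ hb'
          have := (Finset.mem_filter.mp (Finset.mem_coe.mp hb')).2
          omega
        rw [hunion, linearIndepOn_union_iff hdisj'] at hB
        -- The part of the representation on later basis vectors also lies in the span of the
        -- earlier ones, so it vanishes, and so do its coefficients. What remains is a
        -- representation by selected vectors before `t`, to which the selection rule applies.
        have hz : ∑ i ∈ B with t ≤ i, c i • v i = 0 := by
          refine Submodule.disjoint_def.mp hB.2.2 _ ?_ ?_
          · rw [eq_sub_of_add_eq' hsum]
            refine sub_mem (hmem_lt t htS (Or.inr rfl)) (sum_mem fun i hi => ?_)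
            obtain ⟨a, b⟩ := Finset.mem_filter.mp hi
            exact Submodule.smul_mem _ _ (hmem_lt i a (Or.inl b))
          · exact sum_mem fun i hi => Submodule.smul_mem _ _
              (Submodule.subset_span (Set.mem_image_of_mem _ hi))
        have hcz : ∀ i ∈ B.filter (t ≤ ·), c i = 0 := linearIndepOn_finset_iff.mp hB.2.1 c hz
        have h3 : 1 < x ⬝ᵥ y := by
          rw [hsq, ← hsplit, Finset.sum_union hdisj,
            Finset.sum_eq_zero (s := B.filter (t ≤ ·)) (fun i hi => by rw [hcz i hi]; norm_num),
            add_zero]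
          exact hsel t htS c (by rw [hz, add_zero] at hsum; exact hsum)
        have h4 : scatter e v (insert t J) = scatter e v J + vecMulVec x x := by
          rw [scatter, Finset.sum_insert htJ, add_comm]; rfl
        rw [h1, h2, Finset.card_insert_of_notMem (by simp), h4, det_add_vecMulVec hunit, ← hy,
          pow_succ]
        nlinarith
      · have h1 : S.filter (fun i => i ∉ B ∧ i < t + 1) = S.filter (fun i => i ∉ B ∧ i < t) := by
          refine Finset.filter_congr fun i hi => and_congr_right fun hiB => ?_
          have : i ≠ t := by rintro rfl; exact ht ⟨hi, hiB⟩
          omega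
        have h2 : S.filter (fun i => i ∈ B ∨ i < t + 1) = S.filter (fun i => i ∈ B ∨ i < t) := by
          refine Finset.filter_congr fun i hi => ?_
          by_cases hiB : i ∈ B
          · simp [hiB]
          · have : i ≠ t := by rintro rfl; exact ht ⟨hi, hiB⟩
            simp only [hiB, false_or]
            omega
        rw [h1, h2]
        exact ih
  have hlt : ∀ i ∈ S, i < S.sup id + 1 := fun i hi =>
    Nat.lt_succ_of_le (Finset.le_sup (f := id) hi)
  have h := key (S.sup id + 1)
  have h1 : S.filter (fun i => i ∉ B ∧ i < S.sup id + 1) = S \ B := by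
    ext i
    simp only [Finset.mem_filter, Finset.mem_sdiff]
    exact ⟨fun h => ⟨h.1, h.2.1⟩, fun h => ⟨h.1, h.2, hlt i h.1⟩⟩
  have h2 : S.filter (fun i => i ∈ B ∨ i < S.sup id + 1) = S :=
    Finset.filter_true_of_mem fun i hi => Or.inr (hlt i hi)
  rwa [h1, h2, Finset.card_sdiff_of_subset hBS] at h

end Determinant

/-! ### The counting inequality in terms of Gram-Schmidt heights -/

section Count
open InnerProductSpace

variable {V : Type*} [NormedAddCommGroup V] [InnerProductSpace ℝ V]

/-- The height of a linearly independent vector over the span of the previous ones. -/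
noncomputable def gramHeight (v : ℕ → V) (B : Finset ℕ) (b : B) : ℝ :=
  inner ℝ (gramSchmidtNormed ℝ (fun b : B => v b) b) (v b)

theorem inner_gramSchmidtNormed_eq_zero (v : ℕ → V) (B : Finset ℕ) {b b' : B} (h : b' < b) :
    inner ℝ (gramSchmidtNormed ℝ (fun b : B => v b) b) (v b') = 0 := by
  rw [gramSchmidtNormed, inner_smul_left,
    gramSchmidt_inv_triangular ℝ (fun b : B => v b) h, mul_zero]

-- The coordinate matrix is triangular, since each Gram-Schmidt vector is orthogonal to all earlier
-- vectors.
open Matrix in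
theorem det_coord_gramSchmidt (v : ℕ → V) (B : Finset ℕ) :
    (Matrix.of fun k l : B => inner ℝ (gramSchmidtNormed ℝ (fun b : B => v b) k) (v l)).det =
      ∏ b, gramHeight v B b := by
  rw [Matrix.det_of_isUpperTriangular]
  · rfl
  · intro i j hij
    exact inner_gramSchmidtNormed_eq_zero v B hij

-- In Gram-Schmidt coordinates the initial determinant is the square of a triangular one; AM-GM on
-- the eigenvalues together with Bessel bounds the final one.
open Matrix in
theorem two_pow_mul_prod_gramHeight_le {v : ℕ → V} {S B : Finset ℕ} (hBS : B ⊆ S)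
    (hB : LinearIndepOn ℝ v (B : Set ℕ)) (hne : ∀ b, gramHeight v B b ≠ 0)
    (hspan : ∀ i ∈ S, v i ∈ Submodule.span ℝ (v '' {b | b ∈ B ∧ b ≤ i}))
    (hsel : ∀ i ∈ S, ∀ c : ℕ → ℝ, ∑ j ∈ S with j < i, c j • v j = v i →
      1 < ∑ j ∈ S with j < i, c j ^ 2) :
    2 ^ (S.card - B.card) * (∏ b, gramHeight v B b) ^ 2 ≤
      ((∑ i ∈ S, ‖v i‖ ^ 2) / B.card) ^ B.card := by
  set f : B → V := fun b => v b with hf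
  have hLI : LinearIndependent ℝ f := hB
  set e := gramSchmidtNormed ℝ f with he
  have hon : Orthonormal ℝ e := gramSchmidtNormed_orthonormal hLI
  have hdet : (scatter e v B).det = (∏ b, gramHeight v B b) ^ 2 := by
    have : scatter e v B = (Matrix.of fun k l : B => inner ℝ (e k) (v l)) *
        (Matrix.of fun k l : B => inner ℝ (e k) (v l))ᵀ := by
      ext k l
      rw [scatter, Matrix.sum_apply, Matrix.mul_apply, ← Finset.sum_coe_sort]
      rfl
    rw [this, Matrix.det_mul, Matrix.det_transpose, det_coord_gramSchmidt, sq]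
  have hpos : 0 < (scatter e v B).det := by
    rw [hdet]
    have := Finset.prod_ne_zero_iff.mpr fun b (_ : b ∈ Finset.univ) => hne b
    positivity
  have hsp : Submodule.span ℝ (v '' B) = Submodule.span ℝ (Set.range e) := by
    rw [he, span_gramSchmidtNormed_range, span_gramSchmidt]
    congr 1
    ext x
    simp [hf]
  have h := two_pow_mul_det_scatter_le (e := e) hBS ?_ hB hpos hspan hsel
  · rw [← hdet]
    refine h.trans ((det_le_trace_div_card_pow (scatter_posSemidef e v S)).trans ?_)
    rw [Fintype.card_coe]
    refine pow_le_pow_left₀ (div_nonneg ?_ (Nat.cast_nonneg _)) ?_ _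
    · exact (scatter_posSemidef e v S).trace_nonneg
    · exact div_le_div_of_nonneg_right (trace_scatter_le hon v S) (Nat.cast_nonneg _)
  · intro x hx h0
    rw [hsp] at hx
    have : x ∈ (Submodule.span ℝ (Set.range e))ᗮ := by
      rw [Submodule.mem_orthogonal]
      intro u hu
      induction hu using Submodule.span_induction with
      | mem u hu => obtain ⟨k, rfl⟩ := hu; exact h0 k
      | zero => simp
      | add a b _ _ ha hb => rw [inner_add_left, ha, hb, add_zero]
      | smul r a _ ha => rw [inner_smul_left, ha, mul_zero]
    exact (Submodule.mem_bot ℝ).mp ((Submodule.orthogonal_disjoint _).le_bot ⟨hx, this⟩)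

end Count

/-! ### Inradius and circumradius of the stream -/

section Geometry

variable {d : ℕ} {z : ℕ → EuclideanSpace ℝ (Fin d)}

theorem mem_hullOf {T : Finset ℕ} {i : ℕ} (hi : i ∈ T) : z i ∈ hullOf z T :=
  subset_convexHull ℝ _ (Set.mem_image_of_mem z (Finset.mem_coe.mpr hi))

/-- `c + r • (B ∩ span (K - c)) ⊆ K`. -/
def IsInball (K : Set (EuclideanSpace ℝ (Fin d))) (c : EuclideanSpace ℝ (Fin d)) (r : ℝ) : Prop :=
  ∀ v ∈ Submodule.span ℝ ((fun x => x - c) '' K), ‖v‖ ≤ 1 → c + r • v ∈ K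

/-- If the last point is the only one off a hyperplane, at height `h`, then inballs have
diameter at most `h`. -/
theorem two_mul_radius_le_of_height {t : ℕ} {u : EuclideanSpace ℝ (Fin d)} {h : ℝ} (hh : 0 ≤ h)
    (hu : ‖u‖ = 1)
    (hmem : u ∈ Submodule.span ℝ ((fun j => z j - z 1) '' (Finset.Icc 1 t : Set ℕ)))
    (h0 : ∀ j ∈ Finset.Icc 1 t, j ≠ t → inner ℝ u (z j - z 1) = 0)
    (ht : inner ℝ u (z t - z 1) = h) {c : EuclideanSpace ℝ (Fin d)} {r : ℝ}
    (hr : IsInball (hullOf z (Finset.Icc 1 t)) c r) : 2 * r ≤ h := by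
  by_cases ht1 : 1 ≤ t
  swap
  · have : Finset.Icc 1 t = ∅ := Finset.Icc_eq_empty ht1
    rw [this] at hmem
    simp only [Finset.coe_empty, Set.image_empty, Submodule.span_empty, Submodule.mem_bot] at hmem
    simp [hmem] at hu
  have hK : ∀ x ∈ hullOf z (Finset.Icc 1 t), inner ℝ u (x - z 1) ∈ Set.Icc 0 h := by
    have hconv : Convex ℝ {x : EuclideanSpace ℝ (Fin d) | inner ℝ u (x - z 1) ∈ Set.Icc 0 h} := by
      intro x hx y hy a b ha hb hab
      have : a • x + b • y - z 1 = a • (x - z 1) + b • (y - z 1) := by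
        have : z 1 = (a + b) • z 1 := by rw [hab, one_smul]
        conv_lhs => rw [this]
        module
      have hI := convex_Icc (𝕜 := ℝ) (0 : ℝ) h hx hy ha hb hab
      simpa only [Set.mem_ofPred_eq, this, inner_add_right, inner_smul_right, smul_eq_mul] using hI
    refine fun x hx => convexHull_min ?_ hconv hx
    rintro _ ⟨j, hj, rfl⟩
    by_cases hjt : j = t
    · simp [hjt, ht, hh]
    · simp [h0 j (Finset.mem_coe.mp hj) hjt, hh]
  have hus : u ∈ Submodule.span ℝ ((fun x => x - c) '' hullOf z (Finset.Icc 1 t)) := by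
    refine Submodule.span_le.mpr ?_ hmem
    rintro _ ⟨j, hj, rfl⟩
    have : z j - z 1 = (z j - c) - (z 1 - c) := by module
    simp only [this]
    exact sub_mem (Submodule.subset_span ⟨z j, mem_hullOf (Finset.mem_coe.mp hj), rfl⟩)
      (Submodule.subset_span ⟨z 1, mem_hullOf (by simp [ht1]), rfl⟩)
  -- Both $c\pm ru$ lie in the slab of width $h$, and their heights differ by $2r$.
  have h1 := (hK _ (hr u hus hu.le)).2
  have h2 := (hK _ (hr (-u) (neg_mem hus) (by rw [norm_neg, hu]))).1
  have e1 : c + r • u - z 1 = (c - z 1) + r • u := by module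
  have e2 : c + r • -u - z 1 = (c - z 1) - r • u := by module
  rw [e1, inner_add_right, inner_smul_right, real_inner_self_eq_norm_sq, hu] at h1
  rw [e2, inner_sub_right, inner_smul_right, real_inner_self_eq_norm_sq, hu] at h2
  linarith

/-- Positivity comes from a relative interior point of the hull. It is needed because the inradius
is a denominator in `maxAspect`, where division by zero would give the value $0$. -/
theorem inradius_pos_le {t : ℕ} (ht1 : 1 ≤ t) {u : EuclideanSpace ℝ (Fin d)} {h : ℝ} (hh : 0 ≤ h)
    (hu : ‖u‖ = 1)
    (hmem : u ∈ Submodule.span ℝ ((fun j => z j - z 1) '' (Finset.Icc 1 t : Set ℕ)))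
    (h0 : ∀ j ∈ Finset.Icc 1 t, j ≠ t → inner ℝ u (z j - z 1) = 0)
    (ht : inner ℝ u (z t - z 1) = h) :
    0 < inradius (hullOf z (Finset.Icc 1 t)) ∧ 2 * inradius (hullOf z (Finset.Icc 1 t)) ≤ h := by
  set K := hullOf z (Finset.Icc 1 t) with hKdef
  have hz1 : z 1 ∈ K := mem_hullOf (by simp [ht1])
  have hle : ∀ r ∈ {r : ℝ | 0 ≤ r ∧ ∃ c : EuclideanSpace ℝ (Fin d),
    ∀ v ∈ Submodule.span ℝ ((fun x => x - c) '' K), ‖v‖ ≤ 1 → c + r • v ∈ K}, r ≤ h / 2 := by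
    rintro r ⟨-, c, hc⟩
    have := two_mul_radius_le_of_height hh hu hmem h0 ht hc
    linarith
  have hK : Convex ℝ K := convex_convexHull ℝ _
  constructor
  · obtain ⟨c, hc⟩ := (intrinsicInterior_nonempty hK).mpr ⟨z 1, hz1⟩
    have hcK : c ∈ K := intrinsicInterior_subset hc
    obtain ⟨y, hy, rfl⟩ := mem_intrinsicInterior.mp hc
    obtain ⟨ε, hε, hball⟩ := Metric.mem_nhds_iff.mp (mem_interior_iff_mem_nhds.mp hy)
    have : ε / 2 ≤ inradius K := by
      refine le_csSup ⟨h / 2, hle⟩ ⟨by positivity, y, fun v hv hv1 => ?_⟩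
      have hdir : v ∈ (affineSpan ℝ K).direction := by
        rw [direction_affineSpan, vectorSpan_eq_span_vsub_set_right ℝ hcK]
        exact hv
      have hmemA : (y : EuclideanSpace ℝ (Fin d)) + (ε / 2) • v ∈ affineSpan ℝ K := by
        rw [add_comm]
        exact AffineSubspace.vadd_mem_of_mem_direction (Submodule.smul_mem _ _ hdir) y.2
      have : (⟨_, hmemA⟩ : affineSpan ℝ K) ∈ Metric.ball y ε := by
        rw [Metric.mem_ball, Subtype.dist_eq, dist_eq_norm, add_sub_cancel_left, norm_smul,
          Real.norm_of_nonneg (by positivity)]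
        nlinarith [norm_nonneg v]
      exact hball this
    linarith
  · have : inradius K ≤ h / 2 := by
      refine csSup_le ⟨0, le_rfl, z 1, fun v _ _ => ?_⟩ hle
      simpa using hz1
    linarith

theorem circumradius_set_nonempty (T : Finset ℕ) :
    {R : ℝ | 0 ≤ R ∧ ∃ c : EuclideanSpace ℝ (Fin d), hullOf z T ⊆ Metric.closedBall c R}.Nonempty := by
  have hb : Bornology.IsBounded (hullOf z T) :=
    isBounded_convexHull.mpr (T.finite_toSet.image z).isBounded
  obtain ⟨R, hR⟩ := hb.subset_closedBall 0
  exact ⟨max R 0, le_max_right _ _, 0, hR.trans (Metric.closedBall_subset_closedBall (le_max_left _ _))⟩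

theorem le_circumradius {T : Finset ℕ} {a : ℝ}
    (h : ∀ (R : ℝ) (c : EuclideanSpace ℝ (Fin d)), 0 ≤ R → (∀ i ∈ T, ‖z i - c‖ ≤ R) → a ≤ R) :
    a ≤ circumradius (hullOf z T) := by
  refine le_csInf (circumradius_set_nonempty T) ?_
  rintro R ⟨hR, c, hc⟩
  refine h R c hR fun i hi => ?_
  simpa [dist_eq_norm] using hc (mem_hullOf hi)

theorem norm_sub_le_circumradius {T : Finset ℕ} {i j : ℕ} (hi : i ∈ T) (hj : j ∈ T) :
    ‖z i - z j‖ ≤ 2 * circumradius (hullOf z T) := by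
  have : ‖z i - z j‖ / 2 ≤ circumradius (hullOf z T) := by
    refine le_circumradius fun R c _ h => ?_
    have e : z i - z j = (z i - c) - (z j - c) := by module
    have := norm_sub_le (z i - c) (z j - c)
    rw [← e] at this
    linarith [h i hi, h j hj]
  linarith

/-- Three points whose first two heights are both at least `θ` do not fit in a ball of radius less
than `5 / 8 * θ`. -/
theorem height_le_circumradius {T : Finset ℕ} {i j k : ℕ} (hi : i ∈ T) (hj : j ∈ T) (hk : k ∈ T)
    {u w : EuclideanSpace ℝ (Fin d)} (hu : ‖u‖ = 1) (hw : ‖w‖ = 1) (huw : inner ℝ u w = 0)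
    {θ : ℝ} (h1 : θ ≤ inner ℝ u (z j - z i))
    (h2 : inner ℝ w (z j - z i) = 0) (h3 : θ ≤ inner ℝ w (z k - z i)) :
    5 / 8 * θ ≤ circumradius (hullOf z T) := by
  refine le_circumradius fun R c hR h => ?_
  have hon : Orthonormal ℝ ![u, w] := by
    rw [orthonormal_iff_ite]
    intro a b
    fin_cases a <;> fin_cases b <;>
      simp [hu, hw, huw, real_inner_comm u w]
  have bessel : ∀ x : EuclideanSpace ℝ (Fin d), ‖x‖ ≤ R →
      (inner ℝ u x) ^ 2 + (inner ℝ w x) ^ 2 ≤ R ^ 2 := by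
    intro x hx
    have := hon.sum_inner_products_le x (s := Finset.univ)
    simp only [Fin.sum_univ_two, Matrix.cons_val_zero, Matrix.cons_val_one, Real.norm_eq_abs,
      sq_abs] at this
    nlinarith [norm_nonneg x]
  have e : ∀ a, z a - z i = (z a - c) - (z i - c) := fun a => by module
  rw [e, inner_sub_right] at h1 h2 h3
  have b1 := bessel _ (h i hi)
  have b2 := bessel _ (h j hj)
  have b3 := bessel _ (h k hk)
  generalize inner ℝ u (z i - c) = a₁ at *
  generalize inner ℝ w (z i - c) = a₂ at *
  generalize inner ℝ u (z j - c) = b₁ at *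
  generalize inner ℝ w (z j - c) = b₂ at *
  generalize inner ℝ w (z k - c) = p₂ at *
  generalize inner ℝ u (z k - c) = p₁ at *
  obtain rfl : b₂ = a₂ := by linarith
  -- The constant is that of the isosceles triangle with base and height $\theta$. If
  -- $R<\frac58\theta$, the common $w$-coordinate of the first two points relative to the center is
  -- below $-\frac35R$, so their $u$-coordinates are less than $\frac45R$ in absolute value and
  -- cannot differ by $\theta>\frac85R$.
  by_contra hcon
  rw [not_le] at hcon
  have hp : p₂ ≤ R := by nlinarith [sq_nonneg p₁]
  have ha : b₂ < -(3 / 5 * R) := by linarith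
  have hsq : (3 / 5 * R) ^ 2 < b₂ ^ 2 := by nlinarith
  have hdiff : (8 / 5 * R) ^ 2 < (b₁ - a₁) ^ 2 := by nlinarith
  nlinarith [sq_nonneg (b₁ + a₁)]

theorem ratio_le_maxAspect {t t' : ℕ} (h : t' ∈ Finset.Icc 1 t) (hd : 1 ≤ dimAt z t') :
    circumradius (hullOf z (Finset.Icc 1 t)) / inradius (hullOf z (Finset.Icc 1 t')) ≤
      maxAspect z t := by
  refine le_csSup ?_ ⟨t', h, hd, rfl⟩
  refine (((Finset.Icc 1 t).finite_toSet.image fun t' =>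
    circumradius (hullOf z (Finset.Icc 1 t)) /
      inradius (hullOf z (Finset.Icc 1 t'))).subset ?_).bddAbove
  rintro x ⟨t', h1, -, rfl⟩
  exact ⟨t', h1, rfl⟩

theorem one_le_dimAt {t i j : ℕ} (hi : i ∈ Finset.Icc 1 t) (hj : j ∈ Finset.Icc 1 t)
    (hij : z i ≠ z j) : 1 ≤ dimAt z t := by
  have hmem : z i - z j ∈ (affineSpan ℝ (z '' (Finset.Icc 1 t : Set ℕ))).direction := by
    have h1 := subset_affineSpan ℝ _ (Set.mem_image_of_mem z (Finset.mem_coe.mpr hi))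
    have h2 := subset_affineSpan ℝ _ (Set.mem_image_of_mem z (Finset.mem_coe.mpr hj))
    exact AffineSubspace.vsub_mem_direction h1 h2
  have : Nontrivial (affineSpan ℝ (z '' (Finset.Icc 1 t : Set ℕ))).direction :=
    ⟨⟨⟨_, hmem⟩, 0, fun h => sub_ne_zero.mpr hij (congrArg Subtype.val h)⟩⟩
  exact Module.finrank_pos

end Geometry

/-! ### Basic indices and their heights -/

section Basis
open InnerProductSpace

variable {V : Type*} [NormedAddCommGroup V] [InnerProductSpace ℝ V]

open Classical in
/-- The indices in `S` of the vectors that are not in the span of the previous ones. -/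
noncomputable def basisIndices (v : ℕ → V) (S : Finset ℕ) : Finset ℕ :=
  S.filter fun i => v i ∉ Submodule.span ℝ (v '' {j | j ∈ S ∧ j < i})

theorem basisIndices_subset (v : ℕ → V) (S : Finset ℕ) : basisIndices v S ⊆ S := by
  classical exact Finset.filter_subset _ _

theorem mem_basisIndices {v : ℕ → V} {S : Finset ℕ} {i : ℕ} :
    i ∈ basisIndices v S ↔ i ∈ S ∧ v i ∉ Submodule.span ℝ (v '' {j | j ∈ S ∧ j < i}) := by
  classical exact Finset.mem_filter

theorem mem_span_basisIndices {v : ℕ → V} {S : Finset ℕ} {i : ℕ} (hi : i ∈ S) :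
    v i ∈ Submodule.span ℝ (v '' {b | b ∈ basisIndices v S ∧ b ≤ i}) := by
  induction i using Nat.strong_induction_on with
  | _ i ih =>
    by_cases hB : i ∈ basisIndices v S
    · exact Submodule.subset_span ⟨i, ⟨hB, le_rfl⟩, rfl⟩
    · have : v i ∈ Submodule.span ℝ (v '' {j | j ∈ S ∧ j < i}) := by
        by_contra h
        exact hB (mem_basisIndices.mpr ⟨hi, h⟩)
      refine Submodule.span_le.mpr ?_ this
      rintro _ ⟨j, ⟨hj, hji⟩, rfl⟩
      refine Submodule.span_mono (Set.image_mono ?_) (ih j hji hj)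
      exact fun b hb => ⟨hb.1, hb.2.trans hji.le⟩

theorem linearIndepOn_basisIndices (v : ℕ → V) (S : Finset ℕ) :
    LinearIndepOn ℝ v (basisIndices v S : Set ℕ) := by
  suffices h : ∀ B ⊆ basisIndices v S, LinearIndepOn ℝ v (B : Set ℕ) from h _ subset_rfl
  intro B
  induction B using Finset.induction_on_max with
  | empty => intro _; simp
  | insert a B hB ih =>
    intro h
    rw [Finset.coe_insert]
    refine (ih ((Finset.subset_insert _ _).trans h)).insert fun hmem => ?_
    refine (mem_basisIndices.mp (h (Finset.mem_insert_self _ _))).2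
      (Submodule.span_mono (Set.image_mono fun b hb => ?_) hmem)
    have hb' : b ∈ B := hb
    exact ⟨basisIndices_subset v S (h (Finset.mem_insert_of_mem hb')), hB b hb'⟩

/-- A vector differs from its Gram-Schmidt vector by a combination of earlier, orthogonal ones. -/
theorem gramHeight_eq_norm (v : ℕ → V) (B : Finset ℕ) (b : B) :
    gramHeight v B b = ‖gramSchmidt ℝ (fun b : B => v b) b‖ := by
  set f : B → V := fun b => v b with hf
  have h1 : inner ℝ (gramSchmidt ℝ f b) (f b) = ‖gramSchmidt ℝ f b‖ ^ 2 := by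
    rw [gramSchmidt_def'' ℝ f b, inner_add_right, real_inner_self_eq_norm_sq, inner_sum,
      Finset.sum_eq_zero, add_zero]
    intro i hi
    rw [inner_smul_right, gramSchmidt_orthogonal ℝ f (Finset.mem_Iio.mp hi).ne', mul_zero]
  have h2 : gramHeight v B b = ‖gramSchmidt ℝ f b‖⁻¹ * inner ℝ (gramSchmidt ℝ f b) (f b) := by
    rw [gramHeight, gramSchmidtNormed, inner_smul_left]; rfl
  rw [h2, h1]
  by_cases h0 : ‖gramSchmidt ℝ f b‖ = 0
  · simp [h0]
  · field_simp

theorem gramHeight_pos {v : ℕ → V} {B : Finset ℕ} (hB : LinearIndepOn ℝ v (B : Set ℕ)) (b : B) :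
    0 < gramHeight v B b := by
  rw [gramHeight_eq_norm]
  exact norm_pos_iff.mpr (gramSchmidt_ne_zero (f := fun b : B => v b) b hB)

theorem gramHeight_eq_norm_of_min (v : ℕ → V) (B : Finset ℕ) (b : B) (hb : ∀ b' ∈ B, (b : ℕ) ≤ b') :
    gramHeight v B b = ‖v b‖ := by
  rw [gramHeight_eq_norm, gramSchmidt_def, Finset.sum_eq_zero, sub_zero]
  intro i hi
  have := hb i i.2
  have h2 : i < b := Finset.mem_Iio.mp hi
  rw [← Subtype.coe_lt_coe] at h2
  omega

/-- If the inner products of the vectors are integers, then the product of the heights is at least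
one. -/
theorem one_le_prod_gramHeight_sq {v : ℕ → V} {B : Finset ℕ} (hB : LinearIndepOn ℝ v (B : Set ℕ))
    (hint : ∀ i ∈ B, ∀ j ∈ B, ∃ a : ℤ, inner ℝ (v i) (v j) = (a : ℝ)) :
    1 ≤ (∏ b, gramHeight v B b) ^ 2 := by
  set f : B → V := fun b => v b with hf
  set e := gramSchmidtNormed ℝ f with he
  have hon : Orthonormal ℝ e := gramSchmidtNormed_orthonormal hB
  have hexp : ∀ b, f b = ∑ k, inner ℝ (e k) (f b) • e k := by
    intro b
    have hmem : f b ∈ Submodule.span ℝ (Set.range e) := by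
      rw [he, span_gramSchmidtNormed_range, span_gramSchmidt]
      exact Submodule.subset_span ⟨b, rfl⟩
    obtain ⟨c, hc⟩ := (Submodule.mem_span_range_iff_exists_fun ℝ).mp hmem
    rw [← hc]
    refine Finset.sum_congr rfl fun k _ => ?_
    rw [hon.inner_right_fintype]
  choose a ha using fun (i j : B) => hint i i.2 j j.2
  set T : Matrix B B ℝ := Matrix.of fun k l => inner ℝ (e k) (f l) with hT
  -- The Gram matrix has integer entries and determinant $(\det T)^2$, so this squared product is a
  -- positive integer.
  have hgram : T.transpose * T = (Matrix.of a).map (Int.cast : ℤ → ℝ) := by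
    ext i j
    rw [Matrix.mul_apply, Matrix.map_apply, Matrix.of_apply, ← ha i j]
    change _ = inner ℝ (f i) (f j)
    conv_rhs => rw [hexp i, sum_inner]
    refine Finset.sum_congr rfl fun k _ => ?_
    rw [inner_smul_left]
    rfl
  have hdet : (∏ b, gramHeight v B b) ^ 2 = (((Matrix.of a).det : ℤ) : ℝ) := by
    rw [← det_coord_gramSchmidt, sq]
    have : T.det * T.det = (T.transpose * T).det := by rw [Matrix.det_mul, Matrix.det_transpose]
    change T.det * T.det = _
    rw [this, hgram]
    exact (Int.cast_det _).symm
  have hpos : 0 < (∏ b, gramHeight v B b) ^ 2 :=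
    pow_pos (Finset.prod_pos fun b _ => gramHeight_pos hB b) 2
  rw [hdet] at hpos ⊢
  have : 0 < (Matrix.of a).det := by exact_mod_cast hpos
  exact_mod_cast this

end Basis

/-! ### Lifts at a free height -/

section Lift

variable {d : ℕ} {z : ℕ → EuclideanSpace ℝ (Fin d)} {s : ℝ}

/-- The point `z i - z 1` in the affine hyperplane at height `s`. -/
noncomputable def liftAt (z : ℕ → EuclideanSpace ℝ (Fin d)) (s : ℝ) (i : ℕ) :
    WithLp 2 (ℝ × EuclideanSpace ℝ (Fin d)) :=
  WithLp.toLp 2 (s, z i - z 1)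

theorem inner_liftAt (x : WithLp 2 (ℝ × EuclideanSpace ℝ (Fin d))) (i : ℕ) :
    inner ℝ x (liftAt z s i) = x.fst * s + inner ℝ x.snd (z i - z 1) := by
  rw [WithLp.prod_inner_apply]
  simp [liftAt, mul_comm]

theorem norm_liftAt_sq (i : ℕ) : ‖liftAt z s i‖ ^ 2 = s ^ 2 + ‖z i - z 1‖ ^ 2 := by
  rw [WithLp.prod_norm_sq_eq_of_L2]
  simp [liftAt]

/-- The selection rule concerns affine combinations only, so the height `s` of the lift used in the
analysis need not be the one used by the program. It is taken to be the circumradius or $1$ below.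
-/
theorem sum_smul_liftAt (hs : s ≠ 0) (T : Finset ℕ) (c : ℕ → ℝ) (i : ℕ) :
    ∑ j ∈ T, c j • liftAt z s j = liftAt z s i ↔
      ∑ j ∈ T, c j = 1 ∧ ∑ j ∈ T, c j • z j = z i := by
  have h1 : (∑ j ∈ T, c j • liftAt z s j).fst = (∑ j ∈ T, c j) * s := by
    change WithLp.fstₗ 2 ℝ ℝ _ (∑ j ∈ T, c j • liftAt z s j) = _
    rw [map_sum, Finset.sum_mul]
    rfl
  have h2 : (∑ j ∈ T, c j • liftAt z s j).snd = ∑ j ∈ T, c j • z j - (∑ j ∈ T, c j) • z 1 := by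
    change WithLp.sndₗ 2 ℝ ℝ _ (∑ j ∈ T, c j • liftAt z s j) = _
    rw [map_sum, Finset.sum_smul, ← Finset.sum_sub_distrib]
    refine Finset.sum_congr rfl fun j _ => ?_
    rw [← smul_sub]
    rfl
  constructor
  · intro h
    rw [h] at h1 h2
    have h3 : ∑ j ∈ T, c j = 1 := by
      have : s = (∑ j ∈ T, c j) * s := h1
      exact mul_right_cancel₀ hs (by rw [one_mul]; exact this.symm)
    refine ⟨h3, ?_⟩
    rw [h3, one_smul] at h2
    have : z i - z 1 = ∑ j ∈ T, c j • z j - z 1 := h2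
    exact (sub_left_injective this).symm
  · rintro ⟨h3, h4⟩
    rw [h3, one_mul] at h1
    rw [h3, one_smul, h4] at h2
    apply (WithLp.ofLp_injective 2)
    exact Prod.ext h1 h2

end Lift

/-! ### The basis of a selection and its normals -/

namespace IsSelection
open InnerProductSpace

variable {d : ℕ} {z : ℕ → EuclideanSpace ℝ (Fin d)} {t : ℕ} {S : Finset ℕ} {s : ℝ}

theorem mem_span (h : IsSelection z t S) (hs : s ≠ 0) {i : ℕ} (hi : i ∈ Finset.Icc 1 t) :
    liftAt z s i ∈
      Submodule.span ℝ (liftAt z s '' {b | b ∈ basisIndices (liftAt z s) S ∧ b ≤ i}) := by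
  obtain ⟨c, h1, h2, -⟩ := h.cover i hi
  rw [← (sum_smul_liftAt hs _ c i).mpr ⟨h1, h2⟩]
  refine sum_mem fun j hj => Submodule.smul_mem _ _ ?_
  obtain ⟨hj, hji⟩ := Finset.mem_filter.mp hj
  refine Submodule.span_mono (Set.image_mono ?_) (mem_span_basisIndices hj)
  exact fun b hb => ⟨hb.1, hb.2.trans hji⟩

theorem one_le_of_mem (h : IsSelection z t S) {i : ℕ} (hi : i ∈ S) : 1 ≤ i :=
  (Finset.mem_Icc.mp (h.subset hi)).1

theorem one_mem (h : IsSelection z t S) (ht : 1 ≤ t) : 1 ∈ S := by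
  obtain ⟨c, h1, -⟩ := h.cover 1 (by simp [ht])
  by_contra hn
  rw [Finset.sum_eq_zero] at h1
  · simp at h1
  · intro j hj
    obtain ⟨hj, hj1⟩ := Finset.mem_filter.mp hj
    have := h.one_le_of_mem hj
    obtain rfl : j = 1 := by omega
    exact absurd hj hn

theorem one_mem_basis (h : IsSelection z t S) (ht : 1 ≤ t) (hs : s ≠ 0) :
    1 ∈ basisIndices (liftAt z s) S := by
  refine mem_basisIndices.mpr ⟨h.one_mem ht, ?_⟩
  have : {j | j ∈ S ∧ j < 1} = ∅ := by
    ext j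
    simp only [Set.mem_ofPred_eq, Set.mem_empty_iff_false, iff_false, not_and]
    intro hj
    have := h.one_le_of_mem hj
    omega
  rw [this, Set.image_empty, Submodule.span_empty, Submodule.mem_bot]
  intro h0
  have := norm_liftAt_sq (z := z) (s := s) 1
  rw [h0] at this
  simp at this
  exact hs (pow_eq_zero_iff two_ne_zero |>.mp this.symm)

/-- The basic points are affinely independent, because their lifts are linearly independent, and
they have the same affine span as all points seen. -/
theorem card_basis (h : IsSelection z t S) (ht : 1 ≤ t) (hs : s ≠ 0) :
    (basisIndices (liftAt z s) S).card = dimAt z t + 1 := by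
  set B := basisIndices (liftAt z s) S with hB
  have hLI : LinearIndepOn ℝ (liftAt z s) (B : Set ℕ) := linearIndepOn_basisIndices _ _
  have haff : AffineIndependent ℝ (fun b : B => z b) := by
    rw [affineIndependent_iff_of_fintype]
    intro w hw0 hw1
    rw [Finset.univ.weightedVSub_eq_linear_combination hw0] at hw1
    have hLI' : LinearIndependent ℝ (fun b : B => liftAt z s b) := hLI
    refine Fintype.linearIndependent_iff.mp hLI' w ?_
    apply (WithLp.ofLp_injective 2)
    refine Prod.ext ?_ ?_
    · change WithLp.fstₗ 2 ℝ ℝ _ (∑ j, w j • liftAt z s j) = 0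
      rw [map_sum]
      change ∑ j, w j * s = 0
      rw [← Finset.sum_mul, hw0, zero_mul]
    · change WithLp.sndₗ 2 ℝ ℝ _ (∑ j, w j • liftAt z s j) = 0
      rw [map_sum]
      change ∑ j, w j • (z j - z 1) = 0
      simp only [smul_sub, Finset.sum_sub_distrib, ← Finset.sum_smul, hw0, hw1, zero_smul, sub_zero]
  have h1 : 1 ∈ B := h.one_mem_basis ht hs
  have hspan : affineSpan ℝ (z '' (Finset.Icc 1 t : Set ℕ)) =
      affineSpan ℝ (Set.range fun b : B => z b) := by
    apply le_antisymm
    · rw [affineSpan_le]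
      rintro _ ⟨i, hi, rfl⟩
      have hmem : liftAt z s i ∈ Submodule.span ℝ (Set.range fun b : B => liftAt z s b) := by
        refine Submodule.span_mono ?_ (h.mem_span hs (Finset.mem_coe.mp hi))
        rintro _ ⟨b, ⟨hb, -⟩, rfl⟩
        exact ⟨⟨b, hb⟩, rfl⟩
      obtain ⟨c, hc⟩ := (Submodule.mem_span_range_iff_exists_fun ℝ).mp hmem
      set c' : ℕ → ℝ := fun j => if hj : j ∈ B then c ⟨j, hj⟩ else 0 with hc'
      have hcc : ∀ b : B, c' b = c b := fun b => by simp [hc']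
      have hsum : ∑ j ∈ B, c' j • liftAt z s j = liftAt z s i := by
        rw [← Finset.sum_coe_sort, ← hc]
        exact Finset.sum_congr rfl fun b _ => by rw [hcc]
      obtain ⟨g1, g2⟩ := (sum_smul_liftAt hs B c' i).mp hsum
      rw [← Finset.sum_coe_sort] at g1 g2
      simp only [hcc] at g1 g2
      rw [← g2, ← Finset.affineCombination_eq_linear_combination _ _ _ g1]
      exact affineCombination_mem_affineSpan g1 _
    · refine affineSpan_mono ℝ ?_
      rintro _ ⟨b, rfl⟩
      exact ⟨b, h.subset (basisIndices_subset _ _ b.2), rfl⟩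
  have hcard : Fintype.card B = B.card - 1 + 1 := by
    rw [Fintype.card_coe]
    have := Finset.card_pos.mpr ⟨1, h1⟩
    omega
  have := haff.finrank_vectorSpan hcard
  rw [Fintype.card_coe] at hcard
  rw [dimAt, hspan, direction_affineSpan, this, hcard]
  rfl

/-- The Gram-Schmidt vector of a basis index other than `1` has the form `(0, u)`, with `u` a unit
vector normal to the affine span of the previous points. -/
theorem exists_normal (h : IsSelection z t S) (ht : 1 ≤ t) (hs : s ≠ 0)
    {B : Finset ℕ} (hB : B = basisIndices (liftAt z s) S) :
    ∃ u : B → EuclideanSpace ℝ (Fin d), ∀ b : B, (b : ℕ) ≠ 1 →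
      ‖u b‖ = 1 ∧
      u b ∈ Submodule.span ℝ ((fun j => z j - z 1) '' (Finset.Icc 1 (b : ℕ) : Set ℕ)) ∧
      (∀ j ∈ Finset.Icc 1 (b : ℕ), j ≠ b → inner ℝ (u b) (z j - z 1) = 0) ∧
      inner ℝ (u b) (z b - z 1) = gramHeight (liftAt z s) B b ∧
      ∀ b' : B, (b' : ℕ) ≠ 1 → b' ≠ b → inner ℝ (u b') (u b) = 0 := by
  have hLI : LinearIndepOn ℝ (liftAt z s) (B : Set ℕ) := hB ▸ linearIndepOn_basisIndices _ _
  set f : B → WithLp 2 (ℝ × EuclideanSpace ℝ (Fin d)) := fun b => liftAt z s b with hf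
  set e := gramSchmidtNormed ℝ f with he
  have hon : Orthonormal ℝ e := gramSchmidtNormed_orthonormal hLI
  have h1 : 1 ∈ B := hB ▸ h.one_mem_basis ht hs
  have hB1 : ∀ b ∈ B, 1 ≤ b ∧ b ≤ t := fun b hb => by
    have := h.subset (basisIndices_subset _ _ (hB ▸ hb))
    exact Finset.mem_Icc.mp this
  have hlt : ∀ b : B, (b : ℕ) ≠ 1 → (⟨1, h1⟩ : B) < b := fun b hb => by
    have := hB1 b b.2
    exact Subtype.mk_lt_mk.mpr (by omega)
  -- The first lift is $(s,0)$, and all later Gram-Schmidt vectors are orthogonal to it.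
  have hfst : ∀ b : B, (b : ℕ) ≠ 1 → (e b).fst = 0 := by
    intro b hb
    have := inner_gramSchmidtNormed_eq_zero (liftAt z s) B (hlt b hb)
    rw [inner_liftAt] at this
    simpa [hs] using this
  have hinner : ∀ b : B, (b : ℕ) ≠ 1 → ∀ j, inner ℝ (e b) (liftAt z s j) =
      inner ℝ (e b).snd (z j - z 1) := fun b hb j => by
    rw [inner_liftAt, hfst b hb, zero_mul, zero_add]
  refine ⟨fun b => (e b).snd, fun b hb => ⟨?_, ?_, ?_, ?_, ?_⟩⟩
  · have := hon.1 b
    have h2 := WithLp.prod_norm_sq_eq_of_L2 (e b)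
    rw [this, hfst b hb] at h2
    simp only [norm_zero] at h2
    nlinarith [norm_nonneg (e b).snd]
  · have hmem : e b ∈ Submodule.span ℝ (f '' Set.Iic b) := by
      rw [← span_gramSchmidt_Iic, ← span_gramSchmidtNormed]
      exact Submodule.subset_span ⟨b, Set.self_mem_Iic, rfl⟩
    have := Submodule.mem_map_of_mem (f := (WithLp.sndₗ 2 ℝ ℝ (EuclideanSpace ℝ (Fin d)))) hmem
    rw [Submodule.map_span] at this
    refine Submodule.span_mono ?_ this
    rintro _ ⟨_, ⟨b', hb', rfl⟩, rfl⟩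
    exact ⟨b', Finset.mem_coe.mpr (Finset.mem_Icc.mpr ⟨(hB1 b' b'.2).1, hb'⟩), rfl⟩
  · intro j hj hjb
    obtain ⟨hj1, hj2⟩ := Finset.mem_Icc.mp hj
    rw [← hinner b hb]
    have hmem := h.mem_span hs (Finset.mem_Icc.mpr ⟨hj1, hj2.trans (hB1 b b.2).2⟩)
    rw [← hB] at hmem
    generalize liftAt z s j = x at hmem ⊢
    induction hmem using Submodule.span_induction with
    | mem x hx =>
      obtain ⟨b', ⟨hb', hb'j⟩, rfl⟩ := hx
      exact inner_gramSchmidtNormed_eq_zero (liftAt z s) B (b' := ⟨b', hb'⟩)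
        (Subtype.mk_lt_mk.mpr (by omega))
    | zero => simp
    | add x y _ _ hx hy => rw [inner_add_right, hx, hy, add_zero]
    | smul r x _ hx => rw [inner_smul_right, hx, mul_zero]
  · rw [← hinner b hb]
    rfl
  · intro b' hb' hne
    have : inner ℝ (e b') (e b) = 0 := hon.2 hne
    rw [WithLp.prod_inner_apply] at this
    change inner ℝ (e b').fst (e b).fst + inner ℝ (e b').snd (e b).snd = 0 at this
    rw [hfst b hb] at this
    simpa using this

end IsSelection

/-- With $x=m/D$, logarithms give $(x-1)\log2\le\log(x/4)+2\log\kappa+\log20$. The bound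
$\log(x/4)\le x/4-1$ makes the right side linear in $x$ with slope $\frac14<\log2$, so $x$ can be
isolated. -/
theorem card_le_of_two_pow_le {m D : ℕ} {κ : ℝ} (hD : 1 ≤ D) (hDm : D ≤ m) (hκ : 1 ≤ κ)
    (h : (2 : ℝ) ^ (m - D) ≤ (5 * m * κ ^ 2 / D) ^ D) :
    (m : ℝ) ≤ 8 * (D * (1 + Real.log κ)) := by
  have hD0 : (0 : ℝ) < D := by exact_mod_cast hD
  have hm0 : (0 : ℝ) < m := by exact_mod_cast (hD.trans hDm)
  have hκ0 : 0 < κ := by linarith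
  have hlog := Real.log_le_log (by positivity) h
  rw [Real.log_pow, Real.log_pow, Nat.cast_sub hDm] at hlog
  set x : ℝ := m / D with hx
  have hx0 : 0 < x := by positivity
  have hm : (m : ℝ) = D * x := by rw [hx]; field_simp
  have e : 5 * (m : ℝ) * κ ^ 2 / D = (x / 4) * κ ^ 2 * 20 := by rw [hx]; field_simp; ring
  rw [e, Real.log_mul (by positivity) (by norm_num), Real.log_mul (by positivity) (by positivity),
    Real.log_pow] at hlog
  have h1 : Real.log (x / 4) ≤ x / 4 - 1 := Real.log_le_sub_one_of_pos (by positivity)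
  have h2 : Real.log 20 ≤ 3.5 := by
    have : Real.log 20 ≤ Real.log (2 ^ 5) := Real.log_le_log (by norm_num) (by norm_num)
    rw [Real.log_pow] at this
    have := Real.log_two_lt_d9
    push_cast at *
    linarith
  have h3 := Real.log_two_gt_d9
  have h4 := Real.log_two_lt_d9
  have hL : 0 ≤ Real.log κ := Real.log_nonneg hκ
  rw [hm] at hlog
  have h5 : (x - 1) * Real.log 2 ≤ Real.log (x / 4) + (2 : ℕ) * Real.log κ + Real.log 20 := by
    refine le_of_mul_le_mul_left ?_ hD0
    linarith
  have h6 : x ≤ 8 * (1 + Real.log κ) := by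
    push_cast at h5
    nlinarith [mul_nonneg hx0.le (sub_nonneg.mpr h3.le)]
  rw [hm]
  nlinarith

/-! ### Size bounds and the covering property -/

namespace IsSelection

variable {d : ℕ} {z : ℕ → EuclideanSpace ℝ (Fin d)} {t : ℕ} {S : Finset ℕ} {s : ℝ}

/-- The size of a selection in terms of the product of the heights of a basis. -/
theorem card_le (h : IsSelection z t S) (ht : 1 ≤ t) (hs : s ≠ 0) {q κ : ℝ} (hq : 0 < q)
    (hκ : 1 ≤ κ) (hnorm : ∀ i ∈ S, ‖liftAt z s i‖ ^ 2 ≤ 5 * q)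
    (hprod : (q / κ ^ 2) ^ (dimAt z t + 1) ≤
      (∏ b, gramHeight (liftAt z s) (basisIndices (liftAt z s) S) b) ^ 2) :
    (S.card : ℝ) ≤ 8 * (((dimAt z t : ℝ) + 1) * (1 + Real.log κ)) := by
  set B := basisIndices (liftAt z s) S with hB
  have hLI : LinearIndepOn ℝ (liftAt z s) (B : Set ℕ) := linearIndepOn_basisIndices _ _
  have hcard : B.card = dimAt z t + 1 := h.card_basis ht hs
  have hBS : B ⊆ S := basisIndices_subset _ _
  have hκ0 : 0 < κ := by linarith
  have hcount := two_pow_mul_prod_gramHeight_le hBS hLI (fun b => (gramHeight_pos hLI b).ne')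
    (fun i hi => h.mem_span hs (h.subset hi))
    (fun i hi c hc => by
      obtain ⟨h1, h2⟩ := (sum_smul_liftAt hs _ c i).mp hc
      exact h.select i hi c h1 h2)
  rw [← hcard] at hprod
  have hD : (0 : ℝ) < B.card := by rw [hcard]; positivity
  have hsum : ∑ i ∈ S, ‖liftAt z s i‖ ^ 2 ≤ S.card * (5 * q) := by
    simpa using Finset.sum_le_card_nsmul S _ _ hnorm
  have h1 : (2 : ℝ) ^ (S.card - B.card) * (q / κ ^ 2) ^ B.card ≤
      (S.card * (5 * q) / B.card) ^ B.card := by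
    refine (mul_le_mul_of_nonneg_left hprod (by positivity)).trans (hcount.trans ?_)
    refine pow_le_pow_left₀ (div_nonneg (Finset.sum_nonneg fun i _ => sq_nonneg _) hD.le) ?_ _
    exact div_le_div_of_nonneg_right hsum hD.le
  have h2 : (2 : ℝ) ^ (S.card - B.card) ≤ (5 * S.card * κ ^ 2 / B.card) ^ B.card := by
    have hpos : 0 < (q / κ ^ 2) ^ B.card := by positivity
    refine le_of_mul_le_mul_right (h1.trans (le_of_eq ?_)) hpos
    rw [← mul_pow]
    congr 1
    field_simp
  have h3 := card_le_of_two_pow_le (by omega) (Finset.card_le_card hBS) hκ h2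
  rw [hcard] at h3
  push_cast at h3
  exact h3

/-- Lifting at height $1$ keeps the Gram entries integral, so the product of the squared heights is
at least $1\ge(q/\kappa^2)^D$. Here `κ` is any number with $q\le\kappa^2$, not an aspect ratio. -/
theorem card_le_of_int (h : IsSelection z t S) (ht : 1 ≤ t) {q κ : ℝ} (hq : 0 < q)
    (hκ : 1 ≤ κ) (hqκ : q ≤ κ ^ 2) (hnorm : ∀ i ∈ S, 1 + ‖z i - z 1‖ ^ 2 ≤ 5 * q)
    (hint : ∀ i ∈ S, ∀ j ∈ S, ∃ a : ℤ, inner ℝ (z i - z 1) (z j - z 1) = (a : ℝ)) :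
    (S.card : ℝ) ≤ 8 * (((dimAt z t : ℝ) + 1) * (1 + Real.log κ)) := by
  refine h.card_le ht one_ne_zero hq hκ (fun i hi => ?_) ?_
  · rw [norm_liftAt_sq, one_pow]
    exact hnorm i hi
  · have hκ0 : 0 < κ := by linarith
    refine (pow_le_one₀ (by positivity) ((div_le_one (by positivity)).mpr hqκ)).trans
      (one_le_prod_gramHeight_sq (linearIndepOn_basisIndices _ _) fun i hi j hj => ?_)
    obtain ⟨a, ha⟩ := hint i (basisIndices_subset _ _ hi) j (basisIndices_subset _ _ hj)
    refine ⟨1 + a, ?_⟩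
    rw [inner_liftAt]
    simp [liftAt, ha]

theorem card_le_of_dimAt_eq_zero (h : IsSelection z t S) (ht : 1 ≤ t) (hd : dimAt z t = 0) :
    (S.card : ℝ) ≤ 8 := by
  have hz : ∀ i ∈ S, z i = z 1 := by
    intro i hi
    by_contra hne
    have := one_le_dimAt (h.subset hi) (by simp [ht]) hne
    omega
  have := h.card_le_of_int ht (q := 1) (κ := 1) one_pos le_rfl (by norm_num)
    (fun i hi => by simp [hz i hi]) (fun i hi j _ => ⟨0, by simp [hz i hi]⟩)
  simpa [hd] using this

theorem card_le_of_int_coords (h : IsSelection z t S) (ht : 1 ≤ t) {N : ℕ} (hN : 2 ≤ d * N)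
    (hz : ∀ i ∈ Finset.Icc 1 t, ∀ j : Fin d, ∃ a : ℤ, |a| ≤ (N : ℤ) ∧ z i j = (a : ℝ)) :
    (S.card : ℝ) ≤ 8 * (((dimAt z t : ℝ) + 1) * (1 + Real.log ((d : ℝ) * N))) := by
  have hd1 : 1 ≤ d := Nat.pos_of_ne_zero (by rintro rfl; simp at hN)
  have hN1 : 1 ≤ N := Nat.pos_of_ne_zero (by rintro rfl; simp at hN)
  have hd1' : (1 : ℝ) ≤ d := by exact_mod_cast hd1
  have hN1' : (1 : ℝ) ≤ N := by exact_mod_cast hN1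
  have h1t : (1 : ℕ) ∈ Finset.Icc 1 t := by simp [ht]
  -- Differences of coordinates are at most $2N$, so squared norms of the lifts are at most
  -- $1+4dN^2\le5dN^2$; and $dN^2\le(dN)^2$.
  refine h.card_le_of_int ht (q := d * N ^ 2) (by positivity) (by nlinarith) ?_ ?_ ?_
  · rw [mul_pow]
    exact mul_le_mul_of_nonneg_right (by nlinarith) (by positivity)
  · intro i hi
    have hb : ∀ j : Fin d, ‖(z i - z 1) j‖ ^ 2 ≤ 4 * (N : ℝ) ^ 2 := by
      intro j
      obtain ⟨a, ha, hza⟩ := hz i (h.subset hi) j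
      obtain ⟨b, hb, hzb⟩ := hz 1 h1t j
      have ha' : |(a : ℝ)| ≤ N := by exact_mod_cast ha
      have hb' : |(b : ℝ)| ≤ N := by exact_mod_cast hb
      rw [PiLp.sub_apply, hza, hzb, Real.norm_eq_abs, sq_abs]
      obtain ⟨a1, a2⟩ := abs_le.mp ha'
      obtain ⟨b1, b2⟩ := abs_le.mp hb'
      nlinarith
    have : ‖z i - z 1‖ ^ 2 ≤ d * (4 * (N : ℝ) ^ 2) := by
      rw [EuclideanSpace.norm_sq_eq]
      simpa using Finset.sum_le_card_nsmul Finset.univ _ _ fun j _ => hb j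
    have : (1 : ℝ) ≤ d * (N : ℝ) ^ 2 := by nlinarith
    linarith
  · intro i hi j hj
    choose a _ ha using hz i (h.subset hi)
    choose b _ hb using hz j (h.subset hj)
    choose c _ hc using hz 1 h1t
    refine ⟨∑ k, (a k - c k) * (b k - c k), ?_⟩
    rw [PiLp.inner_apply]
    push_cast
    refine Finset.sum_congr rfl fun k _ => ?_
    simp [ha, hb, hc, mul_comm]

/-- Heights are bounded from below in terms of the aspect ratio. -/
theorem aspect_facts (h : IsSelection z t S) (ht : 1 ≤ t) (hdim : 1 ≤ dimAt z t) :
    0 < circumradius (hullOf z (Finset.Icc 1 t)) ∧ 1 ≤ maxAspect z t ∧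
      (2 ≤ dimAt z t → 5 / 4 ≤ maxAspect z t) ∧
      ∀ s : ℝ, s ≠ 0 → ∀ b : basisIndices (liftAt z s) S, (b : ℕ) ≠ 1 →
        2 * circumradius (hullOf z (Finset.Icc 1 t)) ≤
          maxAspect z t * gramHeight (liftAt z s) (basisIndices (liftAt z s) S) b := by
  set R := circumradius (hullOf z (Finset.Icc 1 t)) with hR
  set κ := maxAspect z t with hκ
  have h1t : (1 : ℕ) ∈ Finset.Icc 1 t := by simp [ht]
  have key : ∀ s : ℝ, s ≠ 0 → ∀ b : basisIndices (liftAt z s) S, (b : ℕ) ≠ 1 →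
      0 < R ∧ 1 ≤ κ ∧
        2 * R ≤ κ * gramHeight (liftAt z s) (basisIndices (liftAt z s) S) b := by
    intro s hs b hb
    obtain ⟨u, hu⟩ := h.exists_normal ht hs rfl
    obtain ⟨u1, u2, u3, u4, -⟩ := hu b hb
    have hpos := gramHeight_pos (linearIndepOn_basisIndices (liftAt z s) S) b
    set g := gramHeight (liftAt z s) (basisIndices (liftAt z s) S) b
    have hbt := h.subset (basisIndices_subset _ _ b.2)
    have hb1 : 1 ≤ (b : ℕ) := (Finset.mem_Icc.mp hbt).1
    obtain ⟨r1, r2⟩ := inradius_pos_le hb1 hpos.le u1 u2 u3 u4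
    set r := inradius (hullOf z (Finset.Icc 1 (b : ℕ)))
    have hg : g ≤ 2 * R := by
      rw [← u4]
      refine (real_inner_le_norm _ _).trans ?_
      rw [u1, one_mul]
      exact norm_sub_le_circumradius hbt h1t
    have hne : z b ≠ z 1 := fun he => by
      rw [he, sub_self, inner_zero_right] at u4
      exact hpos.ne u4
    have hdb : 1 ≤ dimAt z b := one_le_dimAt (i := b) (j := 1) (by simp [hb1]) (by simp [hb1]) hne
    have hratio : R / r ≤ κ := ratio_le_maxAspect hbt hdb
    have hRr : R ≤ κ * r := (div_le_iff₀ r1).mp hratio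
    have hR0 : 0 < R := by linarith
    have hκ1 : 1 ≤ κ := le_trans ((one_le_div r1).mpr (by linarith)) hratio
    exact ⟨hR0, hκ1, by nlinarith⟩
  have hcard := h.card_basis ht (one_ne_zero (α := ℝ))
  have h1B := h.one_mem_basis ht (one_ne_zero (α := ℝ))
  obtain ⟨b, hb, hb1⟩ : ∃ b ∈ basisIndices (liftAt z 1) S, b ≠ 1 :=
    Finset.exists_mem_ne (by omega) 1
  obtain ⟨hR0, hκ1, -⟩ := key 1 one_ne_zero ⟨b, hb⟩ hb1
  refine ⟨hR0, hκ1, fun h2 => ?_, fun s hs b hb => (key s hs b hb).2.2⟩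
  obtain ⟨b₁, hb₁, b₂, hb₂, hlt⟩ : ∃ b₁ ∈ (basisIndices (liftAt z 1) S).erase 1,
      ∃ b₂ ∈ (basisIndices (liftAt z 1) S).erase 1, b₁ < b₂ := by
    have : 1 < ((basisIndices (liftAt z 1) S).erase 1).card := by
      rw [Finset.card_erase_of_mem h1B]
      omega
    obtain ⟨x, hx, y, hy, hxy⟩ := Finset.one_lt_card.mp this
    rcases lt_or_gt_of_ne hxy with hlt | hlt
    · exact ⟨x, hx, y, hy, hlt⟩
    · exact ⟨y, hy, x, hx, hlt⟩
  obtain ⟨hb₁1, hb₁B⟩ := Finset.mem_erase.mp hb₁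
  obtain ⟨hb₂1, hb₂B⟩ := Finset.mem_erase.mp hb₂
  have k1 := (key 1 one_ne_zero ⟨b₁, hb₁B⟩ hb₁1).2.2
  have k2 := (key 1 one_ne_zero ⟨b₂, hb₂B⟩ hb₂1).2.2
  obtain ⟨u, hu⟩ := h.exists_normal ht (one_ne_zero (α := ℝ)) rfl
  obtain ⟨p1, -, -, p4, -⟩ := hu ⟨b₁, hb₁B⟩ hb₁1
  obtain ⟨q1, -, q3, q4, q5⟩ := hu ⟨b₂, hb₂B⟩ hb₂1
  have hb₁t := h.subset (basisIndices_subset _ _ hb₁B)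
  have hb₂t := h.subset (basisIndices_subset _ _ hb₂B)
  have hκ0 : 0 < κ := by linarith
  rw [← p4] at k1
  rw [← q4] at k2
  -- Both heights are at least $2R/\kappa$, so $\frac58\cdot2R/\kappa\le R$, that is,
  -- $\kappa\ge\frac54$.
  have := height_le_circumradius (θ := 2 * R / κ) h1t hb₁t hb₂t p1 q1
    (q5 ⟨b₁, hb₁B⟩ hb₁1 (by simpa using hlt.ne))
    ((div_le_iff₀' hκ0).mpr k1)
    (q3 b₁ (Finset.mem_Icc.mpr ⟨(Finset.mem_Icc.mp hb₁t).1, hlt.le⟩) hlt.ne)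
    ((div_le_iff₀' hκ0).mpr k2)
  rw [← hR, ← mul_div_assoc, div_le_iff₀ hκ0] at this
  nlinarith

/-- Lifting at height $R$ balances the two sides: squared norms are at most $R^2+(2R)^2=5R^2$, the
first height is $R$, and the others are at least $2R/\kappa$, so all are at least $R/\kappa$. -/
theorem card_le_of_maxAspect (h : IsSelection z t S) (ht : 1 ≤ t) (hdim : 1 ≤ dimAt z t) :
    (S.card : ℝ) ≤ 8 * (((dimAt z t : ℝ) + 1) * (1 + Real.log (maxAspect z t))) := by
  obtain ⟨hR, hκ, -, hheight⟩ := h.aspect_facts ht hdim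
  set R := circumradius (hullOf z (Finset.Icc 1 t)) with hRdef
  set κ := maxAspect z t with hκdef
  have hκ0 : 0 < κ := by linarith
  have h1t : (1 : ℕ) ∈ Finset.Icc 1 t := by simp [ht]
  refine h.card_le ht hR.ne' (q := R ^ 2) (by positivity) hκ (fun i hi => ?_) ?_
  · rw [norm_liftAt_sq]
    have := norm_sub_le_circumradius (z := z) (h.subset hi) h1t
    rw [← hRdef] at this
    nlinarith [norm_nonneg (z i - z 1)]
  · rw [← div_pow, ← pow_mul, mul_comm, pow_mul]
    refine pow_le_pow_left₀ (by positivity) ?_ 2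
    rw [← h.card_basis ht hR.ne', ← Fintype.card_coe, ← Finset.card_univ, ← Finset.prod_const]
    refine Finset.prod_le_prod (fun _ _ => by positivity) fun b _ => ?_
    rw [div_le_iff₀' hκ0]
    by_cases hb : (b : ℕ) = 1
    · have hmin : gramHeight (liftAt z R) (basisIndices (liftAt z R) S) b = R := by
        rw [gramHeight_eq_norm_of_min _ _ _ fun b' hb' => by
          rw [hb]; exact h.one_le_of_mem (basisIndices_subset _ _ hb')]
        have := norm_liftAt_sq (z := z) (s := R) b
        rw [hb, sub_self, norm_zero] at this
        rw [hb]
        exact (pow_left_inj₀ (norm_nonneg _) hR.le two_ne_zero).mp (by rw [this]; ring)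
      rw [hmin]
      nlinarith
    · have := hheight R hR.ne' b hb
      linarith

theorem hullOf_subset (h : IsSelection z t S) {c : EuclideanSpace ℝ (Fin d)}
    (hc : (S.card : ℝ) • c = ∑ i ∈ S, z i) {α : ℝ} (hα : α = 1 / (S.card + 1)) :
    hullOf z (Finset.Icc 1 t) ⊆ (fun x => c + (1 / α) • (x - c)) '' hullOf z S := by
  have hα0 : 0 < α := by rw [hα]; positivity
  have hα1 : α * (S.card + 1) = 1 := by rw [hα]; field_simp
  have hmem : hullOf z (Finset.Icc 1 t) ⊆ {x | c + α • (x - c) ∈ hullOf z S} := by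
    refine convexHull_min ?_ ?_
    · rintro _ ⟨i, hi, rfl⟩
      obtain ⟨w, h1, h2, h3⟩ := h.cover i (Finset.mem_coe.mp hi)
      rw [Finset.sum_filter] at h1 h2 h3
      -- Extension by zero to all of `S`: points selected after `i` get weight $0$, which still
      -- satisfies $w'\ge-1$.
      set w' : ℕ → ℝ := fun j => if j ≤ i then w j else 0 with hw'
      have h2' : ∑ j ∈ S, w' j • z j = z i := by
        rw [← h2]
        exact Finset.sum_congr rfl fun j _ => by simp only [hw']; split_ifs <;> simp
      have h3' : ∑ j ∈ S, w' j ^ 2 ≤ 1 := by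
        refine le_trans (le_of_eq ?_) h3
        exact Finset.sum_congr rfl fun j _ => by simp only [hw']; split_ifs <;> simp
      have hw1 : ∀ j ∈ S, -1 ≤ w' j := fun j hj => by
        have := (Finset.single_le_sum (f := fun j => w' j ^ 2) (fun _ _ => sq_nonneg _) hj).trans h3'
        nlinarith
      have hpt : c + α • (z i - c) = ∑ j ∈ S, (α * (1 + w' j)) • z j := by
        have e : ∑ j ∈ S, (α * (1 + w' j)) • z j = α • ∑ j ∈ S, z j + α • ∑ j ∈ S, w' j • z j := by
          rw [Finset.smul_sum, Finset.smul_sum, ← Finset.sum_add_distrib]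
          exact Finset.sum_congr rfl fun j _ => by module
        rw [e, h2', ← hc]
        have : c = (α * (S.card + 1)) • c := by rw [hα1, one_smul]
        nth_rewrite 1 [this]
        module
      change c + α • (z i - c) ∈ hullOf z S
      rw [hpt]
      refine (convex_convexHull ℝ _).sum_mem (fun j hj => ?_) ?_ (fun j hj => mem_hullOf hj)
      · exact mul_nonneg hα0.le (by linarith [hw1 j hj])
      · rw [← Finset.mul_sum, Finset.sum_add_distrib, h1, Finset.sum_const, nsmul_eq_mul, mul_one,
          hα1]
    · intro x hx y hy a b ha hb hab
      have : c + α • (a • x + b • y - c) = a • (c + α • (x - c)) + b • (c + α • (y - c)) := by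
        have : c = (a + b) • c := by rw [hab, one_smul]
        conv_lhs => rw [this]
        module
      change c + α • (a • x + b • y - c) ∈ hullOf z S
      rw [this]
      exact convex_convexHull ℝ _ hx hy ha hb hab
  intro x hx
  refine ⟨_, hmem hx, ?_⟩
  simp only [add_sub_cancel_left, smul_smul]
  rw [one_div, inv_mul_cancel₀ hα0.ne', one_smul, add_sub_cancel]

end IsSelection

/-! ### The theorem -/

theorem theorem4 :
    ∃ (A : RealRAM.StreamAlg) (K k : ℕ) (C : ℝ),
      ∀ (d : ℕ), 1 ≤ d → ∀ (z : ℕ → EuclideanSpace ℝ (Fin d)),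
        ∃ (σ : ℕ → RealRAM.State) (τ : ℕ → ℕ),
          -- memory: `K d²` real cells
          RealRAM.IsRun A (K * d ^ 2) z σ τ ∧
          -- running time `Õ(n d²)`
          (∀ n : ℕ, 1 ≤ n →
            (RealRAM.totalTime d τ n : ℝ) ≤
              C * ((n : ℝ) * (d : ℝ) ^ 2) * (1 + Real.log ((n : ℝ) * (d : ℝ))) ^ k) ∧
          RealRAM.coreset σ 0 = ∅ ∧
          ∀ t : ℕ, 1 ≤ t →
            (RealRAM.coreset σ t = RealRAM.coreset σ (t - 1) ∨
              RealRAM.coreset σ t = RealRAM.coreset σ (t - 1) ∪ {t}) ∧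
            0 < (σ t).scale d ∧ (σ t).scale d ≤ 1 ∧
            hullOf z (RealRAM.coreset σ t) ⊆ hullOf z (Finset.Icc 1 t) ∧
            hullOf z (Finset.Icc 1 t) ⊆
              (fun x => (σ t).center d + (1 / (σ t).scale d) • (x - (σ t).center d)) ''
                hullOf z (RealRAM.coreset σ t) ∧
            -- general points
            (dimAt z t = 0 →
              1 / (σ t).scale d ≤ C ∧ ((RealRAM.coreset σ t).card : ℝ) ≤ C) ∧
            (dimAt z t = 1 →
              1 / (σ t).scale d ≤ C * (1 + Real.log (maxAspect z t)) ∧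
              ((RealRAM.coreset σ t).card : ℝ) ≤ C * (1 + Real.log (maxAspect z t))) ∧
            (2 ≤ dimAt z t →
              1 / (σ t).scale d ≤
                C * ((dimAt z t : ℝ) * Real.log ((dimAt z t : ℝ) * maxAspect z t)) ∧
              ((RealRAM.coreset σ t).card : ℝ) ≤
                C * ((dimAt z t : ℝ) * Real.log (maxAspect z t))) ∧
            -- integer points in `[-N, N]`
            (∀ N : ℕ, 2 ≤ d * N → 1 ≤ dimAt z t →
              (∀ i ∈ Finset.Icc 1 t, ∀ j : Fin d, ∃ a : ℤ, |a| ≤ (N : ℤ) ∧ z i j = (a : ℝ)) →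
              1 / (σ t).scale d ≤
                C * ((dimAt z t : ℝ) * Real.log ((d : ℝ) * (N : ℝ))) ∧
              ((RealRAM.coreset σ t).card : ℝ) ≤
                C * ((dimAt z t : ℝ) * Real.log ((d : ℝ) * (N : ℝ)))) := by
  -- No logarithmic factor is needed in the running time, hence $k=0$. The constant $C$ is dictated
  -- by the running time; the size bounds need far less.
  refine ⟨RealRAM.coresetAlg, 20, 0, 200000, fun d hd z => ?_⟩
  obtain ⟨σ, τ, hrun, hτ, hinv⟩ := RealRAM.exists_run hd z
  refine ⟨σ, τ, hrun, fun n hn => ?_, rfl, fun t ht => ?_⟩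
  · have h1 : RealRAM.totalTime d τ n ≤ 200000 * (n * d ^ 2) := by
      have hsum : ∑ t ∈ Finset.Icc 1 n, (d + τ t) ≤ n * (d + 60000 * d ^ 2) := by
        have := Finset.sum_le_card_nsmul (Finset.Icc 1 n) (fun t => d + τ t) (d + 60000 * d ^ 2)
          fun t _ => Nat.add_le_add_left (hτ t) d
        simpa using this
      have h0 := hτ 0
      have hdd : d ≤ d ^ 2 := by nlinarith
      have hnd : d ^ 2 ≤ n * d ^ 2 := Nat.le_mul_of_pos_left _ hn
      have hnd' : n * d ≤ n * d ^ 2 := Nat.mul_le_mul_left _ hdd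
      have hexp : n * (d + 60000 * d ^ 2) = n * d + 60000 * (n * d ^ 2) := by ring
      rw [RealRAM.totalTime]
      omega
    have h2 : (RealRAM.totalTime d τ n : ℝ) ≤ ((200000 * (n * d ^ 2) : ℕ) : ℝ) := by
      exact_mod_cast h1
    push_cast at h2
    simpa using h2
  · obtain ⟨-, -, hcenter, hscale, -, hsel⟩ := hinv t
    have hS := hscale ht
    set S := RealRAM.coreset σ t with hSdef
    have hα : 1 / (σ t).scale d = S.card + 1 := by rw [hS, one_div_one_div]
    have hm1 : (1 : ℝ) ≤ S.card := by
      exact_mod_cast Finset.card_pos.mpr ⟨1, hsel.one_mem ht⟩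
    refine ⟨?_, by rw [hS]; positivity, ?_, ?_, hsel.hullOf_subset hcenter hS, ?_, ?_, ?_, ?_⟩
    · obtain ⟨t, rfl⟩ : ∃ t', t = t' + 1 := ⟨t - 1, by omega⟩
      rw [hSdef, RealRAM.coreset, Nat.add_sub_cancel]
      split_ifs
      · exact Or.inl rfl
      · exact Or.inr rfl
    · rw [hS, div_le_one (by positivity)]
      linarith
    · exact convexHull_mono (Set.image_mono (Finset.coe_subset.mpr hsel.subset))
    · intro h0
      have := hsel.card_le_of_dimAt_eq_zero ht h0
      rw [hα]
      constructor <;> linarith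
    · intro h1
      have hb := hsel.card_le_of_maxAspect ht h1.ge
      have hL : 0 ≤ Real.log (maxAspect z t) :=
        Real.log_nonneg (hsel.aspect_facts ht h1.ge).2.1
      rw [h1] at hb
      push_cast at hb
      rw [hα]
      constructor <;> linarith
    · intro h2
      have hb := hsel.card_le_of_maxAspect ht (by omega)
      obtain ⟨-, hκ1, hκ2, -⟩ := hsel.aspect_facts ht (by omega)
      have hκ := hκ2 h2
      have hD : (2 : ℝ) ≤ dimAt z t := by exact_mod_cast h2
      -- From $\kappa\ge\frac54$ and $\log x\ge1-1/x$. With $\log\kappa$ bounded away from $0$, the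
      -- summand $1$ in $1+\log\kappa$ is absorbed into the constant.
      have hL : 1 / 5 ≤ Real.log (maxAspect z t) := by
        have h3 := Real.one_sub_inv_le_log_of_pos (show (0 : ℝ) < 5 / 4 by norm_num)
        have h4 := Real.log_le_log (by norm_num) hκ
        norm_num at h3
        linarith
      have hL' : Real.log (maxAspect z t) ≤ Real.log (dimAt z t * maxAspect z t) :=
        Real.log_le_log (by linarith) (by nlinarith)
      have hDL : (dimAt z t : ℝ) * Real.log (maxAspect z t) ≤
          dimAt z t * Real.log (dimAt z t * maxAspect z t) :=
        mul_le_mul_of_nonneg_left hL' (by linarith)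
      have hb' : (S.card : ℝ) ≤ 100 * (dimAt z t * Real.log (maxAspect z t)) := by
        refine hb.trans ?_
        generalize Real.log (maxAspect z t) = L at hL
        nlinarith [mul_nonneg (sub_nonneg.mpr hD) (sub_nonneg.mpr hL)]
      rw [hα]
      constructor <;> linarith
    · intro N hN h1 hz
      have hb := hsel.card_le_of_int_coords ht hN hz
      have hD : (1 : ℝ) ≤ dimAt z t := by exact_mod_cast h1
      have hL : 1 / 2 ≤ Real.log ((d : ℝ) * N) := by
        have h3 : Real.log 2 ≤ Real.log ((d : ℝ) * N) :=
          Real.log_le_log (by norm_num) (by exact_mod_cast hN)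
        have := Real.log_two_gt_d9
        linarith
      have hb' : (S.card : ℝ) ≤ 100 * (dimAt z t * Real.log ((d : ℝ) * N)) := by
        refine hb.trans ?_
        generalize Real.log ((d : ℝ) * N) = L at hL
        nlinarith [mul_nonneg (sub_nonneg.mpr hD) (sub_nonneg.mpr hL)]
      rw [hα]
      constructor <;> linarith
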